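/- Let $\Omega\subset\mathbb R^2$ be a bounded, open, connected set with a geometrically conforming triangulation $\mathcal T$ of $\overline\Omega$ into finitely many (affine) triangles, and let $\delta$ be the Euclidean metric. "Smooth on $T$" means $C^\infty$ up to the boundary of the closed element $T$. **Spaces.** $\mathcal R(\mathcal T)$ is the set of symmetric $(2,0)$-tensor fields $\sigma$ that are smooth on each $T\in\mathcal T$ and tangential-tangential continuous: $\sigma|_{T_+}(X,X)=\sigma|_{T_-}(X,X)$ for all $X$ tangent to an edge shared by $T_+,T_-$. $\mathcal R^+(\mathcal T)$ is the set of $g\in\mathcal R(\mathcal T)$ that are positive definite at every point of every (closed) element. $\mathring{\mathcal V}(\mathcal T)$ is the space of functions on $\overline\Omega$ that are continuous, smooth on each $T$, and zero on $\partial\Omega$; $\mathring{\mathcal V}_h^{k}$ is its subspace of functions that are polynomial of degree at most $k$ on each $T$. **Notation.** For $g\in\mathcal R^+(\mathcal T)$, $\int_{\mathcal T}f=\sum_T\int_T f\sqrt{\det g}\,da$, and $\int_{\partial\mathcal T}f=\sum_T\int_{\partial T}f$ with respect to the $g$-length element. Along $\partial T$, oriented counterclockwise, $\hat\tau$ is the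 $g$-unit tangent and $\hat\nu$ the $g$-unit normal such that $(\hat\tau,\hat\nu)$ is positively oriented. $K(g)$ is the elementwise Gauss curvature, $\kappa(g)=g(\nabla_{\hat\tau}\hat\tau,\hat\nu)$ the geodesic curvature of the element edges, and $\sphericalangle_V^Tg$ the interior angle of $T$ at its vertex $V$ in the metric $g$. **Curvature approximation.** Put $$\langle K_g,\varphi\rangle=\sum_{T}\Big(\int_{(T,g)}K(g)\,\varphi+\int_{(\partial T,g)}\kappa(g)\,\varphi\Big)+\sum_{V}\Big(2\pi-\sum_{T\ni V}\sphericalangle_V^Tg\Big)\varphi(V),$$ where the last outer sum is over all mesh vertices $V$ and the inner one over the elements with vertex $V$. For an integer $k\ge0$ let $K_h(g)\in\mathring{\mathcal V}_h^{k+1}$ be the function with $\int_{\mathcal T}K_h(g)\,u_h=\langle K_g,u_h\rangle$ for all $u_h\in\mathring{\mathcal V}_h^{k+1}$. **Distributional incompatibility.** For $g\in\mathcal R^+(\mathcal T)$, $\sigma\in\mathcal R(\mathcal T)$, $u\in\mathring{\mathcal V}(\mathcal T)$, on each element let $(\mathrm{curl}_g\sigma)(Z)=\star\, d^1\sigma_Z$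 with $(d^1\sigma_Z)(X,Y)=(\nabla_X\sigma)(Z,Y)-(\nabla_Y\sigma)(Z,X)$, let $\mathrm{rot}_gu=-(\star\,du)^\sharp$, and put $$\langle\mathrm{inc}_g\sigma,u\rangle=\int_{\mathcal T}(\mathrm{curl}_g\sigma)(\mathrm{rot}_gu)-\int_{\partial\mathcal T}g(\mathrm{rot}_gu,\hat\nu)\,\sigma(\hat\nu,\hat\tau),\qquad b_h(g,\sigma,u)=-\langle\mathrm{inc}_g\sigma,u\rangle .$$ **Claim.** Let $g\in\mathcal R^+(\mathcal T)$, $k\ge 0$, and let $\bar g$ be a Riemannian metric on $\Omega$ that is smooth and positive definite up to the boundary, with Gauss curvature $K(\bar g)$. Put $G(t)=\delta+t(g-\delta)$ and $\bar G(t)=\delta+t(\bar g-\delta)$. Then $K_h(g)$ exists and is unique, the functions of $t$ integrated below are integrable on $[0,1]$, and $$\int_{\mathcal T}K_h(g)\,u_h=\frac12\int_0^1b_h\big(G(t),g-\delta,u_h\big)\,dt\qquad\text{for all }u_h\in\mathring{\mathcal V}_h^{k+1},$$ $$\int_{\mathcal T}K(\bar g)\,u=\frac12\int_0^1b_h\big(\bar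 G(t),\bar g-\delta,u\big)\,dt\qquad\text{for all }u\in\mathring{\mathcal V}(\mathcal T),$$ where the left-hand integrals use the volume of $g$ and of $\bar g$, respectively. -/

import Mathlib

open scoped ContDiff
open Set

noncomputable section

namespace ReggeCurvature

/-- The coordinate plane with coordinates `x 0`, `x 1`. Only its vector space structure, topology,
smooth structure and Lebesgue measure are used; Euclidean lengths enter through the
identity metric `1`. -/
abbrev Plane : Type := Fin 2 → ℝ

/-- A `(2,0)`-tensor field in coordinates: `σ x i j = σ_{ij}(x)`. -/
abbrev TensorField : Type := Plane → Matrix (Fin 2) (Fin 2) ℝ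

/-- A vector field in coordinates. -/
abbrev VectorField : Type := Plane → Plane

/-- The value `(dx¹ ∧ dx²)(X, Y)`. -/
def area (X Y : Plane) : ℝ := X 0 * Y 1 - X 1 * Y 0

/-- The value `A(X, Y)` of a bilinear form on two tangent vectors. -/
def form (A : Matrix (Fin 2) (Fin 2) ℝ) (X Y : Plane) : ℝ := ∑ i, ∑ j, A i j * X i * Y j

/-- The coordinate vector `∂_i`. -/
def coordVec (i : Fin 2) : Plane := Pi.single i 1

/-! ### Riemannian geometry on a closed set `S` of the plane

`S` is a closed element or a closed domain; all derivatives are taken within `S`, so they are the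
one-sided ones at boundary points. -/

/-- The partial derivative `∂_i f`. -/
def pd (S : Set Plane) (i : Fin 2) (f : Plane → ℝ) (x : Plane) : ℝ :=
  fderivWithin ℝ f S x (coordVec i)

/-- Christoffel symbols of the first kind,
`Γ_{ijl} = (∂_i g_{jl} + ∂_j g_{li} - ∂_l g_{ij}) / 2`. -/
def christoffel₁ (S : Set Plane) (g : TensorField) (i j l : Fin 2) (x : Plane) : ℝ :=
  (pd S i (fun y => g y j l) x + pd S j (fun y => g y l i) x - pd S l (fun y => g y i j) x) / 2

/-- Christoffel symbols of the second kind, `Γ_{ij}^k = g^{kl} Γ_{ijl}`. -/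
def christoffel₂ (S : Set Plane) (g : TensorField) (i j k : Fin 2) (x : Plane) : ℝ :=
  ∑ l, (g x)⁻¹ k l * christoffel₁ S g i j l x

/-- The Levi-Civita covariant derivative `∇_X Y` of vector fields. -/
def covDeriv (S : Set Plane) (g : TensorField) (X Y : VectorField) : VectorField := fun x k =>
  ∑ i, X x i * (pd S i (fun y => Y y k) x + ∑ j, christoffel₂ S g i j k x * Y x j)

/-- The Lie bracket `[X, Y]`. -/
def lieBracket (S : Set Plane) (X Y : VectorField) : VectorField := fun x k =>
  ∑ i, (X x i * pd S i (fun y => Y y k) x - Y x i * pd S i (fun y => X y k) x)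

/-- The Riemann tensor `R(X,Y,Z,W) = g(∇_X ∇_Y Z - ∇_Y ∇_X Z - ∇_{[X,Y]} Z, W)`. -/
def riemann (S : Set Plane) (g : TensorField) (X Y Z W : VectorField) (x : Plane) : ℝ :=
  form (g x)
    (covDeriv S g X (covDeriv S g Y Z) x - covDeriv S g Y (covDeriv S g X Z) x
      - covDeriv S g (lieBracket S X Y) Z x)
    (W x)

/-- The Gauss curvature `K(g) = R(X,Y,Y,X) / (g(X,X) g(Y,Y) - g(X,Y)²)`, evaluated in the coordinate
frame `X = ∂_1`, `Y = ∂_2`. -/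
def gaussCurvature (S : Set Plane) (g : TensorField) (x : Plane) : ℝ :=
  riemann S g (fun _ => coordVec 0) (fun _ => coordVec 1) (fun _ => coordVec 1)
      (fun _ => coordVec 0) x
    / (form (g x) (coordVec 0) (coordVec 0) * form (g x) (coordVec 1) (coordVec 1)
        - form (g x) (coordVec 0) (coordVec 1) ^ 2)

/-- The `g`-unit vector `τ / √g(τ,τ)`. -/
def unitTangent (A : Matrix (Fin 2) (Fin 2) ℝ) (τ : Plane) : Plane :=
  (Real.sqrt (form A τ τ))⁻¹ • τ

/-- The vector `ν` with `g(ν, X) = (dx¹ ∧ dx²)(τ, X)` for all `X`, that is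
`ν^k = g^{kj} n_j` with `n = (-τ², τ¹)`. -/
def rawNormal (A : Matrix (Fin 2) (Fin 2) ℝ) (τ : Plane) : Plane :=
  A⁻¹.mulVec ![-(τ 1), τ 0]

/-- The `g`-unit normal, `ν / √g(ν,ν)`; the pair (unit tangent, unit normal) is a positively
oriented `g`-orthonormal basis. -/
def unitNormal (A : Matrix (Fin 2) (Fin 2) ℝ) (τ : Plane) : Plane :=
  (Real.sqrt (form A (rawNormal A τ) (rawNormal A τ)))⁻¹ • rawNormal A τ

/-- The geodesic curvature `κ(g) = g(∇_t t, n)` of a straight line of direction `τ`: its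
`g`-unit tangent is the restriction of the field `t(x) = τ / √g_x(τ,τ)`, `n` is the unit normal. -/
def geodesicCurvature (S : Set Plane) (g : TensorField) (τ : Plane) (x : Plane) : ℝ :=
  form (g x)
    (covDeriv S g (fun y => unitTangent (g y) τ) (fun y => unitTangent (g y) τ) x)
    (unitNormal (g x) τ)

/-- Components `(∇_{∂_j} σ)(∂_i, ∂_k) = ∂_j σ_{ik} - Γ_{ji}^m σ_{mk} - Γ_{jk}^m σ_{im}`. -/
def covDerivTensor (S : Set Plane) (g σ : TensorField) (j i k : Fin 2) (x : Plane) : ℝ :=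
  pd S j (fun y => σ y i k) x
    - ∑ m, (christoffel₂ S g j i m x * σ x m k + christoffel₂ S g j k m x * σ x i m)

/-- The covariant curl of a `(2,0)`-tensor, a 1-form with
`(curl_g σ)(Z) = ⋆ d¹σ_Z`, `(d¹σ_Z)(X,Y) = (∇_X σ)(Z,Y) - (∇_Y σ)(Z,X)`, where
`⋆ (f dx¹ ∧ dx²) = f / √(det g)`. This is its value at the vector `Z` attached to `x`. -/
def covCurl (S : Set Plane) (g σ : TensorField) (x Z : Plane) : ℝ :=
  ∑ i, Z i * ((covDerivTensor S g σ 0 i 1 x - covDerivTensor S g σ 1 i 0 x)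
    / Real.sqrt (g x).det)

/-- The covariant rot of a function, `rot_g u = -(⋆ d⁰u)^♯`, in coordinates
`[rot_g u]^k = ε^{kp} ∂_p u / √(det g)`. -/
def covRot (S : Set Plane) (g : TensorField) (u : Plane → ℝ) : VectorField := fun x =>
  (Real.sqrt (g x).det)⁻¹ • ![pd S 1 u x, -pd S 0 u x]

/-! ### Triangulations and piecewise smooth spaces -/

/-- A geometrically conforming triangulation of `closure Ω` into finitely many nondegenerate
triangles, the vertices of each listed counterclockwise. -/
structure Mesh (Ω : Set Plane) where
  /-- number of elements -/
  n : ℕ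
  /-- the three vertices of every element -/
  vert : Fin n → Fin 3 → Plane
  pos : ∀ T, 0 < area (vert T 1 - vert T 0) (vert T 2 - vert T 0)
  cover : ⋃ T, convexHull ℝ (range (vert T)) = closure Ω
  conforming : ∀ T T', convexHull ℝ (range (vert T)) ∩ convexHull ℝ (range (vert T'))
    = convexHull ℝ (range (vert T) ∩ range (vert T'))
  distinct : ∀ T T', range (vert T) = range (vert T') → T = T'

namespace Mesh

variable {Ω : Set Plane} (M : Mesh Ω)

/-- The closed triangle. -/
def elem (T : Fin M.n) : Set Plane := convexHull ℝ (range (M.vert T))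

/-- The tangent of edge `a` of `T`, which runs from vertex `a` to vertex `a + 1` (mod 3),
i.e. in the direction of the boundary orientation. -/
def tangent (T : Fin M.n) (a : Fin 3) : Plane := M.vert T (a + 1) - M.vert T a

/-- The set of all mesh vertices. -/
def vertices : Finset Plane :=
  Finset.univ.image (fun p : Fin M.n × Fin 3 => M.vert p.1 p.2)

/-- An elementwise defined tensor field; the values `σ T x` matter only for `x ∈ T`. -/
abbrev PiecewiseTensor : Type := Fin M.n → TensorField

/-- The space `S(𝒯)` of symmetric tensors with components smooth up to the boundary
of every element. -/
def IsPiecewiseSmoothSym (σ : M.PiecewiseTensor) : Prop :=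
  ∀ T, (∀ i j, ContDiffOn ℝ ∞ (fun x => σ T x i j) (M.elem T)) ∧
    ∀ x ∈ M.elem T, (σ T x).IsSymm

/-- Membership in `R(𝒯)`: symmetric, piecewise smooth, and tangential-tangential continuous across
every edge shared by two elements. -/
def IsRegge (σ : M.PiecewiseTensor) : Prop :=
  M.IsPiecewiseSmoothSym σ ∧
    ∀ T T', T ≠ T' → ∀ P Q : Plane, P ∈ range (M.vert T) ∩ range (M.vert T') →
      Q ∈ range (M.vert T) ∩ range (M.vert T') →
      ∀ x ∈ segment ℝ P Q, form (σ T x) (Q - P) (Q - P) = form (σ T' x) (Q - P) (Q - P)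

/-- Membership in `R⁺(𝒯)`: the positive definite members of `R(𝒯)`. -/
def IsReggeMetric (g : M.PiecewiseTensor) : Prop :=
  M.IsRegge g ∧ ∀ T, ∀ x ∈ M.elem T, (g T x).PosDef

/-- Membership in `V̊(𝒯)`: continuous on `closure Ω`, smooth on every closed element, and
vanishing on the boundary; functions on `closure Ω` are extended by zero to the plane. -/
def IsTestFunction (u : Plane → ℝ) : Prop :=
  ContinuousOn u (closure Ω) ∧ (∀ T, ContDiffOn ℝ ∞ u (M.elem T)) ∧ ∀ x, x ∉ Ω → u x = 0

/-- Membership in the Lagrange space `V̊_h^k` of continuous, piecewise polynomial functions of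
degree at most `k` vanishing on the boundary. (The elements are affine images of the
reference triangle, so polynomials on the reference triangle and on the element correspond.) -/
def IsLagrange (k : ℕ) (u : Plane → ℝ) : Prop :=
  M.IsTestFunction u ∧
    ∀ T, ∃ p : MvPolynomial (Fin 2) ℝ, p.totalDegree ≤ k ∧
      ∀ x ∈ M.elem T, u x = MvPolynomial.eval x p

/-! ### Integrals -/

/-- `∫_{(T,g)} f = ∫_T f √(det g) da`. -/
def elemIntegral (g : M.PiecewiseTensor) (T : Fin M.n) (f : Plane → ℝ) : ℝ :=
  ∫ x in M.elem T, f x * Real.sqrt (g T x).det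

/-- `∫_𝒯 f`, the sum of the integrals over the elements, with respect to the volume of `g`. -/
def meshIntegral (g : M.PiecewiseTensor) (f : Plane → ℝ) : ℝ := ∑ T, M.elemIntegral g T f

/-- `∫_{(E,g)} f` over edge `a` of `T`, with the length element of `g`, computed with the
parametrization `γ(s) = V + s τ`, `0 ≤ s ≤ 1`. -/
def edgeIntegral (g : M.PiecewiseTensor) (T : Fin M.n) (a : Fin 3) (f : Plane → ℝ) : ℝ :=
  ∫ s in (0 : ℝ)..1, f (M.vert T a + s • M.tangent T a) *
    Real.sqrt (form (g T (M.vert T a + s • M.tangent T a)) (M.tangent T a) (M.tangent T a))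

/-! ### The curvature functional and its finite element representative -/

/-- The interior angle of `T` at its vertex `a` in the metric `g`: the arccosine of
`g(-τ₋, τ₊) / (√g(τ₋,τ₋) √g(τ₊,τ₊))` for the incoming and outgoing edge tangents `τ₋`, `τ₊`. -/
def interiorAngle (g : M.PiecewiseTensor) (T : Fin M.n) (a : Fin 3) : ℝ :=
  Real.arccos
    (form (g T (M.vert T a)) (-M.tangent T (a - 1)) (M.tangent T a)
      / (Real.sqrt (form (g T (M.vert T a)) (M.tangent T (a - 1)) (M.tangent T (a - 1)))
        * Real.sqrt (form (g T (M.vert T a)) (M.tangent T a) (M.tangent T a))))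

/-- The angle deficit `2π - ∑ ∢_V^T g`, summed over the elements having `V` as a vertex. -/
def angleDeficit (g : M.PiecewiseTensor) (V : Plane) : ℝ :=
  2 * Real.pi - ∑ T, ∑ a, if M.vert T a = V then M.interiorAngle g T a else 0

/-- The functional `K_g` with element, edge and vertex sources of curvature. -/
def curvatureFunctional (g : M.PiecewiseTensor) (φ : Plane → ℝ) : ℝ :=
  ∑ T, (M.elemIntegral g T (fun x => gaussCurvature (M.elem T) (g T) x * φ x)
      + ∑ a, M.edgeIntegral g T a
          (fun x => geodesicCurvature (M.elem T) (g T) (M.tangent T a) x * φ x))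
    + ∑ V ∈ M.vertices, M.angleDeficit g V * φ V

/-- `K` is the finite element curvature approximation `K_h(g)` of degree `k + 1`, with homogeneous
Dirichlet data on the whole boundary. -/
def IsCurvatureApprox (g : M.PiecewiseTensor) (k : ℕ) (K : Plane → ℝ) : Prop :=
  M.IsLagrange (k + 1) K ∧
    ∀ u, M.IsLagrange (k + 1) u →
      M.meshIntegral g (fun x => K x * u x) = M.curvatureFunctional g u

/-! ### Distributional covariant curl and incompatibility -/

/-- The distributional covariant curl acting on a piecewise smooth vector field,
`⟨curl_g σ, W⟩ = ∫_𝒯 (curl_g σ)(W) - ∫_{∂𝒯} g(W, n) σ(n, t)`. -/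
def distCurl (g σ : M.PiecewiseTensor) (W : Fin M.n → VectorField) : ℝ :=
  ∑ T, M.elemIntegral g T (fun x => covCurl (M.elem T) (g T) (σ T) x (W T x))
    - ∑ T, ∑ a, M.edgeIntegral g T a (fun x =>
        form (g T x) (W T x) (unitNormal (g T x) (M.tangent T a))
          * form (σ T x) (unitNormal (g T x) (M.tangent T a))
              (unitTangent (g T x) (M.tangent T a)))

/-- The distributional covariant incompatibility, `⟨inc_g σ, u⟩ = ⟨curl_g σ, rot_g u⟩`. -/
def distInc (g σ : M.PiecewiseTensor) (u : Plane → ℝ) : ℝ :=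
  M.distCurl g σ (fun T => covRot (M.elem T) (g T) u)

/-- `b_h(g, σ, u) = -⟨inc_g σ, u⟩`. -/
def bForm (g σ : M.PiecewiseTensor) (u : Plane → ℝ) : ℝ := -M.distInc g σ u

/-- The difference `g - δ` from the Euclidean metric. -/
def deviation (g : M.PiecewiseTensor) : M.PiecewiseTensor := fun T x => g T x - 1

/-- The path `G(t) = δ + t (g - δ)`. -/
def metricPath (g : M.PiecewiseTensor) (t : ℝ) : M.PiecewiseTensor :=
  fun T x => 1 + t • (g T x - 1)

/-- A globally defined tensor field regarded as an elementwise defined one. -/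
def restrict (σ : TensorField) : M.PiecewiseTensor := fun _ => σ

end Mesh

/-- A Riemannian metric on `Ω`, smooth and positive definite up to the boundary. -/
def IsSmoothMetric (Ω : Set Plane) (g : TensorField) : Prop :=
  (∀ i j, ContDiffOn ℝ ∞ (fun x => g x i j) (closure Ω)) ∧ ∀ x ∈ closure Ω, (g x).PosDef

end ReggeCurvature

end

/-! On one triangle, orthonormalise the coordinate frame starting from ∂_1. Its connection form ω
(`connForm`) satisfies dω = K vol, and along a straight edge, with θ the angle from ∂_1 to the edge
direction (`frameAngle`), κ ds = dθ - ω. Green's theorem and integration by parts therefore turn the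
element and edge curvature tested with φ into -∫ dφ∧ω - ∑ ∫ θ dφ plus the corner terms φ(V)
(θ(incoming edge) - θ(outgoing edge)); this is `triangleCurvature_eq`.

Now let the metric run along δ + tσ and differentiate in t. The rate of ω is -½ curl σ - dα, and the
rate of θ on an edge is ½ σ(ν,τ) - α for the unit normal and tangent. Here α (`frameSpin`) is a
gauge term, due to the preference given to ∂_1. Since ∫ dφ∧dα = -∮ α dφ, it drops out of the sum of
element and edge terms, and half the contribution of the triangle to inc remains (`triangleInc_eq`).
At a corner, θ(incoming) - θ(outgoing) and the interior angle have the same derivative in t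
(`frameAngle_sub_cornerAngle`); as only rates are compared, no multiple of 2π has to be tracked.
Integrating over [0,1] gives `triangleCurvature_eq_integral`: the curvature of a triangle minus its
weighted interior angles equals -½ ∫ inc dt minus the weighted Euclidean angles.

In the sum over the triangles the Euclidean angles at a mesh vertex in Ω add up to 2π, and u
vanishes at the other vertices, so exactly the angle deficits of g are left. The value 2π comes from
areas: in a coordinate conformal for a given inner product, the corners at the vertex cut a small
disc into sectors with null overlaps, and the area of a sector is proportional to its angle
(`sum_cornerAngle`). This proves the integral formula for the functional K_g
(`curvatureFunctional_eq_integral`), hence for K_h(g), which exists and is unique because the mass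
form is positive definite on a finite-dimensional space.

For a globally smooth metric the functional reduces to ∫ K u (`curvatureFunctional_restrict`): an
edge shared by two elements is traversed in both directions and geodesic curvature is odd in the
direction, while at a vertex all angles are measured in one inner product, so that the deficit is
zero. -/

noncomputable section

namespace ReggeCurvature

section

/-! ### Calculus of one-sided partial derivatives -/

/-- `f` is differentiable within `S` at `x` and its partial derivative `∂_i f` is `d`. -/
def HasPd (S : Set Plane) (i : Fin 2) (f : Plane → ℝ) (d : ℝ) (x : Plane) : Prop :=
  DifferentiableWithinAt ℝ f S x ∧ pd S i f x = d

namespace HasPd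

variable {S : Set Plane} {i : Fin 2} {f h : Plane → ℝ} {d e : ℝ} {x : Plane}

theorem of_differentiable (hf : DifferentiableWithinAt ℝ f S x) : HasPd S i f (pd S i f x) x :=
  ⟨hf, rfl⟩

theorem of_hasFDerivWithinAt (hS : UniqueDiffWithinAt ℝ S x) {L : Plane →L[ℝ] ℝ}
    (hf : HasFDerivWithinAt f L S x) (hd : L (coordVec i) = d) : HasPd S i f d x :=
  ⟨hf.differentiableWithinAt, by rw [pd, hf.fderivWithin hS, hd]⟩

theorem pd_eq (hf : HasPd S i f d x) : pd S i f x = d := hf.2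

theorem congr (hf : HasPd S i f d x) (hh : EqOn h f S) (hx : x ∈ S) : HasPd S i h d x :=
  ⟨hf.1.congr hh (hh hx), by rw [pd, fderivWithin_congr hh (hh hx)]; exact hf.2⟩

theorem congr_value (hf : HasPd S i f d x) (hd : d = e) : HasPd S i f e x := hd ▸ hf

theorem const (hS : UniqueDiffWithinAt ℝ S x) (k : ℝ) : HasPd S i (fun _ => k) 0 x :=
  of_hasFDerivWithinAt hS (hasFDerivWithinAt_const k x S) rfl

theorem add (hS : UniqueDiffWithinAt ℝ S x) (hf : HasPd S i f d x) (hh : HasPd S i h e x) :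
    HasPd S i (fun y => f y + h y) (d + e) x := by
  refine of_hasFDerivWithinAt hS (hf.1.hasFDerivWithinAt.add hh.1.hasFDerivWithinAt) ?_
  rw [← hf.2, ← hh.2]; rfl

theorem sub (hS : UniqueDiffWithinAt ℝ S x) (hf : HasPd S i f d x) (hh : HasPd S i h e x) :
    HasPd S i (fun y => f y - h y) (d - e) x := by
  refine of_hasFDerivWithinAt hS (hf.1.hasFDerivWithinAt.sub hh.1.hasFDerivWithinAt) ?_
  rw [← hf.2, ← hh.2]; rfl

theorem neg (hS : UniqueDiffWithinAt ℝ S x) (hf : HasPd S i f d x) :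
    HasPd S i (fun y => -f y) (-d) x := by
  refine of_hasFDerivWithinAt hS hf.1.hasFDerivWithinAt.neg ?_
  rw [← hf.2]; rfl

theorem mul (hS : UniqueDiffWithinAt ℝ S x) (hf : HasPd S i f d x) (hh : HasPd S i h e x) :
    HasPd S i (fun y => f y * h y) (d * h x + f x * e) x := by
  refine of_hasFDerivWithinAt hS (hf.1.hasFDerivWithinAt.mul hh.1.hasFDerivWithinAt) ?_
  rw [← hf.2, ← hh.2]
  simp [pd]; ring

theorem const_mul (hS : UniqueDiffWithinAt ℝ S x) (k : ℝ) (hf : HasPd S i f d x) :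
    HasPd S i (fun y => k * f y) (k * d) x :=
  (mul hS (const hS k) hf).congr_value (by ring)

theorem comp (hS : UniqueDiffWithinAt ℝ S x) {F : ℝ → ℝ} {F' : ℝ} (hF : HasDerivAt F F' (f x))
    (hf : HasPd S i f d x) : HasPd S i (fun y => F (f y)) (F' * d) x := by
  refine of_hasFDerivWithinAt hS (hF.comp_hasFDerivWithinAt x hf.1.hasFDerivWithinAt) ?_
  rw [← hf.2]; rfl

theorem div (hS : UniqueDiffWithinAt ℝ S x) (hf : HasPd S i f d x) (hh : HasPd S i h e x)
    (h0 : h x ≠ 0) : HasPd S i (fun y => f y / h y) (d / h x - f x * e / h x ^ 2) x := by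
  have h1 := comp hS (hasDerivAt_inv h0) hh
  exact ((mul hS hf h1).congr_value (by field_simp; ring))

/-- The quotient rule for `f / √h`. -/
theorem div_sqrt (hS : UniqueDiffWithinAt ℝ S x) (hf : HasPd S i f d x) (hh : HasPd S i h e x)
    (h0 : 0 < h x) : HasPd S i (fun y => f y / Real.sqrt (h y))
      ((d - f x * e / (2 * h x)) / Real.sqrt (h x)) x := by
  have h1 := comp hS (Real.hasDerivAt_sqrt h0.ne') hh
  have h2 : Real.sqrt (h x) ≠ 0 := (Real.sqrt_pos.2 h0).ne'
  refine (div hS hf h1 h2).congr_value ?_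
  have h3 : Real.sqrt (h x) ^ 2 = h x := Real.sq_sqrt h0.le
  rw [h3]
  field_simp

end HasPd

/-- Partial derivatives in a larger set agree with those in a smaller one. -/
theorem pd_mono {S S' : Set Plane} (hSS : S' ⊆ S) {x : Plane} (hS' : UniqueDiffWithinAt ℝ S' x)
    {f : Plane → ℝ} (hf : DifferentiableWithinAt ℝ f S x) (i : Fin 2) :
    pd S' i f x = pd S i f x := by
  rw [pd, pd, fderivWithin_subset hSS hS' hf]

theorem pd_congr {S : Set Plane} {f h : Plane → ℝ} {x : Plane} (hfh : EqOn f h S) (hx : x ∈ S)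
    (i : Fin 2) : pd S i f x = pd S i h x := by
  rw [pd, pd, fderivWithin_congr hfh (hfh hx)]

theorem contDiffOn_pd {S : Set Plane} (hS : UniqueDiffOn ℝ S) {f : Plane → ℝ}
    (hf : ContDiffOn ℝ ∞ f S) (i : Fin 2) : ContDiffOn ℝ ∞ (pd S i f) S :=
  (hf.fderivWithin hS (by simp)).clm_apply contDiffOn_const

theorem differentiableWithinAt_of_smooth {S : Set Plane} {f : Plane → ℝ}
    (hf : ContDiffOn ℝ ∞ f S) {x : Plane} (hx : x ∈ S) : DifferentiableWithinAt ℝ f S x :=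
  (hf.differentiableOn (by simp)) x hx

/-- At boundary points the symmetry of the second derivative is inherited from the interior by
continuity; this is the role of `S ⊆ closure (interior S)`. -/
theorem pd_comm {S : Set Plane} (hS : UniqueDiffOn ℝ S) (hcl : S ⊆ closure (interior S))
    {f : Plane → ℝ} (hf : ContDiffOn ℝ ∞ f S) {x : Plane} (hx : x ∈ S) :
    pd S 0 (pd S 1 f) x = pd S 1 (pd S 0 f) x := by
  have hsym : IsSymmSndFDerivWithinAt ℝ f S x :=
    (hf x hx).isSymmSndFDerivWithinAt (by simpa using (ENat.LEInfty.out : (2 : WithTop ℕ∞) ≤ ∞)) hS (hcl hx) hx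
  have hd : DifferentiableWithinAt ℝ (fderivWithin ℝ f S) S x :=
    ((hf.fderivWithin (m := ∞) hS (by simp)).differentiableOn (by simp)) x hx
  have key : ∀ i j, pd S i (pd S j f) x
      = fderivWithin ℝ (fderivWithin ℝ f S) S x (coordVec i) (coordVec j) := by
    intro i j
    have h1 := hd.hasFDerivWithinAt.clm_apply (hasFDerivWithinAt_const (coordVec j) x S)
    have : HasPd S i (pd S j f) _ x := HasPd.of_hasFDerivWithinAt (hS x hx) h1 rfl
    rw [this.2]; simp
  rw [key, key]
  exact hsym _ _

/-! ### Metrics on a closed set -/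

/-- A symmetric tensor field, smooth up to the boundary of `S`. -/
def SmoothSym (S : Set Plane) (σ : TensorField) : Prop :=
  (∀ i j, ContDiffOn ℝ ∞ (fun x => σ x i j) S) ∧ ∀ x ∈ S, σ x 1 0 = σ x 0 1

/-- Positivity of a symmetric `2 × 2` matrix by its minors. -/
def PosMinors (A : Matrix (Fin 2) (Fin 2) ℝ) : Prop :=
  0 < A 0 0 ∧ 0 < A.det ∧ A 1 0 = A 0 1

theorem PosMinors.det_eq {A : Matrix (Fin 2) (Fin 2) ℝ} (hA : PosMinors A) :
    A.det = A 0 0 * A 1 1 - A 0 1 ^ 2 := by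
  rw [Matrix.det_fin_two, hA.2.2]; ring

theorem PosMinors.sqrt_pos {A : Matrix (Fin 2) (Fin 2) ℝ} (hA : PosMinors A) :
    0 < Real.sqrt A.det := Real.sqrt_pos.2 hA.2.1

theorem posMinors_of_posDef {A : Matrix (Fin 2) (Fin 2) ℝ} (hA : A.PosDef) : PosMinors A := by
  refine ⟨?_, hA.det_pos, ?_⟩
  · exact hA.diag_pos
  · simpa using hA.isHermitian.apply 0 1

theorem form_eq (A : Matrix (Fin 2) (Fin 2) ℝ) (X Y : Plane) :
    form A X Y = A 0 0 * X 0 * Y 0 + A 0 1 * X 0 * Y 1 + A 1 0 * X 1 * Y 0 + A 1 1 * X 1 * Y 1 := by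
  simp only [form, Fin.sum_univ_two]; ring

theorem PosMinors.form_eq {A : Matrix (Fin 2) (Fin 2) ℝ} (hA : PosMinors A) (X Y : Plane) :
    form A X Y = A 0 0 * X 0 * Y 0 + A 0 1 * (X 0 * Y 1 + X 1 * Y 0) + A 1 1 * X 1 * Y 1 := by
  rw [ReggeCurvature.form_eq, hA.2.2]; ring

theorem PosMinors.form_pos {A : Matrix (Fin 2) (Fin 2) ℝ} (hA : PosMinors A) {τ : Plane}
    (hτ : τ ≠ 0) : 0 < form A τ τ := by
  have h1 : A 0 0 * form A τ τ = (A 0 0 * τ 0 + A 0 1 * τ 1) ^ 2 + A.det * τ 1 ^ 2 := by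
    rw [hA.form_eq, hA.det_eq]; ring
  have h2 : 0 < A 0 0 * form A τ τ := by
    rw [h1]
    by_cases h : τ 1 = 0
    · have h0 : τ 0 ≠ 0 := fun h0 => hτ (by ext i; fin_cases i <;> simp [h, h0])
      have := hA.1
      have h' : 0 < (A 0 0 * τ 0) ^ 2 := by positivity
      simpa only [h, mul_zero, add_zero, ne_eq, OfNat.ofNat_ne_zero, not_false_eq_true, zero_pow] using h'
    · have := hA.2.1
      positivity
  exact pos_of_mul_pos_right h2 hA.1.le

theorem PosMinors.inv_apply {A : Matrix (Fin 2) (Fin 2) ℝ} (hA : PosMinors A) :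
    A⁻¹ 0 0 = A 1 1 / A.det ∧ A⁻¹ 0 1 = -A 0 1 / A.det ∧ A⁻¹ 1 0 = -A 0 1 / A.det ∧
      A⁻¹ 1 1 = A 0 0 / A.det := by
  have := hA.2.1.ne'
  rw [Matrix.inv_def, Matrix.adjugate_fin_two, Ring.inverse_eq_inv']
  simp [hA.2.2, div_eq_inv_mul]

variable {S : Set Plane} {g σ : TensorField} {x : Plane}

theorem SmoothSym.pd_symm (hσ : SmoothSym S σ) (hx : x ∈ S) (i : Fin 2) :
    pd S i (fun y => σ y 1 0) x = pd S i (fun y => σ y 0 1) x :=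
  pd_congr (fun y hy => hσ.2 y hy) hx i

theorem SmoothSym.christoffel₁_eq (hσ : SmoothSym S σ) (hx : x ∈ S) :
    christoffel₁ S σ 0 0 0 x = pd S 0 (fun y => σ y 0 0) x / 2 ∧
    christoffel₁ S σ 0 0 1 x = pd S 0 (fun y => σ y 0 1) x - pd S 1 (fun y => σ y 0 0) x / 2 ∧
    christoffel₁ S σ 0 1 0 x = pd S 1 (fun y => σ y 0 0) x / 2 ∧
    christoffel₁ S σ 1 0 0 x = pd S 1 (fun y => σ y 0 0) x / 2 ∧
    christoffel₁ S σ 0 1 1 x = pd S 0 (fun y => σ y 1 1) x / 2 ∧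
    christoffel₁ S σ 1 0 1 x = pd S 0 (fun y => σ y 1 1) x / 2 ∧
    christoffel₁ S σ 1 1 0 x = pd S 1 (fun y => σ y 0 1) x - pd S 0 (fun y => σ y 1 1) x / 2 ∧
    christoffel₁ S σ 1 1 1 x = pd S 1 (fun y => σ y 1 1) x / 2 := by
  have h := hσ.pd_symm hx
  simp only [christoffel₁, h]
  refine ⟨?_, ?_, ?_, ?_, ?_, ?_, ?_, ?_⟩ <;> ring

theorem christoffel₂_zero (hA : PosMinors (g x)) (i j : Fin 2) :
    christoffel₂ S g i j 0 x
      = (g x 1 1 * christoffel₁ S g i j 0 x - g x 0 1 * christoffel₁ S g i j 1 x) / (g x).det := by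
  obtain ⟨h1, h2, -, -⟩ := hA.inv_apply
  simp only [christoffel₂, Fin.sum_univ_two, h1, h2]; ring

theorem christoffel₂_one (hA : PosMinors (g x)) (i j : Fin 2) :
    christoffel₂ S g i j 1 x
      = (g x 0 0 * christoffel₁ S g i j 1 x - g x 0 1 * christoffel₁ S g i j 0 x) / (g x).det := by
  obtain ⟨-, -, h1, h2⟩ := hA.inv_apply
  simp only [christoffel₂, Fin.sum_univ_two, h1, h2]; ring

/-- The connection form of the orthonormal frame obtained from `∂_1`, with the sign for which
its exterior derivative is the curvature form. -/
def connForm (S : Set Plane) (g : TensorField) (i : Fin 2) (x : Plane) : ℝ :=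
  -(christoffel₁ S g i 0 1 x - g x 0 1 / g x 0 0 * christoffel₁ S g i 0 0 x)
    / Real.sqrt (g x).det

theorem covDeriv_const (hS : UniqueDiffOn ℝ S) (i j : Fin 2) (hx : x ∈ S) (k : Fin 2) :
    covDeriv S g (fun _ => coordVec i) (fun _ => coordVec j) x k = christoffel₂ S g i j k x := by
  have h0 : ∀ l m : Fin 2, pd S l (fun _ => coordVec j m) x = 0 := fun l m =>
    (HasPd.const (hS x hx) _).2
  simp only [covDeriv, h0]
  fin_cases i <;> fin_cases j <;> simp [coordVec, Fin.sum_univ_two]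

theorem lieBracket_const (hS : UniqueDiffOn ℝ S) (i j : Fin 2) (hx : x ∈ S) :
    lieBracket S (fun _ => coordVec i) (fun _ => coordVec j) x = 0 := by
  have h0 : ∀ j l m : Fin 2, pd S l (fun _ => coordVec j m) x = 0 := fun j l m =>
    (HasPd.const (hS x hx) _).2
  ext k
  simp [lieBracket, h0]

end

section

/-! ### Gauss curvature, geodesic curvature and the connection form -/

variable {S : Set Plane} {g σ : TensorField} {x : Plane}

/-- The Gauss curvature form is the exterior derivative of the connection form. -/
theorem gaussCurvature_mul_sqrt_det (hS : UniqueDiffOn ℝ S) (hcl : S ⊆ closure (interior S))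
    (hg : SmoothSym S g) (hpos : ∀ x ∈ S, PosMinors (g x)) (hx : x ∈ S) :
    gaussCurvature S g x * Real.sqrt (g x).det
      = pd S 0 (connForm S g 1) x - pd S 1 (connForm S g 0) x := by
  have hu := hS x hx
  have hA := hpos x hx
  have hDpos := hA.2.1
  -- Opaque names keep the metric components atomic while the rules of differentiation are applied.
  obtain ⟨a, ha⟩ : ∃ a : Plane → ℝ, a = fun y => g y 0 0 := ⟨_, rfl⟩
  obtain ⟨b, hb⟩ : ∃ b : Plane → ℝ, b = fun y => g y 0 1 := ⟨_, rfl⟩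
  obtain ⟨c, hc⟩ : ∃ c : Plane → ℝ, c = fun y => g y 1 1 := ⟨_, rfl⟩
  have sa : ContDiffOn ℝ ∞ a S := ha ▸ hg.1 0 0
  have sb : ContDiffOn ℝ ∞ b S := hb ▸ hg.1 0 1
  have sc : ContDiffOn ℝ ∞ c S := hc ▸ hg.1 1 1
  have P : ∀ {f : Plane → ℝ}, ContDiffOn ℝ ∞ f S → ∀ i, HasPd S i f (pd S i f x) x :=
    fun hf i => HasPd.of_differentiable (differentiableWithinAt_of_smooth hf hx)
  have PP : ∀ {f : Plane → ℝ}, ContDiffOn ℝ ∞ f S → ∀ i j,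
      HasPd S i (pd S j f) (pd S i (pd S j f) x) x := fun hf i j => P (contDiffOn_pd hS hf j) i
  have hD : ∀ y ∈ S, (g y).det = a y * c y - b y * b y := fun y hy => by
    rw [(hpos y hy).det_eq, ha, hb, hc]; ring
  have hDx := hD x hx
  have hD0 : 0 < a x * c x - b x * b x := hDx ▸ hDpos
  have ha0 : a x ≠ 0 := by rw [ha]; exact hA.1.ne'
  have pD : ∀ i, HasPd S i (fun y => a y * c y - b y * b y) _ x := fun i =>
    ((P sa i).mul hu (P sc i)).sub hu ((P sb i).mul hu (P sb i))
  -- Christoffel symbols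
  have e110 : EqOn (fun y => christoffel₂ S g 1 1 0 y) (fun y =>
      (c y * (pd S 1 b y - (1 / 2) * pd S 0 c y) - b y * ((1 / 2) * pd S 1 c y))
        / (a y * c y - b y * b y)) S := fun y hy => by
    obtain ⟨-, -, -, -, -, -, h1, h2⟩ := hg.christoffel₁_eq hy
    simp only [christoffel₂_zero (hpos y hy), h1, h2, hD y hy]
    simp only [ha, hb, hc]; ring
  have e111 : EqOn (fun y => christoffel₂ S g 1 1 1 y) (fun y =>
      (a y * ((1 / 2) * pd S 1 c y) - b y * (pd S 1 b y - (1 / 2) * pd S 0 c y))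
        / (a y * c y - b y * b y)) S := fun y hy => by
    obtain ⟨-, -, -, -, -, -, h1, h2⟩ := hg.christoffel₁_eq hy
    simp only [christoffel₂_one (hpos y hy), h1, h2, hD y hy]
    simp only [ha, hb, hc]; ring
  have e010 : EqOn (fun y => christoffel₂ S g 0 1 0 y) (fun y =>
      (c y * ((1 / 2) * pd S 1 a y) - b y * ((1 / 2) * pd S 0 c y))
        / (a y * c y - b y * b y)) S := fun y hy => by
    obtain ⟨-, -, h1, -, h2, -, -, -⟩ := hg.christoffel₁_eq hy
    simp only [christoffel₂_zero (hpos y hy), h1, h2, hD y hy]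
    simp only [ha, hb, hc]; ring
  have e011 : EqOn (fun y => christoffel₂ S g 0 1 1 y) (fun y =>
      (a y * ((1 / 2) * pd S 0 c y) - b y * ((1 / 2) * pd S 1 a y))
        / (a y * c y - b y * b y)) S := fun y hy => by
    obtain ⟨-, -, h1, -, h2, -, -, -⟩ := hg.christoffel₁_eq hy
    simp only [christoffel₂_one (hpos y hy), h1, h2, hD y hy]
    simp only [ha, hb, hc]; ring
  have e000 : christoffel₂ S g 0 0 0 x =
      (c x * ((1 / 2) * pd S 0 a x) - b x * (pd S 0 b x - (1 / 2) * pd S 1 a x))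
        / (a x * c x - b x * b x) := by
    obtain ⟨h1, h2, -⟩ := hg.christoffel₁_eq hx
    simp only [christoffel₂_zero hA, h1, h2, hDx]
    simp only [ha, hb, hc]; ring
  have e001 : christoffel₂ S g 0 0 1 x =
      (a x * (pd S 0 b x - (1 / 2) * pd S 1 a x) - b x * ((1 / 2) * pd S 0 a x))
        / (a x * c x - b x * b x) := by
    obtain ⟨h1, h2, -⟩ := hg.christoffel₁_eq hx
    simp only [christoffel₂_one hA, h1, h2, hDx]
    simp only [ha, hb, hc]; ring
  have e100 : christoffel₂ S g 1 0 0 x = christoffel₂ S g 0 1 0 x := by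
    obtain ⟨-, -, h1, h2, h3, h4, -⟩ := hg.christoffel₁_eq hx
    simp only [christoffel₂_zero hA, h1, h2, h3, h4]
  have e101 : christoffel₂ S g 1 0 1 x = christoffel₂ S g 0 1 1 x := by
    obtain ⟨-, -, h1, h2, h3, h4, -⟩ := hg.christoffel₁_eq hx
    simp only [christoffel₂_one hA, h1, h2, h3, h4]
  -- connection form
  have w1 : EqOn (connForm S g 1) (fun y =>
      (b y / a y * ((1 / 2) * pd S 1 a y) - (1 / 2) * pd S 0 c y)
        / Real.sqrt (a y * c y - b y * b y)) S := fun y hy => by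
    obtain ⟨-, -, -, h1, -, h2, -, -⟩ := hg.christoffel₁_eq hy
    simp only [connForm, h1, h2, hD y hy]
    simp only [ha, hb, hc]; ring
  have w0 : EqOn (connForm S g 0) (fun y =>
      (b y / a y * ((1 / 2) * pd S 0 a y) - (pd S 0 b y - (1 / 2) * pd S 1 a y))
        / Real.sqrt (a y * c y - b y * b y)) S := fun y hy => by
    obtain ⟨h1, h2, -⟩ := hg.christoffel₁_eq hy
    simp only [connForm, h1, h2, hD y hy]
    simp only [ha, hb, hc]; ring
  have dw1 := ((((((P sb 0).div hu (P sa 0) ha0).mul hu ((PP sa 0 1).const_mul hu (1 / 2))).sub hu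
    ((PP sc 0 0).const_mul hu (1 / 2))).div_sqrt hu (pD 0) hD0).congr w1 hx).pd_eq
  have dw0 := ((((((P sb 1).div hu (P sa 1) ha0).mul hu ((PP sa 1 0).const_mul hu (1 / 2))).sub hu
    ((PP sb 1 0).sub hu ((PP sa 1 1).const_mul hu (1 / 2)))).div_sqrt hu (pD 1) hD0).congr w0
    hx).pd_eq
  have d110 := (((((P sc 0).mul hu ((PP sb 0 1).sub hu ((PP sc 0 0).const_mul hu (1 / 2)))).sub hu
    ((P sb 0).mul hu ((PP sc 0 1).const_mul hu (1 / 2)))).div hu (pD 0) hD0.ne').congr e110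
    hx).pd_eq
  have d111 := (((((P sa 0).mul hu ((PP sc 0 1).const_mul hu (1 / 2))).sub hu
    ((P sb 0).mul hu ((PP sb 0 1).sub hu ((PP sc 0 0).const_mul hu (1 / 2))))).div hu (pD 0)
    hD0.ne').congr e111 hx).pd_eq
  have d010 := (((((P sc 1).mul hu ((PP sa 1 1).const_mul hu (1 / 2))).sub hu
    ((P sb 1).mul hu ((PP sc 1 0).const_mul hu (1 / 2)))).div hu (pD 1) hD0.ne').congr e010
    hx).pd_eq
  have d011 := (((((P sa 1).mul hu ((PP sc 1 0).const_mul hu (1 / 2))).sub hu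
    ((P sb 1).mul hu ((PP sa 1 1).const_mul hu (1 / 2)))).div hu (pD 1) hD0.ne').congr e011
    hx).pd_eq
  have cc : ∀ i j k, EqOn (fun y => covDeriv S g (fun _ => coordVec i) (fun _ => coordVec j) y k)
      (fun y => christoffel₂ S g i j k y) S := fun i j k y hy => covDeriv_const hS i j hy k
  -- Coordinate fields commute, so the bracket term is zero and only the two iterated derivatives
  -- remain.
  have key : riemann S g (fun _ => coordVec 0) (fun _ => coordVec 1) (fun _ => coordVec 1)
      (fun _ => coordVec 0) x
    = ∑ k, g x k 0 * ((pd S 0 (fun y => christoffel₂ S g 1 1 k y) x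
        + ∑ j, christoffel₂ S g 0 j k x * christoffel₂ S g 1 1 j x)
      - (pd S 1 (fun y => christoffel₂ S g 0 1 k y) x
        + ∑ j, christoffel₂ S g 1 j k x * christoffel₂ S g 0 1 j x)) := by
    have hl := lieBracket_const hS 0 1 hx
    have hz : covDeriv S g (lieBracket S (fun _ => coordVec 0) (fun _ => coordVec 1))
        (fun _ => coordVec 1) x = 0 := by
      ext k; simp [covDeriv, hl]
    have h1 : ∀ k, covDeriv S g (fun _ => coordVec 0)
        (covDeriv S g (fun _ => coordVec 1) (fun _ => coordVec 1)) x k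
        = pd S 0 (fun y => christoffel₂ S g 1 1 k y) x
        + ∑ j, christoffel₂ S g 0 j k x * christoffel₂ S g 1 1 j x := by
      intro k
      rw [covDeriv]
      simp only [Fin.sum_univ_two, pd_congr (cc 1 1 k) hx, covDeriv_const hS _ _ hx]
      simp [coordVec]
    have h2 : ∀ k, covDeriv S g (fun _ => coordVec 1)
        (covDeriv S g (fun _ => coordVec 0) (fun _ => coordVec 1)) x k
        = pd S 1 (fun y => christoffel₂ S g 0 1 k y) x
        + ∑ j, christoffel₂ S g 1 j k x * christoffel₂ S g 0 1 j x := by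
      intro k
      rw [covDeriv]
      simp only [Fin.sum_univ_two, pd_congr (cc 0 1 k) hx, covDeriv_const hS _ _ hx]
      simp [coordVec]
    rw [riemann, form, hz]
    simp only [Fin.sum_univ_two, Pi.sub_apply, h1, h2]
    simp [coordVec]
  have hden : form (g x) (coordVec 0) (coordVec 0) * form (g x) (coordVec 1) (coordVec 1)
        - form (g x) (coordVec 0) (coordVec 1) ^ 2 = a x * c x - b x * b x := by
    simp only [hA.form_eq]; simp [coordVec, ha, hb, hc]; ring
  rw [gaussCurvature, hden, hDx, key, dw1, dw0]
  have hr : 0 < Real.sqrt (a x * c x - b x * b x) := Real.sqrt_pos.2 hD0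
  -- One √det stands on the left and one in the denominator on the right. Their product is det,
  -- which cancels the denominator of K, and a rational identity in the derivatives of the
  -- components up to order two remains.
  rw [← sub_div, eq_div_iff hr.ne', mul_assoc, Real.mul_self_sqrt hD0.le, div_mul_cancel₀ _ hD0.ne']
  simp only [Fin.sum_univ_two, d110, d111, d010, d011, e100, e101, e000, e001]
  have g00 : g x 0 0 = a x := by rw [ha]
  have g10 : g x 1 0 = b x := by rw [hA.2.2, hb]
  have f110 := e110 hx
  have f111 := e111 hx
  have f010 := e010 hx
  have f011 := e011 hx
  beta_reduce at f110 f111 f010 f011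
  rw [f110, f111, f010, f011, g00, g10, pd_comm hS hcl sa hx, pd_comm hS hcl sb hx,
    pd_comm hS hcl sc hx]
  have hD1 := hD0.ne'
  clear * - ha0 hD1
  generalize pd S 1 (pd S 0 a) x = a01
  generalize pd S 1 (pd S 0 b) x = b01
  generalize pd S 1 (pd S 0 c) x = c01
  generalize pd S 1 (pd S 1 a) x = a11
  generalize pd S 0 (pd S 0 c) x = c00
  generalize pd S 0 a x = a0
  generalize pd S 0 b x = b0
  generalize pd S 0 c x = c0
  generalize pd S 1 a x = a1
  generalize pd S 1 b x = b1
  generalize pd S 1 c x = c1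
  generalize a x = A at *
  generalize b x = B at *
  generalize c x = C at *
  have hD2 : A * C - B ^ 2 ≠ 0 := by rwa [pow_two]
  field_simp
  ring

end

/-! ### The frame angle and the geodesic curvature of straight lines -/

section

variable {S : Set Plane} {g σ : TensorField} {x : Plane}

/-- The angle from the first coordinate vector to `τ` in the metric `A`. -/
def frameAngle (A : Matrix (Fin 2) (Fin 2) ℝ) (τ : Plane) : ℝ :=
  Complex.arg ⟨A 0 0 * τ 0 + A 0 1 * τ 1, Real.sqrt A.det * τ 1⟩

/-- The branch cut of the argument does no harm. For k ≠ 0 the imaginary part is nonzero, so the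
point is in the slit plane and the argument is the imaginary part of the logarithm. For k = 0 the
curve stays on the real axis, near s on one side of the origin, and there the argument is constant,
also on the negative half-line. -/
theorem hasDerivWithinAt_arg {p r : ℝ → ℝ} {p' r' k s : ℝ} {I : Set ℝ}
    (hp : HasDerivWithinAt p p' I s) (hr : HasDerivWithinAt r r' I s) (hr0 : r s ≠ 0)
    (hk : k = 0 → p s ≠ 0) :
    HasDerivWithinAt (fun s => Complex.arg ⟨p s, r s * k⟩)
      ((p s * r' - r s * p') * k / (p s ^ 2 + (r s * k) ^ 2)) I s := by
  by_cases h : k = 0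
  · subst h
    have hz : HasDerivWithinAt (fun _ : ℝ => Complex.arg ⟨p s, r s * 0⟩) 0 I s :=
      hasDerivWithinAt_const _ _ _
    have hp0 := hk rfl
    rw [mul_zero, zero_div]
    refine hz.congr_of_eventuallyEq ?_ rfl
    have e : ∀ y : ℝ, (⟨y, 0⟩ : ℂ) = (y : ℂ) := fun y => rfl
    rcases lt_or_gt_of_ne hp0 with hlt | hgt
    · filter_upwards [hp.continuousWithinAt.eventually (gt_mem_nhds hlt)] with y hy
      rw [mul_zero, mul_zero, e, e, Complex.arg_ofReal_of_neg hy, Complex.arg_ofReal_of_neg hlt]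
    · filter_upwards [hp.continuousWithinAt.eventually (lt_mem_nhds hgt)] with y hy
      rw [mul_zero, mul_zero, e, e, Complex.arg_ofReal_of_nonneg hy.le,
        Complex.arg_ofReal_of_nonneg hgt.le]
  · have hz : HasDerivWithinAt (fun s => (p s : ℂ) + (r s : ℂ) * k * Complex.I)
        ((p' : ℂ) + (r' : ℂ) * k * Complex.I) I s :=
      (hp.ofReal_comp).add (((hr.ofReal_comp).mul_const (k : ℂ)).mul_const Complex.I)
    have e : ∀ s : ℝ, (p s : ℂ) + (r s : ℂ) * k * Complex.I = ⟨p s, r s * k⟩ := fun s => by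
      apply Complex.ext <;> simp
    have e' : (p' : ℂ) + (r' : ℂ) * k * Complex.I = ⟨p', r' * k⟩ := by
      apply Complex.ext <;> simp
    have hs : (p s : ℂ) + (r s : ℂ) * k * Complex.I ∈ Complex.slitPlane := by
      rw [e]; exact Or.inr (mul_ne_zero hr0 h)
    have h1 := hz.clog_real hs
    have h2 := (Complex.imCLM.hasFDerivAt).comp_hasDerivWithinAt s h1
    have h3 : ((Complex.imCLM ∘ fun t => Complex.log ((p t : ℂ) + (r t : ℂ) * k * Complex.I)))
        = fun s => Complex.arg ⟨p s, r s * k⟩ := by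
      funext t
      simp only [Function.comp, e, Complex.imCLM_apply, Complex.log_im]
    rw [h3] at h2
    refine h2.congr_deriv ?_
    rw [e, e', Complex.imCLM_apply, Complex.div_im]
    simp only [Complex.normSq_apply]
    rw [show p s * p s + r s * k * (r s * k) = p s ^ 2 + (r s * k) ^ 2 by ring]
    ring

theorem PosMinors.normSq_frame {A : Matrix (Fin 2) (Fin 2) ℝ} (hA : PosMinors A) (τ : Plane) :
    (A 0 0 * τ 0 + A 0 1 * τ 1) ^ 2 + (Real.sqrt A.det * τ 1) ^ 2 = A 0 0 * form A τ τ := by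
  rw [mul_pow, Real.sq_sqrt hA.2.1.le, hA.form_eq, hA.det_eq]; ring

/-- Derivative of the frame angle of a fixed vector along a curve of metrics. -/
theorem hasDerivWithinAt_frameAngle {A : ℝ → Matrix (Fin 2) (Fin 2) ℝ} {a' b' D' s : ℝ}
    {I : Set ℝ} {τ : Plane} (hA : PosMinors (A s)) (hτ : τ ≠ 0)
    (ha : HasDerivWithinAt (fun s => A s 0 0) a' I s)
    (hb : HasDerivWithinAt (fun s => A s 0 1) b' I s)
    (hD : HasDerivWithinAt (fun s => (A s).det) D' I s) :
    HasDerivWithinAt (fun s => frameAngle (A s) τ)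
      (((A s 0 0 * τ 0 + A s 0 1 * τ 1) * D' / 2 - (A s).det * (a' * τ 0 + b' * τ 1)) * τ 1
        / (A s 0 0 * form (A s) τ τ) / Real.sqrt (A s).det) I s := by
  have hp := (ha.mul_const (τ 0)).add (hb.mul_const (τ 1))
  have hr := (Real.hasDerivAt_sqrt hA.2.1.ne').comp_hasDerivWithinAt s hD
  refine (hasDerivWithinAt_arg (k := τ 1) hp hr hA.sqrt_pos.ne' ?_).congr_deriv ?_
  · intro h
    have h0 : τ 0 ≠ 0 := fun h0 => hτ (by ext i; fin_cases i <;> simp [h, h0])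
    have := hA.1.ne'
    simp [h, h0, this]
  · have hr0 := hA.sqrt_pos.ne'
    have hq : A s 0 0 * form (A s) τ τ ≠ 0 := mul_ne_zero hA.1.ne' (hA.form_pos hτ).ne'
    simp only [Pi.add_apply, Function.comp]
    rw [hA.normSq_frame]
    have hr2 : Real.sqrt (A s).det * Real.sqrt (A s).det = (A s).det :=
      Real.mul_self_sqrt hA.2.1.le
    generalize Real.sqrt (A s).det = r at *
    rw [← hr2]
    field_simp

theorem form_smul_left (A : Matrix (Fin 2) (Fin 2) ℝ) (k : ℝ) (X Y : Plane) :
    form A (k • X) Y = k * form A X Y := by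
  simp only [form_eq, Pi.smul_apply, smul_eq_mul]; ring

theorem form_smul_right (A : Matrix (Fin 2) (Fin 2) ℝ) (k : ℝ) (X Y : Plane) :
    form A X (k • Y) = k * form A X Y := by
  simp only [form_eq, Pi.smul_apply, smul_eq_mul]; ring

theorem PosMinors.rawNormal_apply {A : Matrix (Fin 2) (Fin 2) ℝ} (hA : PosMinors A) (τ : Plane) :
    rawNormal A τ 0 = -(A 1 1 * τ 1 + A 0 1 * τ 0) / A.det ∧
      rawNormal A τ 1 = (A 0 1 * τ 1 + A 0 0 * τ 0) / A.det := by
  obtain ⟨h1, h2, h3, h4⟩ := hA.inv_apply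
  constructor <;>
  · simp only [rawNormal, Matrix.mulVec, dotProduct, Fin.sum_univ_two, h1, h2, h3, h4]
    simp; ring

theorem PosMinors.form_rawNormal {A : Matrix (Fin 2) (Fin 2) ℝ} (hA : PosMinors A) (X τ : Plane) :
    form A X (rawNormal A τ) = area τ X := by
  obtain ⟨h1, h2⟩ := hA.rawNormal_apply τ
  have hD := hA.2.1.ne'
  rw [hA.form_eq, h1, h2, area]
  have := hA.det_eq
  field_simp
  rw [this]; ring

theorem PosMinors.form_rawNormal_self {A : Matrix (Fin 2) (Fin 2) ℝ} (hA : PosMinors A)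
    (τ : Plane) : form A (rawNormal A τ) (rawNormal A τ) = form A τ τ / A.det := by
  obtain ⟨h1, h2⟩ := hA.rawNormal_apply τ
  rw [hA.form_rawNormal, area, h1, h2, hA.form_eq]; ring

theorem SmoothSym.hasPd (hσ : SmoothSym S σ) (hx : x ∈ S) (i j k : Fin 2) :
    HasPd S k (fun y => σ y i j) (pd S k (fun y => σ y i j) x) x :=
  HasPd.of_differentiable (differentiableWithinAt_of_smooth (hσ.1 i j) hx)

/-- The geodesic curvature form of a straight line in terms of the Christoffel symbols. -/
theorem geodesicCurvature_mul_length (hS : UniqueDiffOn ℝ S)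
    (hg : SmoothSym S g) (hpos : ∀ x ∈ S, PosMinors (g x)) (hx : x ∈ S) {τ : Plane} (hτ : τ ≠ 0) :
    geodesicCurvature S g τ x * Real.sqrt (form (g x) τ τ)
      = (τ 0 * (∑ i, ∑ j, christoffel₂ S g i j 1 x * τ i * τ j)
          - τ 1 * (∑ i, ∑ j, christoffel₂ S g i j 0 x * τ i * τ j))
        * Real.sqrt (g x).det / form (g x) τ τ := by
  have hu := hS x hx
  have hA := hpos x hx
  have hq := hA.form_pos hτ
  obtain ⟨Q, hQ⟩ : ∃ Q : Fin 2 → ℝ, ∀ i, HasPd S i (fun y => form (g y) τ τ) (Q i) x := by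
    have h : ∀ i, ∃ q, HasPd S i (fun y => form (g y) τ τ) q x := fun i => by
      have h1 := (((hg.hasPd hx 0 0 i).const_mul hu (τ 0 * τ 0)).add hu
        ((hg.hasPd hx 0 1 i).const_mul hu (2 * τ 0 * τ 1))).add hu
        ((hg.hasPd hx 1 1 i).const_mul hu (τ 1 * τ 1))
      exact ⟨_, h1.congr (fun y hy => by simp only [(hpos y hy).form_eq]; ring) hx⟩
    choose q hq using h
    exact ⟨q, hq⟩
  -- Only the length factor of the unit tangent field varies, so this derivative is parallel to τ
  -- and disappears when paired with the normal.
  have hpd : ∀ i k, pd S i (fun y => unitTangent (g y) τ k) x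
      = (0 - τ k * Q i / (2 * form (g x) τ τ)) / Real.sqrt (form (g x) τ τ) := fun i k => by
    have h1 := (HasPd.const hu (τ k)).div_sqrt hu (hQ i) hq
    refine (h1.congr (fun y hy => ?_) hx).pd_eq
    simp [unitTangent, div_eq_inv_mul]
  rw [geodesicCurvature, unitNormal, form_smul_right, hA.form_rawNormal_self, hA.form_rawNormal,
    area]
  simp only [covDeriv, hpd]
  simp only [unitTangent, Pi.smul_apply, smul_eq_mul, Fin.sum_univ_two]
  rw [Real.sqrt_div hq.le]
  have hr := Real.sqrt_pos.2 hq
  have hr2 : form (g x) τ τ = Real.sqrt (form (g x) τ τ) ^ 2 := (Real.sq_sqrt hq.le).symm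
  have hd := hA.sqrt_pos
  generalize Real.sqrt (form (g x) τ τ) = l at *
  rw [hr2]
  field_simp
  ring

/-- Differentiation along a line within `S`. -/
theorem hasDerivWithinAt_segment {f : Plane → ℝ} (hf : ContDiffOn ℝ ∞ f S) {V τ : Plane}
    {I : Set ℝ} (hseg : ∀ s ∈ I, V + s • τ ∈ S) {s : ℝ} (hs : s ∈ I) :
    HasDerivWithinAt (fun s => f (V + s • τ))
      (τ 0 * pd S 0 f (V + s • τ) + τ 1 * pd S 1 f (V + s • τ)) I s := by
  have h1 : HasDerivWithinAt (fun s : ℝ => V + s • τ) τ I s := by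
    simpa using (((hasDerivAt_id s).smul_const τ).const_add V).hasDerivWithinAt
  have h2 := (differentiableWithinAt_of_smooth hf (hseg s hs)).hasFDerivWithinAt
  refine (h2.comp_hasDerivWithinAt s h1 hseg).congr_deriv ?_
  have h3 : ∀ L : Plane →L[ℝ] ℝ, L τ = τ 0 * L (coordVec 0) + τ 1 * L (coordVec 1) := fun L => by
    have : τ = τ 0 • coordVec 0 + τ 1 • coordVec 1 := by
      ext i; fin_cases i <;> simp [coordVec]
    conv_lhs => rw [this]
    rw [map_add, map_smul, map_smul]; rfl
  exact h3 _

/-- Along an edge the geodesic curvature form is the derivative of the frame angle minus the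
connection form. -/
theorem hasDerivWithinAt_frameAngle_segment (hS : UniqueDiffOn ℝ S)
    (hg : SmoothSym S g) (hpos : ∀ x ∈ S, PosMinors (g x)) {V τ : Plane} (hτ : τ ≠ 0)
    (hseg : ∀ s ∈ Icc (0 : ℝ) 1, V + s • τ ∈ S) {s : ℝ} (hs : s ∈ Icc (0 : ℝ) 1) :
    HasDerivWithinAt (fun s => frameAngle (g (V + s • τ)) τ)
      (geodesicCurvature S g τ (V + s • τ) * Real.sqrt (form (g (V + s • τ)) τ τ)
        + (connForm S g 0 (V + s • τ) * τ 0 + connForm S g 1 (V + s • τ) * τ 1)) (Icc 0 1) s := by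
  have hx := hseg s hs
  have ha := hasDerivWithinAt_segment (hg.1 0 0) hseg hs
  have hb := hasDerivWithinAt_segment (hg.1 0 1) hseg hs
  have hc := hasDerivWithinAt_segment (hg.1 1 1) hseg hs
  have hD := ((ha.mul hc).sub (hb.mul hb)).congr_of_mem (f₁ := fun s => (g (V + s • τ)).det)
    (fun s hs => by
      rw [(hpos _ (hseg s hs)).det_eq]; simp; ring) hs
  refine (hasDerivWithinAt_frameAngle (A := fun s => g (V + s • τ)) (hpos _ hx) hτ ha hb
    hD).congr_deriv ?_
  rw [geodesicCurvature_mul_length hS hg hpos hx hτ]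
  generalize V + s • τ = x at *
  have hA := hpos x hx
  obtain ⟨c000, c001, c010, c100, c011, c101, c110, c111⟩ := hg.christoffel₁_eq hx
  simp only [Fin.sum_univ_two, christoffel₂_zero hA, christoffel₂_one hA, connForm, c000, c001,
    c010, c100, c011, c101, c110, c111]
  have hr0 := hA.sqrt_pos
  have hrr : Real.sqrt (g x).det * Real.sqrt (g x).det = (g x).det := Real.mul_self_sqrt hA.2.1.le
  have hq := (hA.form_pos hτ).ne'
  have hq2 := hA.form_eq τ τ
  have hD2 := hA.det_eq
  have hD0 := hA.2.1.ne'
  have ha0 := hA.1.ne'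
  -- With √det moved to the denominator, the curvature and connection terms share the factor 1/√det,
  -- and what is left to compare is rational.
  have hl : ∀ X : ℝ, X * Real.sqrt (g x).det / form (g x) τ τ
      = X * (g x).det / form (g x) τ τ / Real.sqrt (g x).det := fun X => by
    rw [eq_div_iff hr0.ne', ← hrr]
    ring_nf
    simp
  have hcomb : ∀ X Y Z r t w : ℝ, X / r + (Y / r * t + Z / r * w) = (X + (Y * t + Z * w)) / r :=
    fun X Y Z r t w => by ring
  rw [hl, hcomb]
  congr 1
  rw [hD2] at hD0
  rw [hq2] at hq
  rw [hD2, hq2]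
  clear * - hD0 hq ha0
  generalize pd S 0 (fun y => g y 0 0) x = a0
  generalize pd S 0 (fun y => g y 0 1) x = b0
  generalize pd S 0 (fun y => g y 1 1) x = c0
  generalize pd S 1 (fun y => g y 0 0) x = a1
  generalize pd S 1 (fun y => g y 0 1) x = b1
  generalize pd S 1 (fun y => g y 1 1) x = c1
  generalize g x 0 0 = A at *
  generalize g x 0 1 = B at *
  generalize g x 1 1 = C at *
  generalize τ 0 = t at *
  generalize τ 1 = w at *
  -- The length and the determinant stay atoms while denominators are cleared and are expanded only
  -- for the final `ring`.
  obtain ⟨Q, hQ⟩ : ∃ Q, Q = A * t * t + B * (t * w + w * t) + C * w * w := ⟨_, rfl⟩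
  obtain ⟨D, hD⟩ : ∃ D, D = A * C - B ^ 2 := ⟨_, rfl⟩
  rw [← hQ] at hq ⊢
  rw [← hD] at hD0 ⊢
  field_simp
  rw [hQ, hD]
  ring

end

section

variable {S : Set Plane} {g σ : TensorField} {x : Plane}

/-! ### Variation along the segment from the Euclidean metric -/

/-- The path `δ + t σ`. -/
def euclidPath (σ : TensorField) (t : ℝ) : TensorField := fun x => 1 + t • σ x

theorem euclidPath_apply (σ : TensorField) (t : ℝ) (x : Plane) :
    euclidPath σ t x 0 0 = 1 + t * σ x 0 0 ∧ euclidPath σ t x 0 1 = t * σ x 0 1 ∧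
      euclidPath σ t x 1 0 = t * σ x 1 0 ∧ euclidPath σ t x 1 1 = 1 + t * σ x 1 1 := by
  simp [euclidPath]

theorem SmoothSym.euclidPath (hσ : SmoothSym S σ) (t : ℝ) : SmoothSym S (euclidPath σ t) := by
  refine ⟨fun i j => ?_, fun x hx => ?_⟩
  · exact contDiffOn_const.add (contDiffOn_const.mul (hσ.1 i j))
  · obtain ⟨-, h1, h2, -⟩ := euclidPath_apply σ t x
    rw [h1, h2, hσ.2 x hx]

theorem pd_euclidPath (hS : UniqueDiffOn ℝ S) (hσ : SmoothSym S σ) (t : ℝ) (hx : x ∈ S)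
    (k i j : Fin 2) : pd S k (fun y => ReggeCurvature.euclidPath σ t y i j) x
      = t * pd S k (fun y => σ y i j) x := by
  have hu := hS x hx
  exact (((HasPd.const hu _).add hu ((hσ.hasPd hx i j k).const_mul hu t)).congr_value
    (by ring)).pd_eq

/-- The identity metric has constant components. Hence derivatives of the path are linear in t, and
the nonlinear dependence on t sits in the undifferentiated metric. -/
theorem christoffel₁_euclidPath (hS : UniqueDiffOn ℝ S) (hσ : SmoothSym S σ) (t : ℝ) (hx : x ∈ S)
    (i j l : Fin 2) : christoffel₁ S (euclidPath σ t) i j l x = t * christoffel₁ S σ i j l x := by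
  simp only [christoffel₁, pd_euclidPath hS hσ t hx]; ring

theorem connForm_euclidPath (hS : UniqueDiffOn ℝ S) (hσ : SmoothSym S σ) (t : ℝ) (hx : x ∈ S)
    (i : Fin 2) : connForm S (euclidPath σ t) i x
      = t * (t * σ x 0 1 / (1 + t * σ x 0 0) * christoffel₁ S σ i 0 0 x - christoffel₁ S σ i 0 1 x)
        / Real.sqrt (euclidPath σ t x).det := by
  obtain ⟨h1, h2, -⟩ := euclidPath_apply σ t x
  simp only [connForm, christoffel₁_euclidPath hS hσ t hx, h1, h2]; ring

/-- The angular velocity of the frame obtained from `∂_1` relative to the frame that evolves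
symmetrically, along the path `δ + t σ`. -/
def frameSpin (σ : TensorField) (t : ℝ) (x : Plane) : ℝ :=
  (σ x 0 1 - t * σ x 0 1 / (1 + t * σ x 0 0) * σ x 0 0) / Real.sqrt (euclidPath σ t x).det / 2

theorem hasDerivAt_det_euclidPath {t : ℝ} (hs : σ x 1 0 = σ x 0 1) :
    HasDerivAt (fun t => (euclidPath σ t x).det)
      (σ x 0 0 * (1 + t * σ x 1 1) + (1 + t * σ x 0 0) * σ x 1 1 - 2 * t * σ x 0 1 ^ 2) t := by
  have h0 : (fun t => (euclidPath σ t x).det)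
      = fun t => (1 + t * σ x 0 0) * (1 + t * σ x 1 1) - (t * σ x 0 1) * (t * σ x 0 1) := by
    funext t
    obtain ⟨h1, h2, h3, h4⟩ := euclidPath_apply σ t x
    rw [Matrix.det_fin_two, h1, h2, h3, h4, hs]
  have h1 : ∀ k : ℝ, HasDerivAt (fun t : ℝ => t * k) k t := fun k => by
    simpa using (hasDerivAt_id t).mul_const k
  rw [h0]
  refine (((h1 (σ x 0 0)).const_add 1).mul ((h1 (σ x 1 1)).const_add 1)).sub
    ((h1 (σ x 0 1)).mul (h1 (σ x 0 1))) |>.congr_deriv ?_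
  ring

/-- The variation of the frame angle of a fixed vector. -/
theorem hasDerivAt_frameAngle_euclidPath {t : ℝ} (hA : PosMinors (euclidPath σ t x))
    (hs : σ x 1 0 = σ x 0 1) {τ : Plane} (hτ : τ ≠ 0) :
    HasDerivAt (fun t => frameAngle (euclidPath σ t x) τ)
      (form (σ x) (rawNormal (euclidPath σ t x) τ) τ * Real.sqrt (euclidPath σ t x).det
        / form (euclidPath σ t x) τ τ / 2 - frameSpin σ t x) t := by
  have h1 : ∀ k : ℝ, HasDerivAt (fun t : ℝ => t * k) k t := fun k => by
    simpa using (hasDerivAt_id t).mul_const k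
  have ha : HasDerivAt (fun t => euclidPath σ t x 0 0) (σ x 0 0) t :=
    ((h1 (σ x 0 0)).const_add 1).congr_of_eventuallyEq
      (Filter.Eventually.of_forall fun t => (euclidPath_apply σ t x).1)
  have hb : HasDerivAt (fun t => euclidPath σ t x 0 1) (σ x 0 1) t :=
    (h1 (σ x 0 1)).congr_of_eventuallyEq
      (Filter.Eventually.of_forall fun t => (euclidPath_apply σ t x).2.1)
  have h2 := hasDerivWithinAt_frameAngle (I := univ) hA hτ ha.hasDerivWithinAt hb.hasDerivWithinAt
    (hasDerivAt_det_euclidPath hs).hasDerivWithinAt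
  rw [hasDerivWithinAt_univ] at h2
  refine h2.congr_deriv ?_
  obtain ⟨e00, e01, -, e11⟩ := euclidPath_apply σ t x
  obtain ⟨n0, n1⟩ := hA.rawNormal_apply τ
  have hrr := Real.mul_self_sqrt hA.2.1.le
  have hr0 := hA.sqrt_pos
  have hq := (hA.form_pos hτ).ne'
  have hq2 := hA.form_eq τ τ
  have hD2 := hA.det_eq
  have hD0 := hA.2.1.ne'
  have ha0 := hA.1.ne'
  have hl : ∀ X : ℝ, X * Real.sqrt (euclidPath σ t x).det / form (euclidPath σ t x) τ τ
      = X * (euclidPath σ t x).det / form (euclidPath σ t x) τ τ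
        / Real.sqrt (euclidPath σ t x).det := fun X => by
    rw [eq_div_iff hr0.ne', ← hrr]
    ring_nf
    simp
  have hcomb : ∀ X Y r : ℝ, X / r / 2 - Y / r / 2 = (X / 2 - Y / 2) / r := fun X Y r => by ring
  rw [hl, frameSpin, hcomb]
  congr 1
  rw [form_eq (σ x), n0, n1, hs]
  rw [hD2] at hD0
  rw [hq2] at hq
  rw [hD2, hq2]
  rw [e00] at ha0
  rw [e00, e01, e11] at hq hD0 ⊢
  clear * - hD0 hq ha0
  generalize σ x 0 0 = A at *
  generalize σ x 0 1 = B at *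
  generalize σ x 1 1 = C at *
  generalize τ 0 = p at *
  generalize τ 1 = w at *
  obtain ⟨Q, hQ⟩ : ∃ Q, Q = (1 + t * A) * p * p + t * B * (p * w + w * p) + (1 + t * C) * w * w :=
    ⟨_, rfl⟩
  obtain ⟨D, hD⟩ : ∃ D, D = (1 + t * A) * (1 + t * C) - (t * B) ^ 2 := ⟨_, rfl⟩
  rw [← hQ] at hq ⊢
  rw [← hD] at hD0 ⊢
  field_simp
  rw [hQ, hD]
  ring

/-- The derivative in `t` of the connection form along the path `δ + t σ`. -/
def connRate (S : Set Plane) (σ : TensorField) (i : Fin 2) (t : ℝ) (x : Plane) : ℝ :=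
  (1 * (t * σ x 0 1 / (1 + t * σ x 0 0) * christoffel₁ S σ i 0 0 x - christoffel₁ S σ i 0 1 x)
      + t * ((σ x 0 1 * (1 + t * σ x 0 0) - t * σ x 0 1 * σ x 0 0) / (1 + t * σ x 0 0) ^ 2
        * christoffel₁ S σ i 0 0 x)
    - t * (t * σ x 0 1 / (1 + t * σ x 0 0) * christoffel₁ S σ i 0 0 x - christoffel₁ S σ i 0 1 x)
      * (σ x 0 0 * (1 + t * σ x 1 1) + (1 + t * σ x 0 0) * σ x 1 1 - 2 * t * σ x 0 1 ^ 2)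
      / (2 * (euclidPath σ t x).det)) / Real.sqrt (euclidPath σ t x).det

theorem hasDerivAt_connForm_euclidPath (hS : UniqueDiffOn ℝ S) (hσ : SmoothSym S σ) {t : ℝ}
    (hx : x ∈ S) (hA : PosMinors (euclidPath σ t x)) (i : Fin 2) :
    HasDerivAt (fun t => connForm S (euclidPath σ t) i x) (connRate S σ i t x) t := by
  have hs := hσ.2 x hx
  obtain ⟨e00, -⟩ := euclidPath_apply σ t x
  have h1 : ∀ k : ℝ, HasDerivAt (fun t : ℝ => t * k) k t := fun k => by
    simpa using (hasDerivAt_id t).mul_const k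
  have ha0 : 1 + t * σ x 0 0 ≠ 0 := by rw [← e00]; exact hA.1.ne'
  have hL := (((hasDerivAt_id t).mul ((((h1 (σ x 0 1)).div ((h1 (σ x 0 0)).const_add 1) ha0).mul_const
    (christoffel₁ S σ i 0 0 x)).sub_const (christoffel₁ S σ i 0 1 x))).div
    ((Real.hasDerivAt_sqrt hA.2.1.ne').comp t (hasDerivAt_det_euclidPath hs)) hA.sqrt_pos.ne')
  have hfun : (fun t => connForm S (euclidPath σ t) i x) = _ :=
    funext fun t => connForm_euclidPath hS hσ t hx i
  rw [hfun]
  refine hL.congr_deriv ?_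
  have hr0 := hA.sqrt_pos.ne'
  have hr2 : Real.sqrt (euclidPath σ t x).det ^ 2 = (euclidPath σ t x).det :=
    Real.sq_sqrt hA.2.1.le
  have aux : ∀ c c' d r D : ℝ, r ≠ 0 → r ^ 2 = D →
      (c' * r - c * (1 / (2 * r) * d)) / r ^ 2 = (c' - c * d / (2 * D)) / r := by
    intro c c' d r D h0 h
    rw [← h]
    field_simp
  exact aux _ _ _ _ _ hr0 hr2

/-- The variation of the connection form in terms of the covariant curl. -/
theorem connRate_eq (hS : UniqueDiffOn ℝ S) (hσ : SmoothSym S σ) {t : ℝ}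
    (hx : x ∈ S) (hpos : ∀ x ∈ S, PosMinors (euclidPath σ t x)) (i : Fin 2) :
    connRate S σ i t x =
      -((covDerivTensor S (euclidPath σ t) σ 0 i 1 x - covDerivTensor S (euclidPath σ t) σ 1 i 0 x)
          / Real.sqrt (euclidPath σ t x).det) / 2
        - pd S i (frameSpin σ t) x := by
  have hA := hpos x hx
  have hu := hS x hx
  have hs := hσ.2 x hx
  obtain ⟨e00, e01, e10, e11⟩ := euclidPath_apply σ t x
  have ha0 : 1 + t * σ x 0 0 ≠ 0 := by rw [← e00]; exact hA.1.ne'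
  have hD2 := hA.det_eq
  rw [e00, e01, e11] at hD2
  have hD0 := hA.2.1
  obtain ⟨p, hp⟩ : ∃ p : ℝ, p = pd S i (fun y => σ y 0 0) x := ⟨_, rfl⟩
  obtain ⟨q, hq⟩ : ∃ q : ℝ, q = pd S i (fun y => σ y 0 1) x := ⟨_, rfl⟩
  obtain ⟨w, hw⟩ : ∃ w : ℝ, w = pd S i (fun y => σ y 1 1) x := ⟨_, rfl⟩
  have pA : HasPd S i (fun y => σ y 0 0) p x := hp ▸ hσ.hasPd hx 0 0 i
  have pB : HasPd S i (fun y => σ y 0 1) q x := hq ▸ hσ.hasPd hx 0 1 i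
  have pC : HasPd S i (fun y => σ y 1 1) w x := hw ▸ hσ.hasPd hx 1 1 i
  have pa := (HasPd.const hu 1).add hu (pA.const_mul hu t)
  have pc := (HasPd.const hu 1).add hu (pC.const_mul hu t)
  have pb := pB.const_mul hu t
  have pD := (((pa.mul hu pc).sub hu (pb.mul hu pb)).congr
    (h := fun y => (euclidPath σ t y).det) (fun y hy => by
      obtain ⟨f00, f01, -, f11⟩ := euclidPath_apply σ t y
      simp only [(hpos y hy).det_eq, f00, f01, f11]; ring) hx)
  have pS := (((pB.sub hu ((pb.div hu pa ha0).mul hu pA)).div_sqrt hu pD hD0).mul hu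
    (HasPd.const hu (1 / 2))).congr (h := frameSpin σ t) (fun y hy => by
      simp only [frameSpin]; ring) hx
  rw [pS.pd_eq]
  simp only [connRate, covDerivTensor, Fin.sum_univ_two, christoffel₂_zero hA, christoffel₂_one hA,
    christoffel₁_euclidPath hS hσ t hx, e00, e01, e11]
  -- The summand `Z * 0` is the derivative of the constant factor 1/2 in `frameSpin`.
  have hc2 : ∀ X Y Z r : ℝ, -(X / r) / 2 - (Y / r * (1 / 2) + Z * 0) = (-X / 2 - Y / 2) / r :=
    fun X Y Z r => by ring
  rw [hc2]
  congr 1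
  obtain ⟨c000, c001, c010, c100, c011, c101, c110, c111⟩ := hσ.christoffel₁_eq hx
  have hD0' := hD0.ne'
  have hsy := hσ.pd_symm hx
  fin_cases i <;>
  · simp only [Fin.zero_eta, Fin.isValue, Fin.mk_one, c000, c001, c010, c100, c011, c101, c110,
      c111, hs, hsy] at hp hq hw ⊢
    rw [← hp, ← hq, ← hw]
    generalize (euclidPath σ t x).det = D at *
    clear * - ha0 hD0' hD2
    generalize σ x 0 0 = A at *
    generalize σ x 0 1 = B at *
    generalize σ x 1 1 = C at *
    field_simp
    rw [hD2]
    ring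

end

section

/-! ### Triangles -/

/-- The reference triangle. -/
def refTriangle : Set (ℝ × ℝ) := {z | 0 ≤ z.1 ∧ 0 ≤ z.2 ∧ z.1 + z.2 ≤ 1}

/-- Cramer's rule, with `area` as the determinant. -/
theorem eq_add_of_area_ne_zero {X Y : Plane} (h : area X Y ≠ 0) (w : Plane) :
    w = (area w Y / area X Y) • X + (area X w / area X Y) • Y := by
  ext i
  simp only [Pi.add_apply, Pi.smul_apply, smul_eq_mul]
  fin_cases i <;>
  · simp only [Fin.zero_eta, Fin.mk_one]
    field_simp
    simp only [area]; ring

theorem eq_of_add_smul_eq {X Y : Plane} (h : area X Y ≠ 0) {p q p' q' : ℝ}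
    (he : p • X + q • Y = p' • X + q' • Y) : p = p' ∧ q = q' := by
  have h0 := congrFun he 0
  have h1 := congrFun he 1
  simp only [Pi.add_apply, Pi.smul_apply, smul_eq_mul] at h0 h1
  constructor
  · apply mul_right_cancel₀ h
    simp only [area]; linear_combination Y 1 * h0 - Y 0 * h1
  · apply mul_right_cancel₀ h
    simp only [area]; linear_combination -X 1 * h0 + X 0 * h1

theorem range_shift (v : Fin 3 → Plane) (a : Fin 3) : range (fun i => v (a + i)) = range v :=
  (Equiv.addLeft a).surjective.range_comp v

/-- Twice the oriented area is invariant under cyclic relabelling, so every vertex can serve as the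
origin of affine coordinates. -/
theorem area_shift (v : Fin 3 → Plane) (a : Fin 3) :
    area (v (a + 1) - v a) (v (a + 2) - v a) = area (v 1 - v 0) (v 2 - v 0) := by
  have e1 : (1 : Fin 3) + 1 = 2 := rfl
  have e2 : (1 : Fin 3) + 2 = 0 := rfl
  have e3 : (2 : Fin 3) + 1 = 0 := rfl
  have e4 : (2 : Fin 3) + 2 = 1 := rfl
  fin_cases a
  · simp
  · simp only [Fin.mk_one, e1, e2, area, Pi.sub_apply]; ring
  · simp only [Fin.reduceFinMk, e3, e4, area, Pi.sub_apply]; ring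

/-- Points of a triangle in the affine coordinates attached to its vertex `a`. -/
theorem mem_triangle_iff (v : Fin 3 → Plane) (a : Fin 3) {x : Plane} :
    x ∈ convexHull ℝ (range v) ↔ ∃ z ∈ refTriangle,
      x = v a + z.1 • (v (a + 1) - v a) + z.2 • (v (a + 2) - v a) := by
  constructor
  · intro hx
    have hsub : convexHull ℝ (range v) ⊆ {x | ∃ z ∈ refTriangle,
        x = v a + z.1 • (v (a + 1) - v a) + z.2 • (v (a + 2) - v a)} := by
      apply convexHull_min
      · rw [← range_shift v a]
        rintro _ ⟨i, rfl⟩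
        fin_cases i
        · exact ⟨(0, 0), by simp [refTriangle], by simp⟩
        · exact ⟨(1, 0), by simp [refTriangle], by simp⟩
        · exact ⟨(0, 1), by simp [refTriangle], by simp⟩
      · rintro _ ⟨z, hz, rfl⟩ _ ⟨w, hw, rfl⟩ p q hp hq hpq
        refine ⟨p • z + q • w, ?_, ?_⟩
        · obtain ⟨z1, z2, z3⟩ := hz
          obtain ⟨w1, w2, w3⟩ := hw
          refine ⟨?_, ?_, ?_⟩ <;> simp only [Prod.fst_add, Prod.snd_add, Prod.smul_fst,
            Prod.smul_snd, smul_eq_mul]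
          · positivity
          · positivity
          · nlinarith
        · obtain rfl : q = 1 - p := by linarith
          ext i
          simp; ring
    exact hsub hx
  · rintro ⟨z, ⟨h1, h2, h3⟩, rfl⟩
    have hm : ∀ i, v i ∈ convexHull ℝ (range v) := fun i => subset_convexHull ℝ _ ⟨i, rfl⟩
    have := (convex_convexHull ℝ (range v)).sum_mem (t := Finset.univ)
      (w := ![1 - z.1 - z.2, z.1, z.2]) (z := fun i : Fin 3 => v (a + i))
      (by intro i _; fin_cases i <;> simp <;> linarith)
      (by simp [Fin.sum_univ_three]; ring) (fun i _ => hm _)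
    convert this using 1
    ext i
    simp [Fin.sum_univ_three]; ring

theorem isCompact_triangle (v : Fin 3 → Plane) : IsCompact (convexHull ℝ (range v)) :=
  (finite_range v).isCompact_convexHull ℝ

/-- By Cramer's rule the two areas, divided by that of the triangle, are the barycentric coordinates
belonging to the vertices `a + 1` and `a + 2`. Membership becomes three affine inequalities,
convenient for perturbing points. -/
theorem coords_of_mem_triangle {v : Fin 3 → Plane} (hv : 0 < area (v 1 - v 0) (v 2 - v 0))
    (a : Fin 3) {x : Plane} : x ∈ convexHull ℝ (range v) ↔
      0 ≤ area (x - v a) (v (a + 2) - v a) ∧ 0 ≤ area (v (a + 1) - v a) (x - v a) ∧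
      area (x - v a) (v (a + 2) - v a) + area (v (a + 1) - v a) (x - v a)
        ≤ area (v 1 - v 0) (v 2 - v 0) := by
  have hva := area_shift v a
  rw [← hva] at hv ⊢
  rw [mem_triangle_iff v a]
  generalize v (a + 1) - v a = X at *
  generalize v (a + 2) - v a = Y at *
  constructor
  · rintro ⟨z, ⟨h1, h2, h3⟩, rfl⟩
    have e1 : area (v a + z.1 • X + z.2 • Y - v a) Y = z.1 * area X Y := by
      simp [area]; ring
    have e2 : area X (v a + z.1 • X + z.2 • Y - v a) = z.2 * area X Y := by
      simp [area]; ring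
    rw [e1, e2]
    refine ⟨by positivity, by positivity, by nlinarith⟩
  · rintro ⟨h1, h2, h3⟩
    refine ⟨(area (x - v a) Y / area X Y, area X (x - v a) / area X Y), ⟨by positivity, by positivity, ?_⟩, ?_⟩
    · show _ / _ + _ / _ ≤ _
      rw [← add_div, div_le_one hv]; exact h3
    · rw [add_assoc, ← eq_add_of_area_ne_zero hv.ne' (x - v a)]; simp

theorem continuous_area_left (Y w : Plane) : Continuous fun x : Plane => area (x - w) Y := by
  unfold area; fun_prop

theorem continuous_area_right (Y w : Plane) : Continuous fun x : Plane => area Y (x - w) := by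
  unfold area; fun_prop

theorem mem_interior_triangle {v : Fin 3 → Plane} (hv : 0 < area (v 1 - v 0) (v 2 - v 0))
    (a : Fin 3) {x : Plane} (h1 : 0 < area (x - v a) (v (a + 2) - v a))
    (h2 : 0 < area (v (a + 1) - v a) (x - v a))
    (h3 : area (x - v a) (v (a + 2) - v a) + area (v (a + 1) - v a) (x - v a)
        < area (v 1 - v 0) (v 2 - v 0)) : x ∈ interior (convexHull ℝ (range v)) := by
  rw [mem_interior_iff_mem_nhds]
  have c1 := continuous_area_left (v (a + 2) - v a) (v a)
  have c2 := continuous_area_right (v (a + 1) - v a) (v a)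
  filter_upwards [c1.continuousAt.eventually (lt_mem_nhds h1),
    c2.continuousAt.eventually (lt_mem_nhds h2),
    (c1.add c2).continuousAt.eventually (gt_mem_nhds h3)] with y y1 y2 y3
  exact (coords_of_mem_triangle hv a).2 ⟨y1.le, y2.le, y3.le⟩

theorem interior_triangle_nonempty {v : Fin 3 → Plane} (hv : 0 < area (v 1 - v 0) (v 2 - v 0)) :
    (interior (convexHull ℝ (range v))).Nonempty := by
  refine ⟨v 0 + (1 / 3 : ℝ) • (v 1 - v 0) + (1 / 3 : ℝ) • (v 2 - v 0),
    mem_interior_triangle hv 0 ?_ ?_ ?_⟩ <;>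
  · simp only [area, zero_add, Pi.sub_apply, Pi.add_apply, Pi.smul_apply, smul_eq_mul] at hv ⊢
    ring_nf at hv ⊢
    linarith

theorem uniqueDiffOn_triangle {v : Fin 3 → Plane} (hv : 0 < area (v 1 - v 0) (v 2 - v 0)) :
    UniqueDiffOn ℝ (convexHull ℝ (range v)) :=
  uniqueDiffOn_convex (convex_convexHull ℝ _) (interior_triangle_nonempty hv)

theorem triangle_subset_closure_interior {v : Fin 3 → Plane}
    (hv : 0 < area (v 1 - v 0) (v 2 - v 0)) :
    convexHull ℝ (range v) ⊆ closure (interior (convexHull ℝ (range v))) := by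
  rw [(convex_convexHull ℝ (range v)).closure_interior_eq_closure_of_nonempty_interior
    (interior_triangle_nonempty hv)]
  exact subset_closure

/-! ### Integrals over triangles and Green's theorem -/

theorem isClosed_refTriangle : IsClosed refTriangle :=
  (isClosed_le continuous_const continuous_fst).inter
    ((isClosed_le continuous_const continuous_snd).inter
      (isClosed_le (continuous_fst.add continuous_snd) continuous_const))

theorem isCompact_refTriangle : IsCompact refTriangle := by
  refine (isCompact_Icc (a := ((0, 0) : ℝ × ℝ)) (b := (1, 1))).of_isClosed_subset
    isClosed_refTriangle ?_
  rintro ⟨z, w⟩ ⟨h1, h2, h3⟩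
  simp only at h1 h2 h3
  exact ⟨⟨h1, h2⟩, ⟨by simp; linarith, by simp; linarith⟩⟩

theorem integral_refTriangle {F : ℝ × ℝ → ℝ} (hF : ContinuousOn F refTriangle) :
    ∫ z in refTriangle, F z = ∫ y in (0 : ℝ)..1, ∫ x in (0 : ℝ)..(1 - y), F (x, y) := by
  have hm := isClosed_refTriangle.measurableSet
  have hi : MeasureTheory.Integrable (refTriangle.indicator F)
      ((MeasureTheory.volume : MeasureTheory.Measure ℝ).prod MeasureTheory.volume) :=
    (MeasureTheory.integrable_indicator_iff hm).2 (hF.integrableOn_compact isCompact_refTriangle)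
  rw [← MeasureTheory.integral_indicator hm]
  rw [MeasureTheory.Measure.volume_eq_prod, MeasureTheory.integral_prod_symm _ hi,
    intervalIntegral.integral_of_le zero_le_one, ← MeasureTheory.integral_Icc_eq_integral_Ioc,
    ← MeasureTheory.integral_indicator measurableSet_Icc]
  congr 1
  funext y
  by_cases hy : y ∈ Icc (0 : ℝ) 1
  · rw [indicator_of_mem hy, intervalIntegral.integral_of_le (by linarith [hy.2]),
      ← MeasureTheory.integral_Icc_eq_integral_Ioc, ← MeasureTheory.integral_indicator measurableSet_Icc]
    congr 1
    funext x
    by_cases hx : x ∈ Icc (0 : ℝ) (1 - y)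
    · rw [indicator_of_mem hx, indicator_of_mem]
      exact ⟨hx.1, hy.1, by have := hx.2; simp only; linarith⟩
    · rw [indicator_of_notMem hx, indicator_of_notMem]
      rintro ⟨h1, h2, h3⟩
      exact hx ⟨h1, by simp only at h3; linarith⟩
  · rw [indicator_of_notMem hy]
    rw [← MeasureTheory.integral_zero ℝ ℝ]
    congr 1
    funext x
    rw [indicator_of_notMem]
    rintro ⟨h1, h2, h3⟩
    simp only at h1 h2 h3
    exact hy ⟨h2, by linarith⟩

/-- Reflection in the diagonal. Both orders of integration are used in Green's theorem, one for each
partial derivative. -/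
theorem integral_refTriangle_symm {F : ℝ × ℝ → ℝ} (hF : ContinuousOn F refTriangle) :
    ∫ z in refTriangle, F z = ∫ x in (0 : ℝ)..1, ∫ y in (0 : ℝ)..(1 - x), F (x, y) := by
  have hsw : ∫ z in refTriangle, F z = ∫ z in refTriangle, F z.swap := by
    have hp : MeasureTheory.MeasurePreserving (Prod.swap : ℝ × ℝ → ℝ × ℝ)
      MeasureTheory.volume MeasureTheory.volume := MeasureTheory.Measure.measurePreserving_swap
    have := hp.setIntegral_preimage_emb MeasurableEquiv.prodComm.measurableEmbedding F refTriangle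
    rw [← this]
    congr 2
    ext z
    simp only [refTriangle, mem_preimage, mem_ofPred_eq, Prod.fst_swap, Prod.snd_swap]
    constructor <;> rintro ⟨h1, h2, h3⟩ <;> exact ⟨h2, h1, by linarith⟩
  rw [hsw, integral_refTriangle]
  · rfl
  · refine hF.comp continuous_swap.continuousOn ?_
    rintro z ⟨h1, h2, h3⟩
    exact ⟨h2, h1, by simp only [Prod.fst_swap, Prod.snd_swap]; linarith⟩

/-- Affine change of variables: the linear part has the two edge vectors at `v 0` as columns, so its
determinant is their `area`. -/
theorem setIntegral_triangle {v : Fin 3 → Plane} (hv : 0 < area (v 1 - v 0) (v 2 - v 0))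
    (f : Plane → ℝ) :
    ∫ x in convexHull ℝ (range v), f x
      = area (v 1 - v 0) (v 2 - v 0) *
        ∫ z in refTriangle, f (v 0 + z.1 • (v 1 - v 0) + z.2 • (v 2 - v 0)) := by
  obtain ⟨X, hX⟩ : ∃ X, X = v 1 - v 0 := ⟨_, rfl⟩
  obtain ⟨Y, hY⟩ : ∃ Y, Y = v 2 - v 0 := ⟨_, rfl⟩
  rw [← hX, ← hY] at hv ⊢
  have hmp := MeasureTheory.volume_preserving_finTwoArrow ℝ
  let A : Matrix (Fin 2) (Fin 2) ℝ := !![X 0, Y 0; X 1, Y 1]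
  let L : Plane →L[ℝ] Plane := LinearMap.toContinuousLinearMap (Matrix.toLin' A)
  have hL : ∀ z, L z = z 0 • X + z 1 • Y := by
    intro z
    ext i
    simp only [L, A, LinearMap.coe_toContinuousLinearMap', Matrix.toLin'_apply]
    fin_cases i <;> simp [Matrix.mulVec, dotProduct, Fin.sum_univ_two] <;> ring
  have hdet : L.det = area X Y := by
    simp only [L, A, ContinuousLinearMap.det, LinearMap.coe_toContinuousLinearMap,
      LinearMap.det_toLin', Matrix.det_fin_two]
    simp [area]; ring
  let R : Set Plane := MeasurableEquiv.finTwoArrow ⁻¹' refTriangle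
  have hR : MeasurableSet R := MeasurableEquiv.finTwoArrow.measurable isClosed_refTriangle.measurableSet
  have himg : convexHull ℝ (range v) = (fun z => v 0 + L z) '' R := by
    ext x
    rw [mem_triangle_iff v 0]
    simp only [zero_add, ← hX, ← hY, mem_image]
    constructor
    · rintro ⟨z, hz, rfl⟩
      refine ⟨![z.1, z.2], hz, ?_⟩
      rw [hL]; simp [add_assoc]
    · rintro ⟨z, hz, rfl⟩
      refine ⟨(z 0, z 1), hz, ?_⟩
      rw [hL]; simp [add_assoc]
  have hcv := MeasureTheory.integral_image_eq_integral_abs_det_fderiv_smul MeasureTheory.volume hR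
    (f := fun z => v 0 + L z) (f' := fun _ => L)
    (fun z _ => (L.hasFDerivAt.const_add (v 0)).hasFDerivWithinAt) (by
      intro z _ w _ hzw
      simp only [add_right_inj, hL] at hzw
      obtain ⟨h0, h1⟩ := eq_of_add_smul_eq hv.ne' hzw
      ext i; fin_cases i <;> assumption) f
  rw [himg, hcv]
  simp only [hdet, abs_of_pos hv, smul_eq_mul]
  rw [MeasureTheory.integral_const_mul]
  congr 1
  have := hmp.setIntegral_preimage_emb MeasurableEquiv.finTwoArrow.measurableEmbedding
    (fun z => f (v 0 + z.1 • X + z.2 • Y)) refTriangle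
  rw [← this]
  congr 1
  funext z
  rw [hL]; simp [MeasurableEquiv.finTwoArrow, add_assoc]

end

/-! ### Green's theorem on a triangle -/

section

variable {v : Fin 3 → Plane}

/-- The circulation of the 1-form `P dx + Q dy` along the edge `a`. -/
def edgeFlux (v : Fin 3 → Plane) (P Q : Plane → ℝ) (a : Fin 3) : ℝ :=
  ∫ s in (0 : ℝ)..1, (P (v a + s • (v (a + 1) - v a)) * (v (a + 1) - v a) 0
    + Q (v a + s • (v (a + 1) - v a)) * (v (a + 1) - v a) 1)

theorem segment_mem_triangle (v : Fin 3 → Plane) (a : Fin 3) {s : ℝ} (hs : s ∈ Icc (0 : ℝ) 1) :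
    v a + s • (v (a + 1) - v a) ∈ convexHull ℝ (range v) :=
  (mem_triangle_iff v a).2 ⟨(s, 0), ⟨hs.1, le_rfl, by simpa using hs.2⟩, by simp⟩

theorem continuousOn_edge {f : Plane → ℝ} (hf : ContinuousOn f (convexHull ℝ (range v)))
    (a : Fin 3) : ContinuousOn (fun s : ℝ => f (v a + s • (v (a + 1) - v a))) (Icc 0 1) :=
  hf.comp (by fun_prop) fun _ hs => segment_mem_triangle v a hs

theorem intervalIntegrable_edge {f : Plane → ℝ} (hf : ContinuousOn f (convexHull ℝ (range v)))
    (a : Fin 3) : IntervalIntegrable (fun s : ℝ => f (v a + s • (v (a + 1) - v a)))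
      MeasureTheory.volume 0 1 :=
  (continuousOn_edge hf a).intervalIntegrable_of_Icc zero_le_one

/-- Fundamental theorem of calculus along a line within `S`. -/
theorem integral_pd_segment {S : Set Plane} (hS : UniqueDiffOn ℝ S) {f : Plane → ℝ}
    (hf : ContDiffOn ℝ ∞ f S) {V τ : Plane}
    {L : ℝ} (hL : 0 ≤ L) (hseg : ∀ s ∈ Icc 0 L, V + s • τ ∈ S) :
    ∫ s in (0 : ℝ)..L, (τ 0 * pd S 0 f (V + s • τ) + τ 1 * pd S 1 f (V + s • τ))
      = f (V + L • τ) - f V := by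
  have hd := fun s (hs : s ∈ Icc 0 L) => hasDerivWithinAt_segment hf hseg hs
  have hc : ∀ i, ContinuousOn (fun s => pd S i f (V + s • τ)) (Icc 0 L) := fun i =>
    (contDiffOn_pd hS hf i).continuousOn.comp (by fun_prop) hseg
  have := intervalIntegral.integral_eq_sub_of_hasDerivAt_of_le hL
    (fun s hs => (hd s hs).continuousWithinAt)
    (fun s hs => (hd s (Ioo_subset_Icc_self hs)).hasDerivAt (Icc_mem_nhds hs.1 hs.2))
    (((continuousOn_const.mul (hc 0)).add (continuousOn_const.mul (hc 1))).intervalIntegrable_of_Icc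
      hL)
  rw [this]; simp

/-- **Green's theorem** on a triangle, for 1-forms smooth up to the boundary. -/
theorem green_triangle (hv : 0 < area (v 1 - v 0) (v 2 - v 0)) {P Q : Plane → ℝ}
    (hP : ContDiffOn ℝ ∞ P (convexHull ℝ (range v)))
    (hQ : ContDiffOn ℝ ∞ Q (convexHull ℝ (range v))) :
    ∫ x in convexHull ℝ (range v),
        (pd (convexHull ℝ (range v)) 0 Q x - pd (convexHull ℝ (range v)) 1 P x)
      = ∑ a, edgeFlux v P Q a := by
  have hS := uniqueDiffOn_triangle hv
  obtain ⟨S, hSe⟩ : ∃ S, S = convexHull ℝ (range v) := ⟨_, rfl⟩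
  obtain ⟨X, hX⟩ : ∃ X, X = v 1 - v 0 := ⟨_, rfl⟩
  obtain ⟨Y, hY⟩ : ∃ Y, Y = v 2 - v 0 := ⟨_, rfl⟩
  have hmem : ∀ z ∈ refTriangle, v 0 + z.1 • X + z.2 • Y ∈ S := fun z hz => by
    rw [hSe]; exact (mem_triangle_iff v 0).2 ⟨z, hz, by simp [hX, hY]⟩
  rw [setIntegral_triangle hv, ← hX, ← hY]
  rw [← hSe] at hP hQ hS ⊢
  -- pulled back components
  have sp : ContDiffOn ℝ ∞ (fun x => P x * X 0 + Q x * X 1) S :=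
    (hP.mul contDiffOn_const).add (hQ.mul contDiffOn_const)
  have sq : ContDiffOn ℝ ∞ (fun x => P x * Y 0 + Q x * Y 1) S :=
    (hP.mul contDiffOn_const).add (hQ.mul contDiffOn_const)
  obtain ⟨p, hp⟩ : ∃ p, p = fun x => P x * X 0 + Q x * X 1 := ⟨_, rfl⟩
  obtain ⟨q, hq⟩ : ∃ q, q = fun x => P x * Y 0 + Q x * Y 1 := ⟨_, rfl⟩
  rw [← hp] at sp
  rw [← hq] at sq
  have cmap : ContinuousOn (fun z : ℝ × ℝ => v 0 + z.1 • X + z.2 • Y) refTriangle := by fun_prop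
  have cpd : ∀ {f : Plane → ℝ}, ContDiffOn ℝ ∞ f S → ∀ Z : Plane, ContinuousOn (fun z : ℝ × ℝ =>
      Z 0 * pd S 0 f (v 0 + z.1 • X + z.2 • Y) + Z 1 * pd S 1 f (v 0 + z.1 • X + z.2 • Y))
      refTriangle := fun hf Z =>
    (continuousOn_const.mul ((contDiffOn_pd hS hf 0).continuousOn.comp cmap hmem)).add
      (continuousOn_const.mul ((contDiffOn_pd hS hf 1).continuousOn.comp cmap hmem))
  -- The exterior derivative commutes with the affine pullback: p and q are the values of the 1-form
  -- on X and Y, and area(X,Y) times its exterior derivative is X(q) - Y(p).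
  have hpt : ∀ z ∈ refTriangle, area X Y * (pd S 0 Q (v 0 + z.1 • X + z.2 • Y)
        - pd S 1 P (v 0 + z.1 • X + z.2 • Y))
      = (X 0 * pd S 0 q (v 0 + z.1 • X + z.2 • Y) + X 1 * pd S 1 q (v 0 + z.1 • X + z.2 • Y))
        - (Y 0 * pd S 0 p (v 0 + z.1 • X + z.2 • Y)
          + Y 1 * pd S 1 p (v 0 + z.1 • X + z.2 • Y)) := by
    intro z hz
    have hx := hmem z hz
    generalize v 0 + z.1 • X + z.2 • Y = x at hx
    have hu := hS x hx
    have dP := fun i => HasPd.of_differentiable (i := i) (differentiableWithinAt_of_smooth hP hx)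
    have dQ := fun i => HasPd.of_differentiable (i := i) (differentiableWithinAt_of_smooth hQ hx)
    have d : ∀ i (Z : Plane), pd S i (fun x => P x * Z 0 + Q x * Z 1) x
        = pd S i P x * Z 0 + pd S i Q x * Z 1 := fun i Z =>
      ((((dP i).mul hu (HasPd.const hu (Z 0))).add hu
        ((dQ i).mul hu (HasPd.const hu (Z 1)))).congr_value (by ring)).pd_eq
    rw [hp, hq]
    simp only [d, area]; ring
  rw [← MeasureTheory.integral_const_mul,
    MeasureTheory.setIntegral_congr_fun isClosed_refTriangle.measurableSet hpt,
    MeasureTheory.integral_sub ((cpd sq X).integrableOn_compact isCompact_refTriangle)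
      ((cpd sp Y).integrableOn_compact isCompact_refTriangle),
    integral_refTriangle (cpd sq X), integral_refTriangle_symm (cpd sp Y)]
  -- Each inner integral is that of a total derivative along a segment ending on the edge from `v 1`
  -- to `v 2`.
  have hleft : ∀ y ∈ uIcc (0 : ℝ) 1, (∫ x in (0 : ℝ)..(1 - y),
      (X 0 * pd S 0 q (v 0 + x • X + y • Y) + X 1 * pd S 1 q (v 0 + x • X + y • Y)))
      = q (v 1 + y • (v 2 - v 1)) - q (v 0 + y • Y) := by
    intro y hy
    rw [uIcc_of_le zero_le_one] at hy
    have := integral_pd_segment hS sq (V := v 0 + y • Y) (τ := X) (L := 1 - y)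
      (by linarith [hy.2]) (fun s hs => by
        have := hmem (s, y) ⟨hs.1, hy.1, by have := hs.2; simp only; linarith⟩
        rwa [add_right_comm])
    simp only [add_right_comm _ (_ • X) (_ • Y)]
    rw [this]
    congr 2
    ext i; simp [hX, hY]; ring
  have hright : ∀ x ∈ uIcc (0 : ℝ) 1, (∫ y in (0 : ℝ)..(1 - x),
      (Y 0 * pd S 0 p (v 0 + x • X + y • Y) + Y 1 * pd S 1 p (v 0 + x • X + y • Y)))
      = p (v 1 + (1 - x) • (v 2 - v 1)) - p (v 0 + x • X) := by
    intro x hx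
    rw [uIcc_of_le zero_le_one] at hx
    have := integral_pd_segment hS sp (V := v 0 + x • X) (τ := Y) (L := 1 - x)
      (by linarith [hx.2]) (fun s hs =>
        hmem (x, s) ⟨hx.1, hs.1, by have := hs.2; simp only; linarith⟩)
    rw [this]
    congr 2
    ext i; simp [hX, hY]; ring
  simp only at hleft hright ⊢
  rw [intervalIntegral.integral_congr hleft, intervalIntegral.integral_congr hright]
  have e2 : (1 : Fin 3) + 1 = 2 := rfl
  have e3 : (2 : Fin 3) + 1 = 0 := rfl
  have i0 : ∀ {f : Plane → ℝ}, ContDiffOn ℝ ∞ f S → IntervalIntegrable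
      (fun s : ℝ => f (v 0 + s • X)) MeasureTheory.volume 0 1 := fun hf => by
    have := intervalIntegrable_edge (hSe ▸ hf.continuousOn) 0 (v := v)
    simpa [← hX] using this
  have i1 : ∀ {f : Plane → ℝ}, ContDiffOn ℝ ∞ f S → IntervalIntegrable
      (fun s : ℝ => f (v 1 + s • (v 2 - v 1))) MeasureTheory.volume 0 1 := fun hf => by
    have := intervalIntegrable_edge (hSe ▸ hf.continuousOn) 1 (v := v)
    simpa only [e2] using this
  have i2 : ∀ {f : Plane → ℝ}, ContDiffOn ℝ ∞ f S → IntervalIntegrable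
      (fun s : ℝ => f (v 0 + s • Y)) MeasureTheory.volume 0 1 := fun {f} hf => by
    have hc : ContinuousOn (fun s : ℝ => f (v 0 + s • Y)) (Icc 0 1) :=
      hf.continuousOn.comp (by fun_prop) fun s hs => by
        have := hmem (0, s) ⟨le_rfl, hs.1, by simpa using hs.2⟩
        simpa using this
    exact hc.intervalIntegrable_of_Icc zero_le_one
  have i1' : IntervalIntegrable (fun s : ℝ => p (v 1 + (1 - s) • (v 2 - v 1)))
      MeasureTheory.volume 0 1 := by
    simpa using ((i1 sp).comp_sub_left 1).symm
  rw [intervalIntegral.integral_sub (i1 sq) (i2 sq), intervalIntegral.integral_sub i1' (i0 sp)]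
  -- The second iterated integral meets the edge from `v 1` to `v 2` in the reverse parametrization.
  have r1 : ∫ s in (0 : ℝ)..1, p (v 1 + (1 - s) • (v 2 - v 1))
      = ∫ s in (0 : ℝ)..1, p (v 1 + s • (v 2 - v 1)) := by
    simpa using intervalIntegral.integral_comp_sub_left (a := 0) (b := 1)
      (fun s => p (v 1 + s • (v 2 - v 1))) 1
  -- Edge 2 runs from `v 2` to `v 0`, against Y; this is the origin of the sign.
  have r2 : edgeFlux v P Q 2 = -∫ s in (0 : ℝ)..1, q (v 0 + s • Y) := by
    have := intervalIntegral.integral_comp_sub_left (a := 0) (b := 1)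
      (fun s => q (v 0 + s • Y)) 1
    simp only [sub_zero, sub_self] at this
    rw [← this, ← intervalIntegral.integral_neg, edgeFlux]
    congr 1
    funext s
    have : v 2 + s • (v (2 + 1) - v 2) = v 0 + (1 - s) • Y := by
      rw [e3, hY]; ext i; simp; ring
    rw [this, hq, e3, hY]
    simp only [Pi.sub_apply]; ring
  have r0 : edgeFlux v P Q 0 = ∫ s in (0 : ℝ)..1, p (v 0 + s • X) := by
    simp only [edgeFlux, zero_add, ← hX, hp]
  have r3 : edgeFlux v P Q 1 = (∫ s in (0 : ℝ)..1, q (v 1 + s • (v 2 - v 1)))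
      - ∫ s in (0 : ℝ)..1, p (v 1 + s • (v 2 - v 1)) := by
    rw [← intervalIntegral.integral_sub (i1 sq) (i1 sp), edgeFlux]
    simp only [e2, hp, hq, hX, hY, Pi.sub_apply]
    congr 1
    funext s
    ring
  rw [r1, Fin.sum_univ_three, r0, r2, r3]
  ring

end

section

/-! ### Regularity of the variations -/

variable {S : Set Plane} {g σ : TensorField} {x : Plane}

theorem SmoothSym.contDiffOn_det (hg : SmoothSym S g) : ContDiffOn ℝ ∞ (fun x => (g x).det) S := by
  simp only [Matrix.det_fin_two]
  exact ((hg.1 0 0).mul (hg.1 1 1)).sub ((hg.1 0 1).mul (hg.1 1 0))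

theorem SmoothSym.contDiffOn_christoffel₁ (hS : UniqueDiffOn ℝ S) (hg : SmoothSym S g)
    (i j l : Fin 2) : ContDiffOn ℝ ∞ (christoffel₁ S g i j l) S :=
  (((contDiffOn_pd hS (hg.1 j l) i).add (contDiffOn_pd hS (hg.1 l i) j)).sub
    (contDiffOn_pd hS (hg.1 i j) l)).div_const 2

theorem contDiffOn_connForm (hS : UniqueDiffOn ℝ S) (hg : SmoothSym S g)
    (hpos : ∀ x ∈ S, PosMinors (g x)) (i : Fin 2) : ContDiffOn ℝ ∞ (connForm S g i) S :=
  (((hg.contDiffOn_christoffel₁ hS i 0 1).sub (((hg.1 0 1).div (hg.1 0 0)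
    fun x hx => (hpos x hx).1.ne').mul (hg.contDiffOn_christoffel₁ hS i 0 0))).neg).div
    (hg.contDiffOn_det.sqrt fun x hx => (hpos x hx).2.1.ne') fun x hx => (hpos x hx).sqrt_pos.ne'

theorem contDiffOn_frameSpin (hσ : SmoothSym S σ) {t : ℝ}
    (hpos : ∀ x ∈ S, PosMinors (euclidPath σ t x)) : ContDiffOn ℝ ∞ (frameSpin σ t) S := by
  have h0 : ∀ x ∈ S, 1 + t * σ x 0 0 ≠ 0 := fun x hx => by
    rw [← (euclidPath_apply σ t x).1]; exact (hpos x hx).1.ne'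
  exact (((hσ.1 0 1).sub (((contDiffOn_const.mul (hσ.1 0 1)).div
    (contDiffOn_const.add (contDiffOn_const.mul (hσ.1 0 0))) h0).mul (hσ.1 0 0))).div
    ((hσ.euclidPath t).contDiffOn_det.sqrt fun x hx => (hpos x hx).2.1.ne')
    fun x hx => (hpos x hx).sqrt_pos.ne').div_const 2

/-- The derivative in `t` of the frame angle of `τ` along the path `δ + t σ`. -/
def angleRate (σ : TensorField) (τ : Plane) (t : ℝ) (x : Plane) : ℝ :=
  form (σ x) (rawNormal (euclidPath σ t x) τ) τ * Real.sqrt (euclidPath σ t x).det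
        / form (euclidPath σ t x) τ τ / 2 - frameSpin σ t x

/-- The tensor field stays a metric along the path `δ + t σ`, `0 ≤ t ≤ 1`. -/
def PathPos (S : Set Plane) (σ : TensorField) : Prop :=
  ∀ t ∈ Icc (0 : ℝ) 1, ∀ x ∈ S, PosMinors (euclidPath σ t x)

theorem continuousOn_path {f : Plane → ℝ} (hf : ContinuousOn f S) :
    ContinuousOn (fun z : ℝ × Plane => f z.2) (Icc 0 1 ×ˢ S) :=
  hf.comp continuousOn_snd fun _ hz => hz.2

theorem continuousOn_det_path (hσ : SmoothSym S σ) :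
    ContinuousOn (fun z : ℝ × Plane => (euclidPath σ z.1 z.2).det) (Icc 0 1 ×ˢ S) := by
  have h : (fun z : ℝ × Plane => (euclidPath σ z.1 z.2).det) = fun z =>
      (1 + z.1 * σ z.2 0 0) * (1 + z.1 * σ z.2 1 1) - z.1 * σ z.2 0 1 * (z.1 * σ z.2 1 0) := by
    funext z
    obtain ⟨h1, h2, h3, h4⟩ := euclidPath_apply σ z.1 z.2
    rw [Matrix.det_fin_two, h1, h2, h3, h4]
  rw [h]
  have c := fun i j => continuousOn_path (hσ.1 i j).continuousOn
  exact ((continuousOn_const.add (continuousOn_fst.mul (c 0 0))).mul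
    (continuousOn_const.add (continuousOn_fst.mul (c 1 1)))).sub
    ((continuousOn_fst.mul (c 0 1)).mul (continuousOn_fst.mul (c 1 0)))

/-- Joint continuity in time and space on a compact product justifies both the exchange of integrals
and the fundamental theorem of calculus in t. The next lemma plays the same role on the edges. -/
theorem continuousOn_connRate (hS : UniqueDiffOn ℝ S) (hσ : SmoothSym S σ) (hpos : PathPos S σ)
    (i : Fin 2) :
    ContinuousOn (fun z : ℝ × Plane => connRate S σ i z.1 z.2) (Icc 0 1 ×ˢ S) := by
  have hA := continuousOn_path (hσ.1 0 0).continuousOn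
  have hB := continuousOn_path (hσ.1 0 1).continuousOn
  have hC := continuousOn_path (hσ.1 1 1).continuousOn
  have hG := continuousOn_path (hσ.contDiffOn_christoffel₁ hS i 0 0).continuousOn
  have hH := continuousOn_path (hσ.contDiffOn_christoffel₁ hS i 0 1).continuousOn
  have hD := continuousOn_det_path hσ
  have ht : ContinuousOn (fun z : ℝ × Plane => z.1) (Icc 0 1 ×ˢ S) := continuousOn_fst
  have h0 : ∀ z ∈ Icc (0 : ℝ) 1 ×ˢ S, 1 + z.1 * σ z.2 0 0 ≠ 0 := fun z hz => by
    rw [← (euclidPath_apply σ z.1 z.2).1]; exact (hpos _ hz.1 _ hz.2).1.ne'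
  have h1 : ∀ z ∈ Icc (0 : ℝ) 1 ×ˢ S, (euclidPath σ z.1 z.2).det ≠ 0 := fun z hz =>
    (hpos _ hz.1 _ hz.2).2.1.ne'
  have h2 : ∀ z ∈ Icc (0 : ℝ) 1 ×ˢ S, Real.sqrt (euclidPath σ z.1 z.2).det ≠ 0 := fun z hz =>
    (hpos _ hz.1 _ hz.2).sqrt_pos.ne'
  simp only [connRate]
  have c1 := continuousOn_const (c := (1 : ℝ)) |>.add (ht.mul hA)
  have c2 := (((ht.mul hB).div c1 h0).mul hG).sub hH
  have c3 := ((hA.mul (continuousOn_const (c := (1 : ℝ)) |>.add (ht.mul hC))).add (c1.mul hC)).sub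
    (((continuousOn_const (c := (2 : ℝ))).mul ht).mul (hB.pow 2))
  have c4 := (((hB.mul c1).sub ((ht.mul hB).mul hA)).div (c1.pow 2)
    fun z hz => pow_ne_zero 2 (h0 z hz)).mul hG
  exact (((continuousOn_const (c := (1 : ℝ)).mul c2).add (ht.mul c4)).sub
    (((ht.mul c2).mul c3).div ((continuousOn_const (c := (2 : ℝ))).mul hD)
      fun z hz => mul_ne_zero two_ne_zero (h1 z hz))).div hD.sqrt h2

theorem continuousOn_angleRate (hσ : SmoothSym S σ) (hpos : PathPos S σ) {τ : Plane} (hτ : τ ≠ 0) :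
    ContinuousOn (fun z : ℝ × Plane => angleRate σ τ z.1 z.2) (Icc 0 1 ×ˢ S) := by
  have hA := continuousOn_path (hσ.1 0 0).continuousOn
  have hB := continuousOn_path (hσ.1 0 1).continuousOn
  have hC := continuousOn_path (hσ.1 1 1).continuousOn
  have hD := continuousOn_det_path hσ
  have ht : ContinuousOn (fun z : ℝ × Plane => z.1) (Icc 0 1 ×ˢ S) := continuousOn_fst
  have h0 : ∀ z ∈ Icc (0 : ℝ) 1 ×ˢ S, 1 + z.1 * σ z.2 0 0 ≠ 0 := fun z hz => by
    rw [← (euclidPath_apply σ z.1 z.2).1]; exact (hpos _ hz.1 _ hz.2).1.ne'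
  have h1 : ∀ z ∈ Icc (0 : ℝ) 1 ×ˢ S, (euclidPath σ z.1 z.2).det ≠ 0 := fun z hz =>
    (hpos _ hz.1 _ hz.2).2.1.ne'
  have h2 : ∀ z ∈ Icc (0 : ℝ) 1 ×ˢ S, Real.sqrt (euclidPath σ z.1 z.2).det ≠ 0 := fun z hz =>
    (hpos _ hz.1 _ hz.2).sqrt_pos.ne'
  have hq : ContinuousOn (fun z : ℝ × Plane => form (euclidPath σ z.1 z.2) τ τ) (Icc 0 1 ×ˢ S) := by
    have : ContinuousOn (fun z : ℝ × Plane => (1 + z.1 * σ z.2 0 0) * τ 0 * τ 0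
        + z.1 * σ z.2 0 1 * (τ 0 * τ 1 + τ 1 * τ 0) + (1 + z.1 * σ z.2 1 1) * τ 1 * τ 1)
        (Icc 0 1 ×ˢ S) :=
      ((((continuousOn_const.add (ht.mul hA)).mul continuousOn_const).mul continuousOn_const).add
        ((ht.mul hB).mul continuousOn_const)).add
        (((continuousOn_const.add (ht.mul hC)).mul continuousOn_const).mul continuousOn_const)
    refine this.congr fun z hz => ?_
    obtain ⟨e1, e2, -, e4⟩ := euclidPath_apply σ z.1 z.2
    simp only
    rw [(hpos _ hz.1 _ hz.2).form_eq, e1, e2, e4]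
  have h3 : ∀ z ∈ Icc (0 : ℝ) 1 ×ˢ S, form (euclidPath σ z.1 z.2) τ τ ≠ 0 := fun z hz =>
    ((hpos _ hz.1 _ hz.2).form_pos hτ).ne'
  have n0 : ContinuousOn (fun z : ℝ × Plane => rawNormal (euclidPath σ z.1 z.2) τ 0)
      (Icc 0 1 ×ˢ S) := by
    have : ContinuousOn (fun z : ℝ × Plane => -((1 + z.1 * σ z.2 1 1) * τ 1 + z.1 * σ z.2 0 1 * τ 0)
        / (euclidPath σ z.1 z.2).det) (Icc 0 1 ×ˢ S) :=
      (((continuousOn_const.add (ht.mul hC)).mul continuousOn_const).add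
        ((ht.mul hB).mul continuousOn_const)).neg.div hD h1
    refine this.congr fun z hz => ?_
    obtain ⟨e1, e2, -, e4⟩ := euclidPath_apply σ z.1 z.2
    simp only
    rw [((hpos _ hz.1 _ hz.2).rawNormal_apply τ).1, e2, e4]
  have n1 : ContinuousOn (fun z : ℝ × Plane => rawNormal (euclidPath σ z.1 z.2) τ 1)
      (Icc 0 1 ×ˢ S) := by
    have : ContinuousOn (fun z : ℝ × Plane => (z.1 * σ z.2 0 1 * τ 1 + (1 + z.1 * σ z.2 0 0) * τ 0)
        / (euclidPath σ z.1 z.2).det) (Icc 0 1 ×ˢ S) :=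
      ((((ht.mul hB).mul continuousOn_const).add
        ((continuousOn_const.add (ht.mul hA)).mul continuousOn_const))).div hD h1
    refine this.congr fun z hz => ?_
    obtain ⟨e1, e2, -, e4⟩ := euclidPath_apply σ z.1 z.2
    simp only
    rw [((hpos _ hz.1 _ hz.2).rawNormal_apply τ).2, e1, e2]
  have hform : ContinuousOn (fun z : ℝ × Plane =>
      form (σ z.2) (rawNormal (euclidPath σ z.1 z.2) τ) τ) (Icc 0 1 ×ˢ S) := by
    have hB' := continuousOn_path (hσ.1 1 0).continuousOn
    simp only [form_eq]
    exact ((((hA.mul n0).mul continuousOn_const).add ((hB.mul n0).mul continuousOn_const)).add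
      ((hB'.mul n1).mul continuousOn_const)).add ((hC.mul n1).mul continuousOn_const)
  simp only [angleRate, frameSpin]
  exact (((hform.mul hD.sqrt).div hq h3).div_const 2).sub
    (((hB.sub (((ht.mul hB).div (continuousOn_const.add (ht.mul hA)) h0).mul hA)).div
      hD.sqrt h2).div_const 2)

end

section

/-! ### Interior angles -/

variable {S : Set Plane} {g σ : TensorField} {x : Plane}

/-- The interior angle between consecutive edges `m`, `p` of a positively oriented polygon. -/
def cornerAngle (A : Matrix (Fin 2) (Fin 2) ℝ) (m p : Plane) : ℝ :=
  Real.arccos (form A (-m) p / (Real.sqrt (form A m m) * Real.sqrt (form A p p)))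

theorem PosMinors.lagrange_identity {A : Matrix (Fin 2) (Fin 2) ℝ} (hA : PosMinors A)
    (m p : Plane) :
    form A m m * form A p p - form A m p ^ 2 = A.det * area m p ^ 2 := by
  rw [hA.form_eq, hA.form_eq, hA.form_eq, hA.det_eq, area]; ring

theorem form_neg_left (A : Matrix (Fin 2) (Fin 2) ℝ) (X Y : Plane) :
    form A (-X) Y = -form A X Y := by
  simp only [form_eq, Pi.neg_apply]; ring

theorem hasDerivAt_form_euclidPath (σ : TensorField) (x X Y : Plane) (t : ℝ) :
    HasDerivAt (fun t => form (euclidPath σ t x) X Y) (form (σ x) X Y) t := by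
  have h : (fun t => form (euclidPath σ t x) X Y)
      = fun t => form 1 X Y + t * form (σ x) X Y := by
    funext t
    simp [form_eq, euclidPath]; ring
  rw [h]
  simpa using ((hasDerivAt_id t).mul_const (form (σ x) X Y)).const_add (form 1 X Y)

theorem hasDerivAt_cornerAngle {t : ℝ} (hA : PosMinors (euclidPath σ t x))
    {m p : Plane} (hmp : 0 < area m p) :
    HasDerivAt (fun t => cornerAngle (euclidPath σ t x) m p)
      ((form (σ x) m p - form (euclidPath σ t x) m p *
        (form (σ x) m m / form (euclidPath σ t x) m m
          + form (σ x) p p / form (euclidPath σ t x) p p) / 2)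
        / (Real.sqrt (euclidPath σ t x).det * area m p)) t := by
  have hm : m ≠ 0 := by rintro rfl; simp [area] at hmp
  have hp : p ≠ 0 := by rintro rfl; simp [area] at hmp
  have hL := hA.lagrange_identity m p
  have qm := hA.form_pos hm
  have qp := hA.form_pos hp
  have lm : 0 < Real.sqrt (form (euclidPath σ t x) m m) := Real.sqrt_pos.2 qm
  have lp : 0 < Real.sqrt (form (euclidPath σ t x) p p) := Real.sqrt_pos.2 qp
  have em := Real.mul_self_sqrt qm.le
  have ep := Real.mul_self_sqrt qp.le
  have hr := hA.sqrt_pos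
  have er := Real.mul_self_sqrt hA.2.1.le
  have dm := (Real.hasDerivAt_sqrt qm.ne').comp t (hasDerivAt_form_euclidPath σ x m m t)
  have dp := (Real.hasDerivAt_sqrt qp.ne').comp t (hasDerivAt_form_euclidPath σ x p p t)
  have dmp := hasDerivAt_form_euclidPath σ x (-m) p t
  have dq := dmp.div (dm.mul dp) (mul_pos lm lp).ne'
  -- The sine of the interior angle, by Lagrange's identity. It is positive because `area m p` is,
  -- so the arccosine is not evaluated at ±1 and is differentiable.
  have hc : Real.sqrt (1 - (form (euclidPath σ t x) (-m) p / (Real.sqrt (form (euclidPath σ t x) m m)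
        * Real.sqrt (form (euclidPath σ t x) p p))) ^ 2)
      = Real.sqrt (euclidPath σ t x).det * area m p / (Real.sqrt (form (euclidPath σ t x) m m)
        * Real.sqrt (form (euclidPath σ t x) p p)) := by
    rw [Real.sqrt_eq_iff_mul_self_eq_of_pos (by positivity)]
    rw [form_neg_left]
    field_simp
    rw [Real.sq_sqrt qm.le, Real.sq_sqrt qp.le, Real.sq_sqrt hA.2.1.le]
    linarith
  have hpos : 0 < 1 - (form (euclidPath σ t x) (-m) p / (Real.sqrt (form (euclidPath σ t x) m m)
        * Real.sqrt (form (euclidPath σ t x) p p))) ^ 2 := by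
    rw [← Real.sqrt_pos, hc]; positivity
  have n1 : form (euclidPath σ t x) (-m) p / (Real.sqrt (form (euclidPath σ t x) m m)
        * Real.sqrt (form (euclidPath σ t x) p p)) ≠ -1 := fun h => by
    rw [h] at hpos; norm_num at hpos
  have n2 : form (euclidPath σ t x) (-m) p / (Real.sqrt (form (euclidPath σ t x) m m)
        * Real.sqrt (form (euclidPath σ t x) p p)) ≠ 1 := fun h => by
    rw [h] at hpos; norm_num at hpos
  have := (Real.hasDerivAt_arccos n1 n2).comp t dq
  refine this.congr_deriv ?_
  rw [hc]
  simp only [Function.comp, Pi.mul_apply, form_neg_left]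
  have aux : ∀ u w M P l n q q' r k : ℝ, l ≠ 0 → n ≠ 0 → r ≠ 0 → k ≠ 0 → l * l = q → n * n = q' →
      -(1 / (r * k / (l * n))) * ((-u * (l * n) - -w * (1 / (2 * l) * M * n + l * (1 / (2 * n) * P)))
        / (l * n) ^ 2) = (u - w * (M / q + P / q') / 2) / (r * k) := by
    intro u w M P l n q q' r k hl hn hr hk h1 h2
    rw [← h1, ← h2]
    field_simp
    ring
  exact aux _ _ _ _ _ _ _ _ _ _ lm.ne' lp.ne' hr.ne' hmp.ne' em ep

/-- The turning of the frame angle at a corner and the interior angle vary in the same way. -/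
theorem frameAngle_sub_cornerAngle (hσ : σ x 1 0 = σ x 0 1)
    (hpos : ∀ t ∈ Icc (0 : ℝ) 1, PosMinors (euclidPath σ t x)) {m p : Plane} (hmp : 0 < area m p) :
    frameAngle (euclidPath σ 1 x) m - frameAngle (euclidPath σ 1 x) p
        - cornerAngle (euclidPath σ 1 x) m p
      = frameAngle (euclidPath σ 0 x) m - frameAngle (euclidPath σ 0 x) p
        - cornerAngle (euclidPath σ 0 x) m p := by
  have hm : m ≠ 0 := by rintro rfl; simp [area] at hmp
  have hp : p ≠ 0 := by rintro rfl; simp [area] at hmp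
  have hd : ∀ t ∈ Icc (0 : ℝ) 1, HasDerivAt (fun t => frameAngle (euclidPath σ t x) m
      - frameAngle (euclidPath σ t x) p - cornerAngle (euclidPath σ t x) m p) 0 t := by
    intro t ht
    have hA := hpos t ht
    refine (((hasDerivAt_frameAngle_euclidPath hA hσ hm).sub
      (hasDerivAt_frameAngle_euclidPath hA hσ hp)).sub (hasDerivAt_cornerAngle hA hmp)).congr_deriv ?_
    obtain ⟨n0, n1⟩ := hA.rawNormal_apply m
    obtain ⟨k0, k1⟩ := hA.rawNormal_apply p
    have qm := (hA.form_pos hm).ne'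
    have qp := (hA.form_pos hp).ne'
    have hr := hA.sqrt_pos.ne'
    have er := Real.mul_self_sqrt hA.2.1.le
    have hD := hA.2.1.ne'
    have hD2 := hA.det_eq
    have hl : ∀ X Y : ℝ, X * Real.sqrt (euclidPath σ t x).det / Y
        = X * (euclidPath σ t x).det / Y / Real.sqrt (euclidPath σ t x).det := fun X Y => by
      rw [eq_div_iff hr, ← er]
      ring_nf
      simp
    -- Z is the spin of the frame. It is the same for both edge directions and cancels in their
    -- difference.
    have hcomb : ∀ U V W Z r k : ℝ, U / r / 2 - Z - (V / r / 2 - Z) - W / (r * k)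
        = (U / 2 - V / 2 - W / k) / r := fun U V W Z r k => by
      rw [← div_div, div_right_comm W]; ring
    rw [hl, hl, hcomb]
    rw [div_eq_zero_iff]
    left
    rw [form_eq (σ x) (rawNormal _ _), form_eq (σ x) (rawNormal _ _), n0, n1, k0, k1, hσ,
      form_eq (σ x) m m, form_eq (σ x) p p, form_eq (σ x) m p, hσ, hA.form_eq m p]
    rw [sub_eq_zero]
    have hmp' := hmp.ne'
    have em := hA.form_eq m m
    have ep := hA.form_eq p p
    have ea : area m p = m 0 * p 1 - m 1 * p 0 := rfl
    clear * - em ep ea hmp' qm qp hD hD2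
    generalize (euclidPath σ t x).det = D at *
    generalize form (euclidPath σ t x) m m = qM at *
    generalize form (euclidPath σ t x) p p = qP at *
    generalize area m p = k at *
    generalize euclidPath σ t x 0 0 = a at *
    generalize euclidPath σ t x 0 1 = b at *
    generalize euclidPath σ t x 1 1 = c at *
    field_simp
    rw [em, ep, ea]
    ring
  -- The value of the constant, an odd multiple of π depending on the branch of the argument, is not
  -- needed.
  have := constant_of_has_deriv_right_zero
    (fun t ht => (hd t ht).continuousAt.continuousWithinAt)
    (fun t ht => (hd t (Ico_subset_Icc_self ht)).hasDerivWithinAt) 1 (right_mem_Icc.2 zero_le_one)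
  exact this

end

section

/-! ### The identity on a single triangle -/

variable {v : Fin 3 → Plane} {g σ : TensorField} {φ : Plane → ℝ}

/-- The element and edge curvature of a triangle tested with `φ`. -/
def triangleCurvature (v : Fin 3 → Plane) (g : TensorField) (φ : Plane → ℝ) : ℝ :=
  (∫ x in convexHull ℝ (range v), gaussCurvature (convexHull ℝ (range v)) g x * φ x
      * Real.sqrt (g x).det)
    + ∑ a : Fin 3, ∫ s in (0 : ℝ)..1,
        geodesicCurvature (convexHull ℝ (range v)) g (v (a + 1) - v a)
            (v a + s • (v (a + 1) - v a)) * φ (v a + s • (v (a + 1) - v a))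
          * Real.sqrt (form (g (v a + s • (v (a + 1) - v a))) (v (a + 1) - v a) (v (a + 1) - v a))

/-- The derivative of `φ` along the edge `a`. -/
def edgeDeriv (v : Fin 3 → Plane) (φ : Plane → ℝ) (a : Fin 3) (s : ℝ) : ℝ :=
  (v (a + 1) - v a) 0 * pd (convexHull ℝ (range v)) 0 φ (v a + s • (v (a + 1) - v a))
    + (v (a + 1) - v a) 1 * pd (convexHull ℝ (range v)) 1 φ (v a + s • (v (a + 1) - v a))

/-- The value `(dφ ∧ ω)(∂_1, ∂_2)` for a 1-form with components `w`. -/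
def wedge (S : Set Plane) (φ : Plane → ℝ) (w : Fin 2 → Plane → ℝ) (x : Plane) : ℝ :=
  pd S 0 φ x * w 1 x - pd S 1 φ x * w 0 x

theorem tangent_ne_zero (hv : 0 < area (v 1 - v 0) (v 2 - v 0)) (a : Fin 3) :
    v (a + 1) - v a ≠ 0 := by
  intro h
  rw [← area_shift v a, h] at hv
  simp [area] at hv

theorem area_tangents (v : Fin 3 → Plane) (a : Fin 3) :
    area (v (a + 1) - v a) (v (a + 1 + 1) - v (a + 1)) = area (v 1 - v 0) (v 2 - v 0) := by
  have e : a + 1 + 1 = a + 2 := by rw [add_assoc]; rfl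
  rw [← area_shift v a, e]
  simp only [area, Pi.sub_apply]; ring

theorem continuousOn_edgeDeriv (hv : 0 < area (v 1 - v 0) (v 2 - v 0))
    (hφ : ContDiffOn ℝ ∞ φ (convexHull ℝ (range v))) (a : Fin 3) :
    ContinuousOn (edgeDeriv v φ a) (Icc 0 1) := by
  have hS := uniqueDiffOn_triangle hv
  exact (continuousOn_const.mul (continuousOn_edge (contDiffOn_pd hS hφ 0).continuousOn a)).add
    (continuousOn_const.mul (continuousOn_edge (contDiffOn_pd hS hφ 1).continuousOn a))

theorem integral_edgeDeriv (hv : 0 < area (v 1 - v 0) (v 2 - v 0))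
    (hφ : ContDiffOn ℝ ∞ φ (convexHull ℝ (range v))) (a : Fin 3) :
    ∫ s in (0 : ℝ)..1, edgeDeriv v φ a s = φ (v (a + 1)) - φ (v a) := by
  have := integral_pd_segment (uniqueDiffOn_triangle hv) hφ (V := v a) (τ := v (a + 1) - v a)
    zero_le_one fun s hs => segment_mem_triangle v a hs
  rw [one_smul, add_sub_cancel] at this
  exact this

theorem hasDerivWithinAt_edge (hφ : ContDiffOn ℝ ∞ φ (convexHull ℝ (range v))) (a : Fin 3) {s : ℝ}
    (hs : s ∈ Icc (0 : ℝ) 1) :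
    HasDerivWithinAt (fun s => φ (v a + s • (v (a + 1) - v a))) (edgeDeriv v φ a s) (Icc 0 1) s :=
  hasDerivWithinAt_segment hφ (fun _ hs => segment_mem_triangle v a hs) hs

/-- Integration by parts for θp with θ' = k + w. In the application θ is the frame angle along an
edge, k the geodesic curvature density and w the connection form. -/
theorem integral_mul_eq_of_hasDerivWithinAt {θ k w p d : ℝ → ℝ}
    (hθ : ∀ s ∈ Icc (0 : ℝ) 1, HasDerivWithinAt θ (k s + w s) (Icc 0 1) s)
    (hp : ∀ s ∈ Icc (0 : ℝ) 1, HasDerivWithinAt p (d s) (Icc 0 1) s)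
    (hk : ContinuousOn k (Icc 0 1)) (hw : ContinuousOn w (Icc 0 1)) (hd : ContinuousOn d (Icc 0 1)) :
    ∫ s in (0 : ℝ)..1, k s * p s = θ 1 * p 1 - θ 0 * p 0 - (∫ s in (0 : ℝ)..1, θ s * d s)
      - ∫ s in (0 : ℝ)..1, w s * p s := by
  have cθ : ContinuousOn θ (Icc 0 1) := fun s hs => (hθ s hs).continuousWithinAt
  have cp : ContinuousOn p (Icc 0 1) := fun s hs => (hp s hs).continuousWithinAt
  have I1 := (hk.mul cp).intervalIntegrable_of_Icc (μ := MeasureTheory.volume) zero_le_one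
  have I2 := (hw.mul cp).intervalIntegrable_of_Icc (μ := MeasureTheory.volume) zero_le_one
  have I3 := (cθ.mul hd).intervalIntegrable_of_Icc (μ := MeasureTheory.volume) zero_le_one
  have h := intervalIntegral.integral_eq_sub_of_hasDerivAt_of_le zero_le_one
    (f := fun s => θ s * p s) (f' := fun s => (k s * p s + w s * p s) + θ s * d s)
    (cθ.mul cp)
    (fun s hs => (((hθ s (Ioo_subset_Icc_self hs)).mul
      (hp s (Ioo_subset_Icc_self hs))).hasDerivAt (Icc_mem_nhds hs.1 hs.2)).congr_deriv (by ring))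
    ((I1.add I2).add I3)
  have e1 := intervalIntegral.integral_add (I1.add I2) I3
  have e2 := intervalIntegral.integral_add I1 I2
  simp only [Pi.mul_apply] at e1 e2
  rw [e1, e2] at h
  linarith

/-- Continuity is read off from the exterior derivative of the smooth connection form, without
examining iterated covariant derivatives. -/
theorem continuousOn_gaussCurvature_mul_sqrt_det {S : Set Plane} (hS : UniqueDiffOn ℝ S)
    (hcl : S ⊆ closure (interior S)) (hg : SmoothSym S g) (hpos : ∀ x ∈ S, PosMinors (g x)) :
    ContinuousOn (fun x => gaussCurvature S g x * Real.sqrt (g x).det) S := by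
  have hw := contDiffOn_connForm hS hg hpos
  exact ((contDiffOn_pd hS (hw 1) 0).continuousOn.sub
    (contDiffOn_pd hS (hw 0) 1).continuousOn).congr
    fun x hx => gaussCurvature_mul_sqrt_det hS hcl hg hpos hx

theorem continuousOn_geodesicCurvature_mul_length {S : Set Plane} (hS : UniqueDiffOn ℝ S)
    (hg : SmoothSym S g) (hpos : ∀ x ∈ S, PosMinors (g x)) {τ : Plane} (hτ : τ ≠ 0) :
    ContinuousOn (fun x => geodesicCurvature S g τ x * Real.sqrt (form (g x) τ τ)) S := by
  have hQ : ContinuousOn (fun x => form (g x) τ τ) S := by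
    simp only [form_eq]
    have := fun i j => (hg.1 i j).continuousOn
    fun_prop
  have hΓ : ∀ i j k, ContinuousOn (christoffel₂ S g i j k) S := fun i j k => by
    have h1 := fun l => (hg.contDiffOn_christoffel₁ hS i j l).continuousOn
    have h2 := fun i j => (hg.1 i j).continuousOn
    have h3 := hg.contDiffOn_det.continuousOn
    have h4 : ∀ x ∈ S, (g x).det ≠ 0 := fun x hx => (hpos x hx).2.1.ne'
    fin_cases k
    · exact ((((h2 1 1).mul (h1 0)).sub ((h2 0 1).mul (h1 1))).div h3 h4).congr
        fun x hx => christoffel₂_zero (hpos x hx) i j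
    · exact ((((h2 0 0).mul (h1 1)).sub ((h2 0 1).mul (h1 0))).div h3 h4).congr
        fun x hx => christoffel₂_one (hpos x hx) i j
  have : ContinuousOn (fun x => (τ 0 * (∑ i, ∑ j, christoffel₂ S g i j 1 x * τ i * τ j)
      - τ 1 * (∑ i, ∑ j, christoffel₂ S g i j 0 x * τ i * τ j))
      * Real.sqrt (g x).det / form (g x) τ τ) S := by
    refine ContinuousOn.div (ContinuousOn.mul ?_ hg.contDiffOn_det.continuousOn.sqrt) hQ
      fun x hx => ((hpos x hx).form_pos hτ).ne'
    simp only [Fin.sum_univ_two]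
    fun_prop
  exact this.congr fun x hx => geodesicCurvature_mul_length hS hg hpos hx hτ

/-- The weak form of the curvature of a triangle: all derivatives of the metric are in the
connection form. -/
theorem triangleCurvature_eq (hv : 0 < area (v 1 - v 0) (v 2 - v 0))
    (hg : SmoothSym (convexHull ℝ (range v)) g)
    (hpos : ∀ x ∈ convexHull ℝ (range v), PosMinors (g x))
    (hφ : ContDiffOn ℝ ∞ φ (convexHull ℝ (range v))) :
    triangleCurvature v g φ =
      -(∫ x in convexHull ℝ (range v), wedge (convexHull ℝ (range v)) φ
          (connForm (convexHull ℝ (range v)) g) x)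
      - (∑ a, ∫ s in (0 : ℝ)..1,
          frameAngle (g (v a + s • (v (a + 1) - v a))) (v (a + 1) - v a) * edgeDeriv v φ a s)
      + ∑ a, φ (v a) * (frameAngle (g (v a)) (v a - v (a - 1))
          - frameAngle (g (v a)) (v (a + 1) - v a)) := by
  have hS := uniqueDiffOn_triangle hv
  have hcl := triangle_subset_closure_interior hv
  have hcpt := isCompact_triangle v
  obtain ⟨S, hSe⟩ : ∃ S, S = convexHull ℝ (range v) := ⟨_, rfl⟩
  have hseg : ∀ a, ∀ s ∈ Icc (0 : ℝ) 1, v a + s • (v (a + 1) - v a) ∈ S := fun a s hs =>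
    hSe ▸ segment_mem_triangle v a hs
  have hce : ∀ {f : Plane → ℝ}, ContinuousOn f S → ∀ a,
      ContinuousOn (fun s : ℝ => f (v a + s • (v (a + 1) - v a))) (Icc 0 1) := fun hf a =>
    continuousOn_edge (hSe ▸ hf) a
  have hed := continuousOn_edgeDeriv hv hφ
  have hph := fun a s hs => hasDerivWithinAt_edge (v := v) hφ a (s := s) hs
  have hgreen : ∀ {P Q : Plane → ℝ}, ContDiffOn ℝ ∞ P S → ContDiffOn ℝ ∞ Q S →
      ∫ x in S, (pd S 0 Q x - pd S 1 P x) = ∑ a, edgeFlux v P Q a := by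
    rw [hSe]; exact fun hP hQ => green_triangle hv hP hQ
  rw [triangleCurvature]
  rw [← hSe] at hS hcl hg hpos hφ hcpt ⊢
  have hw := contDiffOn_connForm hS hg hpos
  -- the element term
  have hint : ∫ x in S, gaussCurvature S g x * φ x * Real.sqrt (g x).det
      = ∑ a, edgeFlux v (fun x => φ x * connForm S g 0 x) (fun x => φ x * connForm S g 1 x) a
        - ∫ x in S, wedge S φ (connForm S g) x := by
    rw [← hgreen (hφ.mul (hw 0)) (hφ.mul (hw 1)), ← MeasureTheory.integral_sub]
    · refine MeasureTheory.setIntegral_congr_fun hcpt.measurableSet fun x hx => ?_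
      have hu := hS x hx
      have d := fun i => HasPd.of_differentiable (i := i) (differentiableWithinAt_of_smooth hφ hx)
      have e := fun i j => HasPd.of_differentiable (i := i)
        (differentiableWithinAt_of_smooth (hw j) hx)
      simp only [((d 0).mul hu (e 0 1)).pd_eq, ((d 1).mul hu (e 1 0)).pd_eq, wedge]
      rw [mul_right_comm, gaussCurvature_mul_sqrt_det hS hcl hg hpos hx]
      ring
    · exact ((contDiffOn_pd hS (hφ.mul (hw 1)) 0).continuousOn.sub
        (contDiffOn_pd hS (hφ.mul (hw 0)) 1).continuousOn).integrableOn_compact hcpt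
    · exact (((contDiffOn_pd hS hφ 0).continuousOn.mul (hw 1).continuousOn).sub
        ((contDiffOn_pd hS hφ 1).continuousOn.mul (hw 0).continuousOn)).integrableOn_compact hcpt
  -- the edge terms
  have hedge : ∀ a, (∫ s in (0 : ℝ)..1, geodesicCurvature S g (v (a + 1) - v a)
            (v a + s • (v (a + 1) - v a)) * φ (v a + s • (v (a + 1) - v a))
          * Real.sqrt (form (g (v a + s • (v (a + 1) - v a))) (v (a + 1) - v a) (v (a + 1) - v a)))
      = frameAngle (g (v (a + 1))) (v (a + 1) - v a) * φ (v (a + 1))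
        - frameAngle (g (v a)) (v (a + 1) - v a) * φ (v a)
        - (∫ s in (0 : ℝ)..1, frameAngle (g (v a + s • (v (a + 1) - v a))) (v (a + 1) - v a)
            * edgeDeriv v φ a s)
        - edgeFlux v (fun x => φ x * connForm S g 0 x) (fun x => φ x * connForm S g 1 x) a := by
    intro a
    have hτ := tangent_ne_zero hv a
    have hc := hce (f := φ) hφ.continuousOn a
    have hth := fun s hs => hasDerivWithinAt_frameAngle_segment hS hg hpos hτ (hseg a) (s := s) hs
    have hκ : ContinuousOn (fun s : ℝ => geodesicCurvature S g (v (a + 1) - v a)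
            (v a + s • (v (a + 1) - v a))
          * Real.sqrt (form (g (v a + s • (v (a + 1) - v a))) (v (a + 1) - v a) (v (a + 1) - v a)))
          (Icc 0 1) := hce (continuousOn_geodesicCurvature_mul_length hS hg hpos hτ) a
    have hwt : ContinuousOn (fun s : ℝ => connForm S g 0 (v a + s • (v (a + 1) - v a))
        * (v (a + 1) - v a) 0 + connForm S g 1 (v a + s • (v (a + 1) - v a)) * (v (a + 1) - v a) 1)
        (Icc 0 1) :=
      ((hce (hw 0).continuousOn a).mul continuousOn_const).add
        ((hce (hw 1).continuousOn a).mul continuousOn_const)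
    have h := integral_mul_eq_of_hasDerivWithinAt hth (hph a) hκ hwt (hed a)
    simp only [one_smul, zero_smul, add_zero, add_sub_cancel] at h
    simp only [mul_right_comm _ (φ _)]
    rw [h, edgeFlux]
    congr 2
    funext s
    ring
  -- The circulation of φω that Green's theorem produces cancels against the one left by the edges.
  rw [hint, Finset.sum_congr rfl fun a _ => hedge a]
  simp only [Finset.sum_sub_distrib]
  -- The endpoint values are regrouped by vertices: the edge arriving at vertex a is edge `a - 1`.
  have hshift : ∑ a, frameAngle (g (v (a + 1))) (v (a + 1) - v a) * φ (v (a + 1))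
      = ∑ a, frameAngle (g (v a)) (v a - v (a - 1)) * φ (v a) := by
    rw [← Equiv.sum_comp (Equiv.addRight (1 : Fin 3))
      (fun a => frameAngle (g (v a)) (v a - v (a - 1)) * φ (v a))]
    simp
  rw [hshift]
  have hsum : ∑ a, φ (v a) * (frameAngle (g (v a)) (v a - v (a - 1))
        - frameAngle (g (v a)) (v (a + 1) - v a))
      = ∑ a, frameAngle (g (v a)) (v a - v (a - 1)) * φ (v a)
        - ∑ a, frameAngle (g (v a)) (v (a + 1) - v a) * φ (v a) := by
    rw [← Finset.sum_sub_distrib]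
    exact Finset.sum_congr rfl fun a _ => by ring
  rw [hsum]
  ring

end

/-! ### The bilinear form on a triangle and its integral in time -/

section

variable {v : Fin 3 → Plane} {g σ : TensorField} {φ : Plane → ℝ}

/-- The contribution of a triangle to `⟨inc_g σ, φ⟩`. -/
def triangleInc (v : Fin 3 → Plane) (g σ : TensorField) (φ : Plane → ℝ) : ℝ :=
  (∫ x in convexHull ℝ (range v), covCurl (convexHull ℝ (range v)) g σ x
      (covRot (convexHull ℝ (range v)) g φ x) * Real.sqrt (g x).det)
    - ∑ a : Fin 3, ∫ s in (0 : ℝ)..1,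
        form (g (v a + s • (v (a + 1) - v a)))
            (covRot (convexHull ℝ (range v)) g φ (v a + s • (v (a + 1) - v a)))
            (unitNormal (g (v a + s • (v (a + 1) - v a))) (v (a + 1) - v a))
          * form (σ (v a + s • (v (a + 1) - v a)))
            (unitNormal (g (v a + s • (v (a + 1) - v a))) (v (a + 1) - v a))
            (unitTangent (g (v a + s • (v (a + 1) - v a))) (v (a + 1) - v a))
          * Real.sqrt (form (g (v a + s • (v (a + 1) - v a))) (v (a + 1) - v a) (v (a + 1) - v a))

/-- By `connRate_eq` the curl is -2 times the sum of the rate of ω and the differential of the spin.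
The determinant factors in rot and in the volume cancel. -/
theorem covCurl_covRot {S : Set Plane} (hS : UniqueDiffOn ℝ S) (hσ : SmoothSym S σ) {t : ℝ}
    (hpos : ∀ x ∈ S, PosMinors (euclidPath σ t x)) {x : Plane} (hx : x ∈ S) :
    covCurl S (euclidPath σ t) σ x (covRot S (euclidPath σ t) φ x)
        * Real.sqrt (euclidPath σ t x).det
      = 2 * (wedge S φ (fun i => connRate S σ i t) x
        + wedge S φ (fun i => pd S i (frameSpin σ t)) x) := by
  have hr := (hpos x hx).sqrt_pos.ne'
  simp only [wedge, connRate_eq hS hσ hx hpos]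
  simp only [covCurl, covRot, Fin.sum_univ_two, Pi.smul_apply, smul_eq_mul, Matrix.cons_val_zero,
    Matrix.cons_val_one]
  field_simp
  ring

/-- For unit normal and tangent, g(rot φ, ν) is minus the derivative of φ along the tangent, and the
angle rate plus the spin is ½ σ(ν,τ). The length elements cancel. -/
theorem edge_integrand_eq {S : Set Plane} {t : ℝ} {x τ : Plane}
    (hA : PosMinors (euclidPath σ t x)) (hτ : τ ≠ 0) :
    form (euclidPath σ t x) (covRot S (euclidPath σ t) φ x) (unitNormal (euclidPath σ t x) τ)
        * form (σ x) (unitNormal (euclidPath σ t x) τ) (unitTangent (euclidPath σ t x) τ)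
        * Real.sqrt (form (euclidPath σ t x) τ τ)
      = -2 * ((angleRate σ τ t x + frameSpin σ t x)
          * (τ 0 * pd S 0 φ x + τ 1 * pd S 1 φ x)) := by
  have hr := hA.sqrt_pos
  have hrr := Real.mul_self_sqrt hA.2.1.le
  have hq := hA.form_pos hτ
  have hl := Real.sqrt_pos.2 hq
  have hll := Real.mul_self_sqrt hq.le
  rw [unitNormal, unitTangent, form_smul_right, form_smul_left, form_smul_right,
    hA.form_rawNormal_self, hA.form_rawNormal, Real.sqrt_div hq.le, angleRate, sub_add_cancel]
  simp only [covRot, area, Pi.smul_apply, smul_eq_mul, Matrix.cons_val_zero,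
    Matrix.cons_val_one]
  generalize form (σ x) (rawNormal (euclidPath σ t x) τ) τ = Z
  generalize Real.sqrt (form (euclidPath σ t x) τ τ) = l at *
  generalize Real.sqrt (euclidPath σ t x).det = r at *
  rw [← hll]
  field_simp
  ring

/-- dφ∧dα = -d(α dφ) because second derivatives of φ commute; then Green's theorem applies. This is
what removes the gauge term. -/
theorem pd_frameSpin_green (hv : 0 < area (v 1 - v 0) (v 2 - v 0)) {α : Plane → ℝ}
    (hα : ContDiffOn ℝ ∞ α (convexHull ℝ (range v)))
    (hφ : ContDiffOn ℝ ∞ φ (convexHull ℝ (range v))) :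
    ∫ x in convexHull ℝ (range v), wedge (convexHull ℝ (range v)) φ
        (fun i => pd (convexHull ℝ (range v)) i α) x
      = -∑ a, ∫ s in (0 : ℝ)..1, α (v a + s • (v (a + 1) - v a)) * edgeDeriv v φ a s := by
  have hS := uniqueDiffOn_triangle hv
  have hcl := triangle_subset_closure_interior hv
  have hcpt := isCompact_triangle v
  have h := green_triangle hv (hα.mul (contDiffOn_pd hS hφ 0)).neg
    (hα.mul (contDiffOn_pd hS hφ 1)).neg
  have e1 : ∫ x in convexHull ℝ (range v), wedge (convexHull ℝ (range v)) φ
        (fun i => pd (convexHull ℝ (range v)) i α) x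
      = ∫ x in convexHull ℝ (range v), (pd (convexHull ℝ (range v)) 0
          (fun x => -(α x * pd (convexHull ℝ (range v)) 1 φ x)) x
        - pd (convexHull ℝ (range v)) 1 (fun x => -(α x * pd (convexHull ℝ (range v)) 0 φ x)) x) := by
    refine MeasureTheory.setIntegral_congr_fun hcpt.measurableSet fun x hx => ?_
    have hu := hS x hx
    have d := fun i => HasPd.of_differentiable (i := i) (differentiableWithinAt_of_smooth hα hx)
    have e := fun i j => HasPd.of_differentiable (i := i)
      (differentiableWithinAt_of_smooth (contDiffOn_pd hS hφ j) hx)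
    simp only [(((d 0).mul hu (e 0 1)).neg hu).pd_eq, (((d 1).mul hu (e 1 0)).neg hu).pd_eq, wedge,
      pd_comm hS hcl hφ hx]
    ring
  rw [e1, h, ← Finset.sum_neg_distrib]
  refine Finset.sum_congr rfl fun a _ => ?_
  rw [edgeFlux, ← intervalIntegral.integral_neg]
  congr 1
  funext s
  simp only [edgeDeriv]
  ring

/-- The bilinear form of a triangle as the variation of the weak curvature. -/
theorem triangleInc_eq (hv : 0 < area (v 1 - v 0) (v 2 - v 0))
    (hσ : SmoothSym (convexHull ℝ (range v)) σ) (hpos : PathPos (convexHull ℝ (range v)) σ)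
    (hφ : ContDiffOn ℝ ∞ φ (convexHull ℝ (range v))) {t : ℝ} (ht : t ∈ Icc (0 : ℝ) 1) :
    triangleInc v (euclidPath σ t) σ φ / 2
      = (∫ x in convexHull ℝ (range v), wedge (convexHull ℝ (range v)) φ
          (fun i => connRate (convexHull ℝ (range v)) σ i t) x)
        + ∑ a, ∫ s in (0 : ℝ)..1,
          angleRate σ (v (a + 1) - v a) t (v a + s • (v (a + 1) - v a)) * edgeDeriv v φ a s := by
  have hS := uniqueDiffOn_triangle hv
  have hcpt := isCompact_triangle v
  have hed := continuousOn_edgeDeriv hv hφ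
  have hspin := contDiffOn_frameSpin hσ (hpos t ht)
  have hgr := pd_frameSpin_green hv hspin hφ
  have hslice : ∀ {f : ℝ × Plane → ℝ}, ContinuousOn f (Icc 0 1 ×ˢ convexHull ℝ (range v)) →
      ContinuousOn (fun x => f (t, x)) (convexHull ℝ (range v)) := fun hf =>
    hf.comp (by fun_prop) fun x hx => ⟨ht, hx⟩
  have hrate := fun i => hslice (continuousOn_connRate hS hσ hpos i)
  have cpd := fun i => (contDiffOn_pd hS hφ i).continuousOn
  have cw1 : ContinuousOn (wedge (convexHull ℝ (range v)) φ
      (fun i => connRate (convexHull ℝ (range v)) σ i t)) (convexHull ℝ (range v)) :=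
    ((cpd 0).mul (hrate 1)).sub ((cpd 1).mul (hrate 0))
  have cw2 : ContinuousOn (wedge (convexHull ℝ (range v)) φ
      (fun i => pd (convexHull ℝ (range v)) i (frameSpin σ t))) (convexHull ℝ (range v)) :=
    ((cpd 0).mul (contDiffOn_pd hS hspin 1).continuousOn).sub
      ((cpd 1).mul (contDiffOn_pd hS hspin 0).continuousOn)
  rw [triangleInc, MeasureTheory.setIntegral_congr_fun hcpt.measurableSet
    fun x hx => covCurl_covRot hS hσ (hpos t ht) hx, MeasureTheory.integral_const_mul,
    MeasureTheory.integral_add (cw1.integrableOn_compact hcpt) (cw2.integrableOn_compact hcpt), hgr]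
  have hedge : ∀ a, (∫ s in (0 : ℝ)..1,
        form (euclidPath σ t (v a + s • (v (a + 1) - v a)))
            (covRot (convexHull ℝ (range v)) (euclidPath σ t) φ (v a + s • (v (a + 1) - v a)))
            (unitNormal (euclidPath σ t (v a + s • (v (a + 1) - v a))) (v (a + 1) - v a))
          * form (σ (v a + s • (v (a + 1) - v a)))
            (unitNormal (euclidPath σ t (v a + s • (v (a + 1) - v a))) (v (a + 1) - v a))
            (unitTangent (euclidPath σ t (v a + s • (v (a + 1) - v a))) (v (a + 1) - v a))
          * Real.sqrt (form (euclidPath σ t (v a + s • (v (a + 1) - v a)))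
            (v (a + 1) - v a) (v (a + 1) - v a)))
      = -2 * ((∫ s in (0 : ℝ)..1,
          angleRate σ (v (a + 1) - v a) t (v a + s • (v (a + 1) - v a)) * edgeDeriv v φ a s)
        + ∫ s in (0 : ℝ)..1, frameSpin σ t (v a + s • (v (a + 1) - v a)) * edgeDeriv v φ a s) := by
    intro a
    have hτ := tangent_ne_zero hv a
    have c1 := (continuousOn_edge (hslice (continuousOn_angleRate hσ hpos hτ)) a).mul (hed a)
    have c2 := (continuousOn_edge hspin.continuousOn a).mul (hed a)
    have e := intervalIntegral.integral_add
      (c1.intervalIntegrable_of_Icc (μ := MeasureTheory.volume) zero_le_one)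
      (c2.intervalIntegrable_of_Icc (μ := MeasureTheory.volume) zero_le_one)
    simp only [Pi.mul_apply] at e
    rw [← e, ← intervalIntegral.integral_const_mul]
    refine intervalIntegral.integral_congr fun s hs => ?_
    rw [uIcc_of_le zero_le_one] at hs
    rw [edge_integrand_eq (hpos t ht _ (segment_mem_triangle v a hs)) hτ, edgeDeriv]
    ring
  -- The spin integrals over the edges cancel the one from the element, already rewritten as a
  -- boundary term by `hgr`.
  rw [Finset.sum_congr rfl fun a _ => hedge a, ← Finset.mul_sum, Finset.sum_add_distrib]
  ring

theorem euclidPath_zero (σ : TensorField) : euclidPath σ 0 = fun _ => 1 := by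
  funext x; simp [euclidPath]

theorem connForm_euclidPath_zero {S : Set Plane} (hS : UniqueDiffOn ℝ S) (hσ : SmoothSym S σ)
    {x : Plane} (hx : x ∈ S) (i : Fin 2) : connForm S (euclidPath σ 0) i x = 0 := by
  rw [connForm_euclidPath hS hσ 0 hx]; simp

/-- Integration in time of the bilinear form of a triangle. -/
theorem integral_triangleInc (hv : 0 < area (v 1 - v 0) (v 2 - v 0))
    (hσ : SmoothSym (convexHull ℝ (range v)) σ) (hpos : PathPos (convexHull ℝ (range v)) σ)
    (hφ : ContDiffOn ℝ ∞ φ (convexHull ℝ (range v))) :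
    IntervalIntegrable (fun t => triangleInc v (euclidPath σ t) σ φ) MeasureTheory.volume 0 1 ∧
    (∫ t in (0 : ℝ)..1, triangleInc v (euclidPath σ t) σ φ) / 2
      = (∫ x in convexHull ℝ (range v), wedge (convexHull ℝ (range v)) φ
          (connForm (convexHull ℝ (range v)) (euclidPath σ 1)) x)
        + ∑ a, ∫ s in (0 : ℝ)..1,
          (frameAngle (euclidPath σ 1 (v a + s • (v (a + 1) - v a))) (v (a + 1) - v a)
            - frameAngle (euclidPath σ 0 (v a + s • (v (a + 1) - v a))) (v (a + 1) - v a))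
            * edgeDeriv v φ a s := by
  have hS := uniqueDiffOn_triangle hv
  have hcpt := isCompact_triangle v
  have hed := continuousOn_edgeDeriv hv hφ
  have cpd := fun i => (contDiffOn_pd hS hφ i).continuousOn
  obtain ⟨S, hSe⟩ : ∃ S, S = convexHull ℝ (range v) := ⟨_, rfl⟩
  have hrate := continuousOn_connRate hS hσ hpos
  have c1 : ContinuousOn (fun z : ℝ × Plane => wedge (convexHull ℝ (range v)) φ
      (fun i => connRate (convexHull ℝ (range v)) σ i z.1) z.2)
      (Icc 0 1 ×ˢ convexHull ℝ (range v)) :=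
    ((continuousOn_path (cpd 0)).mul (hrate 1)).sub ((continuousOn_path (cpd 1)).mul (hrate 0))
  have c2 : ∀ a, ContinuousOn (fun z : ℝ × ℝ => angleRate σ (v (a + 1) - v a) z.1
      (v a + z.2 • (v (a + 1) - v a)) * edgeDeriv v φ a z.2) (Icc 0 1 ×ˢ Icc 0 1) := fun a =>
    ((continuousOn_angleRate hσ hpos (tangent_ne_zero hv a)).comp
      (f := fun z : ℝ × ℝ => (z.1, v a + z.2 • (v (a + 1) - v a))) (by fun_prop)
      fun z hz => ⟨hz.1, segment_mem_triangle v a hz.2⟩).mul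
      ((hed a).comp continuousOn_snd fun z hz => hz.2)
  -- Integrability over the products serves twice: for Fubini's theorem and for integrability in t
  -- of the inner integrals.
  have k1 := c1.integrableOn_compact (μ := (MeasureTheory.volume : MeasureTheory.Measure ℝ).prod
    MeasureTheory.volume) (isCompact_Icc.prod hcpt)
  have k2 := fun a => (c2 a).integrableOn_compact
    (μ := (MeasureTheory.volume : MeasureTheory.Measure ℝ).prod MeasureTheory.volume)
    (isCompact_Icc.prod isCompact_Icc)
  simp only [MeasureTheory.IntegrableOn, ← MeasureTheory.Measure.prod_restrict] at k1 k2
  have hconv : ∀ f : ℝ → ℝ, ∫ t in (0 : ℝ)..1, f t = ∫ t in Icc (0 : ℝ) 1, f t := fun f => by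
    rw [intervalIntegral.integral_of_le zero_le_one, MeasureTheory.integral_Icc_eq_integral_Ioc]
  have hint : ∀ f : ℝ → ℝ, MeasureTheory.IntegrableOn f (Icc 0 1) →
      IntervalIntegrable f MeasureTheory.volume 0 1 := fun f hf =>
    (intervalIntegrable_iff_integrableOn_Icc_of_le zero_le_one).2 hf
  have i1 := hint _ k1.integral_prod_left
  have i2 := fun a => hint _ (k2 a).integral_prod_left
  simp only [← hconv] at i2
  have hexp : ∀ t ∈ uIcc (0 : ℝ) 1, triangleInc v (euclidPath σ t) σ φ
      = 2 * ((∫ x in convexHull ℝ (range v), wedge (convexHull ℝ (range v)) φ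
          (fun i => connRate (convexHull ℝ (range v)) σ i t) x)
        + ∑ a, ∫ s in (0 : ℝ)..1,
          angleRate σ (v (a + 1) - v a) t (v a + s • (v (a + 1) - v a)) * edgeDeriv v φ a s) := by
    intro t ht
    rw [uIcc_of_le zero_le_one] at ht
    rw [← triangleInc_eq hv hσ hpos hφ ht]; ring
  have isum := IntervalIntegrable.sum Finset.univ fun a _ => i2 a
  constructor
  · refine IntervalIntegrable.congr (fun t ht => ?_) ((i1.add isum).const_mul 2)
    simp only [Finset.sum_apply]
    exact (hexp t (uIoc_subset_uIcc ht)).symm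
  rw [intervalIntegral.integral_congr hexp, intervalIntegral.integral_const_mul,
    intervalIntegral.integral_add i1 (by simpa only [Finset.sum_fn] using isum),
    intervalIntegral.integral_finsetSum fun a _ => i2 a]
  rw [mul_div_cancel_left₀ _ two_ne_zero]
  congr 1
  -- With the time integral inside, the fundamental theorem of calculus applies at each point x, and
  -- the connection form is zero at t = 0.
  · rw [hconv, MeasureTheory.integral_integral_swap k1]
    refine MeasureTheory.setIntegral_congr_fun hcpt.measurableSet fun x hx => ?_
    simp only [← hconv]
    have hcx : ∀ i, ContinuousOn (fun t => connRate (convexHull ℝ (range v)) σ i t x) (Icc 0 1) :=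
      fun i => (hrate i).comp (f := fun t => (t, x)) (by fun_prop) fun t ht => ⟨ht, hx⟩
    have hftc : ∀ i, ∫ t in (0 : ℝ)..1, connRate (convexHull ℝ (range v)) σ i t x
        = connForm (convexHull ℝ (range v)) (euclidPath σ 1) i x := fun i => by
      rw [intervalIntegral.integral_eq_sub_of_hasDerivAt (fun t ht => by
        rw [uIcc_of_le zero_le_one] at ht
        exact hasDerivAt_connForm_euclidPath hS hσ hx (hpos t ht x hx) i)
        ((hcx i).intervalIntegrable_of_Icc zero_le_one), connForm_euclidPath_zero hS hσ hx, sub_zero]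
    simp only [wedge]
    rw [intervalIntegral.integral_sub
      (((hcx 1).intervalIntegrable_of_Icc zero_le_one).const_mul _)
      (((hcx 0).intervalIntegrable_of_Icc zero_le_one).const_mul _),
      intervalIntegral.integral_const_mul, intervalIntegral.integral_const_mul, hftc, hftc]
  · refine Finset.sum_congr rfl fun a _ => ?_
    have hτ := tangent_ne_zero hv a
    simp only [hconv]
    rw [MeasureTheory.integral_integral_swap (k2 a)]
    refine MeasureTheory.setIntegral_congr_fun measurableSet_Icc fun s hs => ?_
    have hx := segment_mem_triangle v a hs
    simp only [← hconv]
    rw [intervalIntegral.integral_mul_const]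
    congr 1
    have hcx : ContinuousOn (fun t => angleRate σ (v (a + 1) - v a) t
        (v a + s • (v (a + 1) - v a))) (Icc 0 1) :=
      (continuousOn_angleRate hσ hpos hτ).comp
        (f := fun t => (t, v a + s • (v (a + 1) - v a))) (by fun_prop) fun t ht => ⟨ht, hx⟩
    exact intervalIntegral.integral_eq_sub_of_hasDerivAt (fun t ht => by
        rw [uIcc_of_le zero_le_one] at ht
        exact hasDerivAt_frameAngle_euclidPath (hpos t ht _ hx) (hσ.2 _ hx) hτ)
        (hcx.intervalIntegrable_of_Icc zero_le_one)

/-- The curvature of a triangle, including its interior angles, as an integral of the bilinear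
form along the segment from the Euclidean metric. -/
theorem triangleCurvature_eq_integral (hv : 0 < area (v 1 - v 0) (v 2 - v 0))
    (hσ : SmoothSym (convexHull ℝ (range v)) σ) (hpos : PathPos (convexHull ℝ (range v)) σ)
    (hφ : ContDiffOn ℝ ∞ φ (convexHull ℝ (range v))) :
    triangleCurvature v (euclidPath σ 1) φ
        - ∑ a, φ (v a) * cornerAngle (euclidPath σ 1 (v a)) (v a - v (a - 1)) (v (a + 1) - v a)
      = -(∫ t in (0 : ℝ)..1, triangleInc v (euclidPath σ t) σ φ) / 2
        - ∑ a, φ (v a) * cornerAngle 1 (v a - v (a - 1)) (v (a + 1) - v a) := by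
  have h1 : (1 : ℝ) ∈ Icc (0 : ℝ) 1 := right_mem_Icc.2 zero_le_one
  have hed := continuousOn_edgeDeriv hv hφ
  have hS := uniqueDiffOn_triangle hv
  rw [triangleCurvature_eq hv (hσ.euclidPath 1) (hpos 1 h1) hφ, neg_div,
    (integral_triangleInc hv hσ hpos hφ).2]
  -- At t = 0 the metric is δ everywhere, so the frame angle is constant along the edge and its
  -- integral against dφ reduces to endpoint values.
  have hedge : ∀ a, ∫ s in (0 : ℝ)..1,
          (frameAngle (euclidPath σ 1 (v a + s • (v (a + 1) - v a))) (v (a + 1) - v a)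
            - frameAngle (euclidPath σ 0 (v a + s • (v (a + 1) - v a))) (v (a + 1) - v a))
            * edgeDeriv v φ a s
      = (∫ s in (0 : ℝ)..1, frameAngle (euclidPath σ 1 (v a + s • (v (a + 1) - v a)))
          (v (a + 1) - v a) * edgeDeriv v φ a s)
        - frameAngle 1 (v (a + 1) - v a) * (φ (v (a + 1)) - φ (v a)) := by
    intro a
    have hτ := tangent_ne_zero hv a
    have c1 : ContinuousOn (fun s : ℝ => frameAngle (euclidPath σ 1 (v a + s • (v (a + 1) - v a)))
          (v (a + 1) - v a)) (Icc 0 1) := fun s hs =>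
      (hasDerivWithinAt_frameAngle_segment hS (hσ.euclidPath 1) (hpos 1 h1) hτ
        (fun s hs => segment_mem_triangle v a hs) hs).continuousWithinAt
    rw [← integral_edgeDeriv hv hφ a, ← intervalIntegral.integral_const_mul,
      ← intervalIntegral.integral_sub]
    · simp only [euclidPath_zero, sub_mul]
    · exact (c1.mul (hed a)).intervalIntegrable_of_Icc zero_le_one
    · exact (continuousOn_const.mul (hed a)).intervalIntegrable_of_Icc zero_le_one
  rw [Finset.sum_congr rfl fun a _ => hedge a, Finset.sum_sub_distrib]
  have hshift : ∑ a, frameAngle 1 (v (a + 1) - v a) * (φ (v (a + 1)) - φ (v a))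
      = ∑ a, φ (v a) * (frameAngle 1 (v a - v (a - 1)) - frameAngle 1 (v (a + 1) - v a)) := by
    simp only [mul_comm (φ _), mul_sub, sub_mul, Finset.sum_sub_distrib]
    congr 1
    rw [← Equiv.sum_comp (Equiv.addRight (1 : Fin 3))
      (fun a => frameAngle 1 (v a - v (a - 1)) * φ (v a))]
    simp
  rw [hshift]
  -- Corner turnings at t = 1 are exchanged for those at t = 0, the difference being that of the
  -- interior angles.
  have hcorner : ∀ a, φ (v a) * (frameAngle (euclidPath σ 1 (v a)) (v a - v (a - 1))
          - frameAngle (euclidPath σ 1 (v a)) (v (a + 1) - v a))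
        - φ (v a) * cornerAngle (euclidPath σ 1 (v a)) (v a - v (a - 1)) (v (a + 1) - v a)
      = φ (v a) * (frameAngle 1 (v a - v (a - 1)) - frameAngle 1 (v (a + 1) - v a))
        - φ (v a) * cornerAngle 1 (v a - v (a - 1)) (v (a + 1) - v a) := by
    intro a
    have hx : v a ∈ convexHull ℝ (range v) := subset_convexHull ℝ _ ⟨a, rfl⟩
    have ha : 0 < area (v a - v (a - 1)) (v (a + 1) - v a) := by
      have := area_tangents v (a - 1)
      rw [sub_add_cancel] at this
      rwa [this]
    have := frameAngle_sub_cornerAngle (hσ.2 _ hx) (fun t ht => hpos t ht _ hx) ha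
    simp only [euclidPath_zero] at this
    linear_combination φ (v a) * this
  have hsum := Finset.sum_congr (rfl : (Finset.univ : Finset (Fin 3)) = Finset.univ)
    fun a _ => hcorner a
  rw [Finset.sum_sub_distrib, Finset.sum_sub_distrib] at hsum
  linear_combination hsum

end

section

/-! ### Areas of circular sectors -/

/-- The sector of radius `ρ` spanned counterclockwise by `z` and `w`. -/
def sector (ρ : ℝ) (z w : ℂ) : Set ℂ :=
  {y | ‖y‖ < ρ ∧ 0 ≤ ((starRingEnd ℂ) z * y).im ∧ 0 ≤ ((starRingEnd ℂ) y * w).im}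

theorem measurableSet_sector (ρ : ℝ) (z w : ℂ) : MeasurableSet (sector ρ z w) := by
  have h1 : MeasurableSet {y : ℂ | ‖y‖ < ρ} :=
    (isOpen_lt continuous_norm continuous_const).measurableSet
  have h2 : MeasurableSet {y : ℂ | 0 ≤ ((starRingEnd ℂ) z * y).im} :=
    (isClosed_le continuous_const
      (Complex.continuous_im.comp (continuous_const.mul continuous_id))).measurableSet
  have h3 : MeasurableSet {y : ℂ | 0 ≤ ((starRingEnd ℂ) y * w).im} :=
    (isClosed_le continuous_const
      (Complex.continuous_im.comp (Complex.continuous_conj.mul continuous_const))).measurableSet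
  have h4 : sector ρ z w = {y : ℂ | ‖y‖ < ρ} ∩ ({y : ℂ | 0 ≤ ((starRingEnd ℂ) z * y).im} ∩
    {y : ℂ | 0 ≤ ((starRingEnd ℂ) y * w).im}) := by ext y; rfl
  rw [h4]
  exact h1.inter (h2.inter h3)

/-- In polar coordinates the two half-plane conditions read sin θ ≥ 0 and sin(β - θ) ≥ 0. For θ in
(-π, π) and β in (0, π) they hold together exactly when 0 ≤ θ ≤ β. -/
theorem polar_mem_sector_iff {ρ β r θ : ℝ} (hβ : β ∈ Ioo 0 Real.pi) (hr : 0 < r)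
    (hθ : θ ∈ Ioo (-Real.pi) Real.pi) :
    (r : ℂ) * (Real.cos θ + Real.sin θ * Complex.I) ∈ sector ρ 1 (Complex.exp (β * Complex.I))
      ↔ r < ρ ∧ θ ∈ Icc 0 β := by
  have hn : ‖(r : ℂ) * (Real.cos θ + Real.sin θ * Complex.I)‖ = r := by
    simpa only [Complex.polarCoord_symm_apply, abs_of_pos hr] using
      Complex.norm_polarCoord_symm (r, θ)
  have h1 : ((starRingEnd ℂ) 1 * ((r : ℂ) * (Real.cos θ + Real.sin θ * Complex.I))).im
      = r * Real.sin θ := by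
    rw [map_one, one_mul, Complex.im_ofReal_mul]
    simp [-Complex.ofReal_sin]
  have h2 : ((starRingEnd ℂ) ((r : ℂ) * (Real.cos θ + Real.sin θ * Complex.I))
      * Complex.exp (β * Complex.I)).im = r * Real.sin (β - θ) := by
    rw [Complex.exp_mul_I, Real.sin_sub]
    simp [← Complex.ofReal_cos, ← Complex.ofReal_sin]
    ring
  rw [sector, mem_ofPred_eq, hn, h1, h2]
  refine and_congr_right fun _ => ?_
  rw [mul_nonneg_iff_of_pos_left hr, mul_nonneg_iff_of_pos_left hr]
  obtain ⟨b0, b1⟩ := hβ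
  obtain ⟨t0, t1⟩ := hθ
  constructor
  · rintro ⟨s1, s2⟩
    have hθ0 : 0 ≤ θ := by
      by_contra hlt
      exact absurd (Real.sin_neg_of_neg_of_neg_pi_lt (not_le.1 hlt) t0) (not_lt.2 s1)
    refine ⟨hθ0, ?_⟩
    by_contra hlt
    exact absurd (Real.sin_neg_of_neg_of_neg_pi_lt (by linarith) (by linarith)) (not_lt.2 s2)
  · rintro ⟨s1, s2⟩
    exact ⟨Real.sin_nonneg_of_nonneg_of_le_pi s1 t1.le,
      Real.sin_nonneg_of_nonneg_of_le_pi (by linarith) (by linarith)⟩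

theorem volume_unit_sector {ρ β : ℝ} (hρ : 0 < ρ) (hβ : β ∈ Ioo 0 Real.pi) :
    MeasureTheory.volume (sector ρ 1 (Complex.exp (β * Complex.I)))
      = ENNReal.ofReal (ρ ^ 2 / 2 * β) := by
  rw [← MeasureTheory.lintegral_indicator_one (measurableSet_sector _ _ _),
    ← Complex.lintegral_comp_polarCoord_symm]
  have h1 : ∀ p ∈ polarCoord.target, ENNReal.ofReal p.1 • (sector ρ 1
      (Complex.exp (β * Complex.I))).indicator 1 (Complex.polarCoord.symm p)
      = (Ioo 0 ρ ×ˢ Icc 0 β).indicator (fun p => ENNReal.ofReal p.1) p := by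
    intro p hp
    have hp' : 0 < p.1 ∧ p.2 ∈ Ioo (-Real.pi) Real.pi := ⟨hp.1, hp.2⟩
    have hiff := polar_mem_sector_iff (ρ := ρ) hβ hp'.1 hp'.2
    rw [Complex.polarCoord_symm_apply]
    by_cases h : p.1 < ρ ∧ p.2 ∈ Icc 0 β
    · rw [indicator_of_mem (hiff.2 h), indicator_of_mem (show p ∈ Ioo 0 ρ ×ˢ Icc 0 β from ⟨⟨hp'.1, h.1⟩, h.2⟩)]; simp
    · rw [indicator_of_notMem (fun hm => h (hiff.1 hm)),
        indicator_of_notMem (fun hm => h ⟨hm.1.2, hm.2⟩)]; simp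
  have hsub : Ioo 0 ρ ×ˢ Icc 0 β ⊆ polarCoord.target := by
    rintro p ⟨hp1, hp2⟩
    exact ⟨hp1.1, by linarith [hp2.1, Real.pi_pos], by linarith [hp2.2, hβ.2]⟩
  have hm : MeasurableSet (Ioo (0 : ℝ) ρ ×ˢ Icc 0 β) := measurableSet_Ioo.prod measurableSet_Icc
  rw [MeasureTheory.setLIntegral_congr_fun polarCoord.open_target.measurableSet h1,
    MeasureTheory.setLIntegral_indicator hm, inter_eq_left.2 hsub,
    MeasureTheory.Measure.volume_eq_prod, ← MeasureTheory.Measure.prod_restrict,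
    MeasureTheory.lintegral_prod _ (by fun_prop)]
  simp only [MeasureTheory.lintegral_const, MeasureTheory.Measure.restrict_apply_univ,
    Real.volume_Icc, sub_zero]
  rw [MeasureTheory.lintegral_mul_const _ (by fun_prop)]
  have h2 : ∫⁻ r in Ioo 0 ρ, ENNReal.ofReal r = ENNReal.ofReal (ρ ^ 2 / 2) := by
    rw [MeasureTheory.restrict_Ioo_eq_restrict_Ioc,
      ← MeasureTheory.ofReal_integral_eq_lintegral_ofReal, ← intervalIntegral.integral_of_le hρ.le,
      integral_id]
    · congr 1; ring
    · exact (continuous_id.integrableOn_Icc (a := 0) (b := ρ)).mono_set Ioc_subset_Icc_self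
    · exact (MeasureTheory.ae_restrict_iff' measurableSet_Ioc).2
        (Filter.Eventually.of_forall fun r hr => hr.1.le)
  rw [h2, ← ENNReal.ofReal_mul (by positivity)]

/-- The rotation by z/|z| preserves area and carries the positive real axis to the ray through z.
The moduli of z and w only scale the two sign conditions. -/
theorem volume_sector {ρ : ℝ} (hρ : 0 < ρ) {z w : ℂ} (h : 0 < ((starRingEnd ℂ) z * w).im) :
    MeasureTheory.volume (sector ρ z w)
      = ENNReal.ofReal (ρ ^ 2 / 2 * Complex.arg ((starRingEnd ℂ) z * w)) := by
  have hz : z ≠ 0 := by rintro rfl; simp at h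
  have hw : w ≠ 0 := by rintro rfl; simp at h
  have hzn : 0 < ‖z‖ := norm_pos_iff.2 hz
  have hwn : 0 < ‖w‖ := norm_pos_iff.2 hw
  have hβ : Complex.arg ((starRingEnd ℂ) z * w) ∈ Ioo 0 Real.pi := by
    refine ⟨lt_of_le_of_ne (Complex.arg_nonneg_iff.2 h.le) fun h0 => ?_,
      Complex.arg_lt_pi_iff.2 (Or.inr h.ne')⟩
    rw [eq_comm, Complex.arg_eq_zero_iff] at h0
    exact h.ne' h0.2
  rw [← volume_unit_sector hρ hβ]
  obtain ⟨u, hu⟩ : ∃ u : Circle, (u : ℂ) = z / ‖z‖ :=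
    ⟨⟨z / ‖z‖, by simp [Submonoid.unitSphere, hz]⟩, rfl⟩
  have hmp := (rotation u).measurePreserving
  rw [← hmp.measure_preimage (measurableSet_sector ρ z w).nullMeasurableSet]
  congr 1
  ext y
  have hzz : (starRingEnd ℂ) z * z = ((‖z‖ ^ 2 : ℝ) : ℂ) := by
    rw [mul_comm, Complex.mul_conj, Complex.normSq_eq_norm_sq]
  have e1 : (starRingEnd ℂ) z * (rotation u y) = (‖z‖ : ℝ) * ((starRingEnd ℂ) 1 * y) := by
    rw [rotation_apply, hu, map_one, one_mul, div_mul_eq_mul_div, mul_div_assoc', ← mul_assoc, hzz]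
    have : (‖z‖ : ℂ) ≠ 0 := by exact_mod_cast hzn.ne'
    push_cast
    field_simp
  have e2 : (starRingEnd ℂ) (rotation u y) * w = (‖w‖ : ℝ) * ((starRingEnd ℂ) y
      * Complex.exp (Complex.arg ((starRingEnd ℂ) z * w) * Complex.I)) := by
    have h3 := Complex.norm_mul_exp_arg_mul_I ((starRingEnd ℂ) z * w)
    rw [norm_mul, RCLike.norm_conj] at h3
    have : (‖z‖ : ℂ) ≠ 0 := by exact_mod_cast hzn.ne'
    rw [rotation_apply, hu, map_mul, map_div₀, Complex.conj_ofReal]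
    push_cast at h3
    field_simp
    linear_combination -(starRingEnd ℂ) y * h3
  simp only [sector, mem_preimage, mem_ofPred_eq, LinearIsometryEquiv.norm_map]
  rw [e1, e2, Complex.im_ofReal_mul, Complex.im_ofReal_mul,
    mul_nonneg_iff_of_pos_left hzn, mul_nonneg_iff_of_pos_left hwn]

end

section

/-! ### Combinatorics of conforming triangulations -/

theorem fin_three_cases : ∀ i a : Fin 3, i = a ∨ i = a + 1 ∨ i = a + 2 := by decide

theorem injective_of_area_pos {v : Fin 3 → Plane} (hv : 0 < area (v 1 - v 0) (v 2 - v 0)) :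
    Function.Injective v := by
  intro i j h
  rcases fin_three_cases j i with rfl | rfl | rfl
  · rfl
  · exact absurd (sub_eq_zero.2 h.symm) (tangent_ne_zero hv i)
  · refine absurd (sub_eq_zero.2 ?_) (tangent_ne_zero hv (i + 2))
    rw [← h, add_assoc, show (2 : Fin 3) + 1 = 0 from rfl, add_zero]

theorem area_eq_zero_of_mem_convexHull {s : Set Plane} {P τ x : Plane}
    (h : ∀ y ∈ s, area τ (y - P) = 0) (hx : x ∈ convexHull ℝ s) : area τ (x - P) = 0 := by
  have hc : Convex ℝ {x : Plane | area τ (x - P) = 0} := by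
    intro y hy z hz p q _ _ hpq
    have e : area τ (p • y + q • z - P) = p * area τ (y - P) + q * area τ (z - P) := by
      simp only [area, Pi.add_apply, Pi.sub_apply, Pi.smul_apply, smul_eq_mul]
      linear_combination (τ 0 * P 1 - τ 1 * P 0) * hpq
    have hy' : area τ (y - P) = 0 := hy
    have hz' : area τ (z - P) = 0 := hz
    change area τ (p • y + q • z - P) = 0
    rw [e, hy', hz']; simp
  exact convexHull_min (fun y hy => h y hy) hc hx

namespace Mesh

variable {Ω : Set Plane} (M : Mesh Ω)

theorem vert_injective (T : Fin M.n) : Function.Injective (M.vert T) :=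
  injective_of_area_pos (M.pos T)

theorem vert_mem_elem (T : Fin M.n) (a : Fin 3) : M.vert T a ∈ M.elem T :=
  subset_convexHull ℝ _ (mem_range_self a)

theorem isClosed_elem (T : Fin M.n) : IsClosed (M.elem T) := (isCompact_triangle _).isClosed

theorem elem_subset (T : Fin M.n) : M.elem T ⊆ closure Ω :=
  M.cover ▸ subset_iUnion (fun T => convexHull ℝ (range (M.vert T))) T

theorem exists_mem_elem {x : Plane} (hx : x ∈ closure Ω) : ∃ T, x ∈ M.elem T := by
  rw [← M.cover] at hx
  exact mem_iUnion.1 hx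

variable {M}

/-- By conformity x lies in the hull of the shared vertices. If vertex `a + 2` were not shared, all
shared vertices, and with them x, would lie on the line through edge a. -/
theorem vert_mem_range_of_area_pos {T T' : Fin M.n} {a : Fin 3} {x : Plane} (hx : x ∈ M.elem T)
    (hx' : x ∈ M.elem T')
    (h : 0 < area (M.vert T (a + 1) - M.vert T a) (x - M.vert T a)) :
    M.vert T (a + 2) ∈ range (M.vert T') := by
  by_contra hn
  have hmem : x ∈ convexHull ℝ (range (M.vert T) ∩ range (M.vert T')) := by
    rw [← M.conforming]; exact ⟨hx, hx'⟩
  refine h.ne' (area_eq_zero_of_mem_convexHull ?_ hmem)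
  rintro y ⟨⟨i, rfl⟩, hy⟩
  rcases fin_three_cases i a with rfl | rfl | rfl
  · simp [area]
  · simp only [area]; ring
  · exact absurd hy hn

/-- Vertex a is opposite to edge `a + 1` and off its line, so the previous lemma applies to the
vertex itself. -/
theorem vert_mem_range_of_mem_elem {T T' : Fin M.n} {a : Fin 3} (h : M.vert T a ∈ M.elem T') :
    M.vert T a ∈ range (M.vert T') := by
  have e : a + 1 + 2 = a := by rw [add_assoc, show (1 : Fin 3) + 2 = 0 from rfl, add_zero]
  have := vert_mem_range_of_area_pos (a := a + 1) (M.vert_mem_elem T a) h ?_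
  · rwa [e] at this
  · have := M.pos T
    rw [← area_shift _ (a + 1), e] at this
    exact this

theorem range_eq_of_subset {T T' : Fin M.n} (h : range (M.vert T) ⊆ range (M.vert T')) :
    T = T' := by
  refine M.distinct T T' (Set.eq_of_subset_of_ncard_le h (le_of_eq ?_) (finite_range _))
  rw [← image_univ, ← image_univ, ncard_image_of_injective _ (M.vert_injective T),
    ncard_image_of_injective _ (M.vert_injective T')]

/-- An oriented edge belongs to at most one element. -/
theorem oriented_edge_unique {T T' : Fin M.n} {a a' : Fin 3} (h : M.vert T a = M.vert T' a')
    (h' : M.vert T (a + 1) = M.vert T' (a' + 1)) : T = T' ∧ a = a' := by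
  suffices hT : T = T' by
    subst hT
    exact ⟨rfl, M.vert_injective T h⟩
  obtain ⟨τ, hτ⟩ : ∃ τ, τ = M.vert T (a + 1) - M.vert T a := ⟨_, rfl⟩
  obtain ⟨η, hη⟩ : ∃ η, η = M.vert T (a + 2) - M.vert T a := ⟨_, rfl⟩
  obtain ⟨η', hη'⟩ : ∃ η', η' = M.vert T' (a' + 2) - M.vert T' a' := ⟨_, rfl⟩
  have hD := M.pos T
  have hD' := M.pos T'
  rw [← area_shift _ a, ← hτ, ← hη] at hD
  rw [← area_shift _ a', ← hη', ← h, ← h', ← hτ] at hD'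
  -- Both triangles lie to the left of the oriented edge, so the midpoint pushed slightly to the
  -- left belongs to both. The conditions on ε are the barycentric inequalities for this point.
  have hev : ∀ᶠ ε in nhdsWithin (0 : ℝ) (Ioi 0), 0 < ε ∧ ε < 1 / 2 ∧
      0 < area τ η' / 2 + ε * area η η' ∧
      area τ η' / 2 + ε * area η η' + ε * area τ η < area τ η' := by
    refine Filter.Eventually.and self_mem_nhdsWithin (Filter.Eventually.filter_mono
      nhdsWithin_le_nhds (Filter.Eventually.and ?_ (Filter.Eventually.and ?_ ?_)))
    · exact eventually_lt_nhds (by norm_num)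
    · have : Continuous fun ε : ℝ => area τ η' / 2 + ε * area η η' := by fun_prop
      exact continuousAt_const.eventually_lt this.continuousAt (by linarith)
    · have : Continuous fun ε : ℝ => area τ η' / 2 + ε * area η η' + ε * area τ η := by fun_prop
      exact this.continuousAt.eventually_lt continuousAt_const (by linarith)
  obtain ⟨ε, h0, h1, h2, h3⟩ := hev.exists
  obtain ⟨x, hx⟩ : ∃ x, x = M.vert T a + ((1 / 2 : ℝ) • τ + ε • η) := ⟨_, rfl⟩
  have hxa : x - M.vert T a = (1 / 2 : ℝ) • τ + ε • η := by rw [hx, add_sub_cancel_left]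
  have e1 : area ((1 / 2 : ℝ) • τ + ε • η) η = area τ η / 2 := by
    simp only [area, Pi.add_apply, Pi.smul_apply, smul_eq_mul]; ring
  have e2 : area τ ((1 / 2 : ℝ) • τ + ε • η) = ε * area τ η := by
    simp only [area, Pi.add_apply, Pi.smul_apply, smul_eq_mul]; ring
  have e3 : area ((1 / 2 : ℝ) • τ + ε • η) η' = area τ η' / 2 + ε * area η η' := by
    simp only [area, Pi.add_apply, Pi.smul_apply, smul_eq_mul]; ring
  have hxT : x ∈ M.elem T := by
    refine (coords_of_mem_triangle (M.pos T) a).2 ?_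
    rw [← area_shift _ a, ← hτ, ← hη, hxa, e1, e2]
    exact ⟨by positivity, by positivity, by nlinarith⟩
  have hxT' : x ∈ M.elem T' := by
    refine (coords_of_mem_triangle (M.pos T') a').2 ?_
    rw [← area_shift _ a', ← hη', ← h, ← h', ← hτ, hxa, e3, e2]
    exact ⟨h2.le, by positivity, h3.le⟩
  have hR := vert_mem_range_of_area_pos (a := a) hxT hxT' (by rw [← hτ, hxa, e2]; positivity)
  refine range_eq_of_subset ?_
  rintro _ ⟨i, rfl⟩
  rcases fin_three_cases i a with rfl | rfl | rfl
  · rw [h]; exact mem_range_self _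
  · rw [h']; exact mem_range_self _
  · exact hR

/-- A small step from x away from the third vertex leaves T but stays in Ω. If no other element
contained x, the step would also miss all other elements, which are closed and finite in number,
contradicting the covering. -/
theorem exists_other_elem {T : Fin M.n} {a : Fin 3} (hopen : IsOpen Ω) {x : Plane} (hx : x ∈ Ω)
    (h0 : area (M.vert T (a + 1) - M.vert T a) (x - M.vert T a) = 0) :
    ∃ T', T' ≠ T ∧ x ∈ M.elem T' := by
  by_contra hn
  push Not at hn
  obtain ⟨U, hU⟩ : ∃ U, U = ⋂ T' : {T' // T' ≠ T}, (M.elem T'.1)ᶜ := ⟨_, rfl⟩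
  have hUo : IsOpen U := by
    rw [hU]
    exact isOpen_iInter_of_finite fun T' => (M.isClosed_elem T'.1).isOpen_compl
  have hxU : x ∈ U := by
    rw [hU]
    exact mem_iInter.2 fun T' => hn T'.1 T'.2
  have hc : Continuous fun ε : ℝ => x - ε • (M.vert T (a + 2) - M.vert T a) := by fun_prop
  have hev : ∀ᶠ ε in nhdsWithin (0 : ℝ) (Ioi 0), 0 < ε ∧
      x - ε • (M.vert T (a + 2) - M.vert T a) ∈ U ∩ Ω := by
    refine Filter.Eventually.and self_mem_nhdsWithin (Filter.Eventually.filter_mono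
      nhdsWithin_le_nhds (hc.continuousAt.eventually_mem ((hUo.inter hopen).mem_nhds ?_)))
    simpa using ⟨hxU, hx⟩
  obtain ⟨ε, hε, hyU, hyΩ⟩ := hev.exists
  obtain ⟨S, hS⟩ := M.exists_mem_elem (subset_closure hyΩ)
  by_cases hST : S = T
  · subst hST
    have h1 := ((coords_of_mem_triangle (M.pos S) a).1 hS).2.1
    have hD := M.pos S
    rw [← area_shift _ a] at hD
    have e : area (M.vert S (a + 1) - M.vert S a)
        (x - ε • (M.vert S (a + 2) - M.vert S a) - M.vert S a)
        = area (M.vert S (a + 1) - M.vert S a) (x - M.vert S a)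
          - ε * area (M.vert S (a + 1) - M.vert S a) (M.vert S (a + 2) - M.vert S a) := by
      simp only [area, Pi.sub_apply, Pi.smul_apply, smul_eq_mul]; ring
    rw [e, h0] at h1
    nlinarith
  · rw [hU] at hyU
    exact mem_iInter.1 hyU ⟨S, hST⟩ hS

/-- Every edge with a relatively interior point in `Ω` is, with the opposite orientation, an edge
of another element. -/
theorem exists_reversed_edge {T : Fin M.n} {a : Fin 3} (hopen : IsOpen Ω) {s : ℝ}
    (hs : s ∈ Ioo (0 : ℝ) 1) (hx : M.vert T a + s • M.tangent T a ∈ Ω) :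
    ∃ T' a', M.vert T' a' = M.vert T (a + 1) ∧ M.vert T' (a' + 1) = M.vert T a := by
  have hD := M.pos T
  have hxT : M.vert T a + s • M.tangent T a ∈ M.elem T :=
    segment_mem_triangle _ a (Ioo_subset_Icc_self hs)
  obtain ⟨T', hne, hxT'⟩ := exists_other_elem (T := T) (a := a) hopen hx (by
    rw [add_sub_cancel_left, tangent]
    simp only [area, Pi.smul_apply, smul_eq_mul]; ring)
  have i1 : a + 1 + 2 = a := by rw [add_assoc, show (1 : Fin 3) + 2 = 0 from rfl, add_zero]
  have i2 : a + 2 + 2 = a + 1 := by rw [add_assoc, show (2 : Fin 3) + 2 = 1 from rfl]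
  have i3 : a + 1 + 1 = a + 2 := by rw [add_assoc, show (1 : Fin 3) + 1 = 2 from rfl]
  have i4 : a + 2 + 1 = a := by rw [add_assoc, show (2 : Fin 3) + 1 = 0 from rfl, add_zero]
  rw [← area_shift _ a] at hD
  -- A relatively interior point of the edge is off the lines of the two other edges, which makes
  -- both endpoints shared vertices.
  have hP : M.vert T a ∈ range (M.vert T') := by
    rw [← i1]
    refine vert_mem_range_of_area_pos hxT hxT' ?_
    have : 0 < (1 - s) * area (M.vert T (a + 1) - M.vert T a) (M.vert T (a + 2) - M.vert T a) :=
      mul_pos (by linarith [hs.2]) hD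
    convert this using 1
    rw [i3]
    simp only [area, tangent, Pi.add_apply, Pi.sub_apply, Pi.smul_apply, smul_eq_mul]; ring
  have hQ : M.vert T (a + 1) ∈ range (M.vert T') := by
    rw [← i2]
    refine vert_mem_range_of_area_pos hxT hxT' ?_
    have : 0 < s * area (M.vert T (a + 1) - M.vert T a) (M.vert T (a + 2) - M.vert T a) :=
      mul_pos hs.1 hD
    convert this using 1
    rw [i4]
    simp only [area, tangent, Pi.add_apply, Pi.sub_apply, Pi.smul_apply, smul_eq_mul]; ring
  obtain ⟨i, hi⟩ := hP
  obtain ⟨j, hj⟩ := hQ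
  -- The endpoints are consecutive vertices of T' in one of two orders; the order of T would force
  -- T' = T.
  rcases fin_three_cases i j with rfl | rfl | rfl
  · exact absurd (M.vert_injective T (hi.symm.trans hj)) (by simp)
  · exact ⟨T', j, hj, hi⟩
  · refine absurd (oriented_edge_unique hi ?_).1 hne
    rw [← hj, add_assoc, show (2 : Fin 3) + 1 = 0 from rfl, add_zero]

/-- Edge terms which change sign with the orientation cancel. -/
theorem sum_edges_eq_zero (hopen : IsOpen Ω) {F : Fin M.n → Fin 3 → ℝ}
    (hcancel : ∀ T a T' a', M.vert T' a' = M.vert T (a + 1) → M.vert T' (a' + 1) = M.vert T a →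
      F T a + F T' a' = 0)
    (hzero : ∀ T a, (∀ s ∈ Ioo (0 : ℝ) 1, M.vert T a + s • M.tangent T a ∉ Ω) → F T a = 0) :
    ∑ T, ∑ a, F T a = 0 := by
  classical
  obtain ⟨rev, hrev⟩ : ∃ rev : Fin M.n × Fin 3 → Fin M.n × Fin 3 → Prop, ∀ p q, rev p q ↔
    M.vert q.1 q.2 = M.vert p.1 (p.2 + 1) ∧ M.vert q.1 (q.2 + 1) = M.vert p.1 p.2 :=
    ⟨_, fun _ _ => Iff.rfl⟩
  have hsymm : ∀ p q, rev p q → rev q p := fun p q h =>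
    (hrev q p).2 ⟨((hrev p q).1 h).2.symm, ((hrev p q).1 h).1.symm⟩
  have huniq : ∀ p q q', rev p q → rev p q' → q = q' := by
    intro p q q' h h'
    obtain ⟨h1, h2⟩ := (hrev _ _).1 h
    obtain ⟨h3, h4⟩ := (hrev _ _).1 h'
    obtain ⟨h5, h6⟩ := oriented_edge_unique (h1.trans h3.symm) (h2.trans h4.symm)
    exact Prod.ext h5 h6
  have hsum : ∀ p q, rev p q → F p.1 p.2 + F q.1 q.2 = 0 := fun p q h =>
    hcancel _ _ _ _ ((hrev p q).1 h).1 ((hrev p q).1 h).2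
  have hno : ∀ p, (¬ ∃ q, rev p q) → F p.1 p.2 = 0 := by
    intro p h
    refine hzero _ _ fun s hs hx => h ?_
    obtain ⟨T', a', h1, h2⟩ := exists_reversed_edge hopen hs hx
    exact ⟨(T', a'), (hrev _ _).2 ⟨h1, h2⟩⟩
  rw [← Fintype.sum_prod_type']
  -- Each edge is paired with its reversal. Edges without one are fixed points, where the term is
  -- zero.
  refine Finset.sum_involution (fun p _ => if h : ∃ q, rev p q then h.choose else p) ?_ ?_
    (fun _ _ => Finset.mem_univ _) ?_
  · intro p _
    split_ifs with h
    · exact hsum _ _ h.choose_spec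
    · rw [hno p h, add_zero]
  · intro p _ hp
    split_ifs with h
    · intro he
      have := hsum _ _ h.choose_spec
      rw [he] at this
      exact hp (by linarith)
    · exact absurd (hno p h) hp
  · intro p _
    by_cases h : ∃ q, rev p q
    · have h' : ∃ q, rev h.choose q := ⟨p, hsymm _ _ h.choose_spec⟩
      rw [dif_pos h, dif_pos h']
      exact huniq _ _ _ h'.choose_spec (hsymm _ _ h.choose_spec)
    · rw [dif_neg h, dif_neg h]

end Mesh

end

section

/-! ### The sum of the angles around an interior vertex -/

/-- A complex coordinate on the plane, conformal for the inner product `A`. -/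
def conformalCoord (A : Matrix (Fin 2) (Fin 2) ℝ) (x : Plane) : ℂ :=
  ⟨A 0 0 * x 0 + A 0 1 * x 1, Real.sqrt A.det * x 1⟩

/-- The inverse of `conformalCoord A`. -/
def conformalCoordSymm (A : Matrix (Fin 2) (Fin 2) ℝ) (w : ℂ) : Plane :=
  ![(w.re - A 0 1 * (w.im / Real.sqrt A.det)) / A 0 0, w.im / Real.sqrt A.det]

variable {A : Matrix (Fin 2) (Fin 2) ℝ}

theorem continuous_conformalCoordSymm : Continuous (conformalCoordSymm A) := by
  refine continuous_pi fun i => ?_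
  have hre := Complex.continuous_re
  have him := Complex.continuous_im
  fin_cases i <;> simp only [conformalCoordSymm, Fin.zero_eta, Fin.mk_one, Matrix.cons_val_zero,
    Matrix.cons_val_one] <;> fun_prop

theorem conformalCoordSymm_zero : conformalCoordSymm A 0 = 0 := by
  ext i; fin_cases i <;> simp [conformalCoordSymm]

namespace PosMinors

theorem conformalCoord_symm (hA : PosMinors A) (w : ℂ) :
    conformalCoord A (conformalCoordSymm A w) = w := by
  have h1 := hA.1.ne'
  have h2 := hA.sqrt_pos.ne'
  apply Complex.ext
  · simp only [conformalCoord, conformalCoordSymm, Matrix.cons_val_zero, Matrix.cons_val_one]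
    field_simp
    ring
  · simp only [conformalCoord, conformalCoordSymm, Matrix.cons_val_zero, Matrix.cons_val_one]
    field_simp

theorem conj_mul_conformalCoord_im (X Y : Plane) :
    ((starRingEnd ℂ) (conformalCoord A X) * conformalCoord A Y).im
      = A 0 0 * Real.sqrt A.det * area X Y := by
  simp only [conformalCoord, Complex.mul_im, Complex.conj_re, Complex.conj_im, area]
  ring

theorem conj_mul_conformalCoord_re (hA : PosMinors A) (X Y : Plane) :
    ((starRingEnd ℂ) (conformalCoord A X) * conformalCoord A Y).re = A 0 0 * form A X Y := by
  have h := Real.mul_self_sqrt hA.2.1.le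
  rw [hA.form_eq]
  simp only [conformalCoord, Complex.mul_re, Complex.conj_re, Complex.conj_im]
  have := hA.det_eq
  linear_combination X 1 * Y 1 * (h + this)

theorem norm_conformalCoord (hA : PosMinors A) (X : Plane) :
    ‖conformalCoord A X‖ = Real.sqrt (A 0 0) * Real.sqrt (form A X X) := by
  rw [← Real.sqrt_mul hA.1.le, ← hA.conj_mul_conformalCoord_re, ← Real.sqrt_sq (norm_nonneg _),
    mul_comm ((starRingEnd ℂ) _), Complex.mul_conj, Complex.ofReal_re, Complex.normSq_eq_norm_sq]

/-- The real part and the modulus of the product are `A 0 0` times the inner product and the product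
of the lengths, so their quotient is the argument of the arccosine. The positive imaginary part
selects the matching branch. -/
theorem cornerAngle_eq_arg (hA : PosMinors A) {X Y m : Plane} (hm : Y = -m)
    (h : 0 < area X Y) : cornerAngle A m X
      = Complex.arg ((starRingEnd ℂ) (conformalCoord A X) * conformalCoord A Y) := by
  have him : 0 < ((starRingEnd ℂ) (conformalCoord A X) * conformalCoord A Y).im := by
    rw [conj_mul_conformalCoord_im]
    exact mul_pos (mul_pos hA.1 hA.sqrt_pos) h
  rw [Complex.arg_of_im_nonneg_of_ne_zero him.le (fun h0 => by simp [h0] at him),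
    hA.conj_mul_conformalCoord_re, norm_mul, RCLike.norm_conj, hA.norm_conformalCoord,
    hA.norm_conformalCoord, cornerAngle]
  have e1 : form A m m = form A Y Y := by
    rw [hm]; simp only [form, Pi.neg_apply]; simp
  have e2 : form A (-m) X = form A X Y := by
    rw [← hm, hA.form_eq, hA.form_eq]; ring
  have h1 := hA.1.ne'
  have e3 : Real.sqrt (A 0 0) * Real.sqrt (form A X X) * (Real.sqrt (A 0 0)
      * Real.sqrt (form A Y Y)) = A 0 0 * (Real.sqrt (form A Y Y) * Real.sqrt (form A X X)) := by
    linear_combination Real.sqrt (form A X X) * Real.sqrt (form A Y Y)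
      * Real.mul_self_sqrt hA.1.le
  rw [e1, e2, e3, mul_div_mul_left _ _ h1]

theorem conformalCoord_mem_sector_iff (hA : PosMinors A) {ρ : ℝ} {X Y x : Plane} :
    conformalCoord A x ∈ sector ρ (conformalCoord A X) (conformalCoord A Y) ↔
      ‖conformalCoord A x‖ < ρ ∧ 0 ≤ area X x ∧ 0 ≤ area x Y := by
  have h := mul_pos hA.1 hA.sqrt_pos
  rw [sector, mem_ofPred_eq, conj_mul_conformalCoord_im, conj_mul_conformalCoord_im,
    mul_nonneg_iff_of_pos_left h, mul_nonneg_iff_of_pos_left h]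

end PosMinors

theorem volume_line_eq_zero {z : ℂ} (hz : z ≠ 0) :
    MeasureTheory.volume {w : ℂ | ((starRingEnd ℂ) z * w).im = 0} = 0 := by
  obtain ⟨L, hL⟩ : ∃ L : Submodule ℝ ℂ, L = LinearMap.ker
    (Complex.imLm ∘ₗ LinearMap.mulLeft ℝ ((starRingEnd ℂ) z)) := ⟨_, rfl⟩
  have hset : {w : ℂ | ((starRingEnd ℂ) z * w).im = 0} = L := by
    ext w
    rw [hL]
    simp only [SetLike.mem_coe, LinearMap.mem_ker, LinearMap.comp_apply, LinearMap.mulLeft_apply]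
    rfl
  rw [hset]
  refine MeasureTheory.Measure.addHaar_submodule _ _ fun htop => ?_
  have : Complex.I * z ∈ L := htop ▸ Submodule.mem_top
  rw [← SetLike.mem_coe, ← hset] at this
  have h2 : ((starRingEnd ℂ) z * (Complex.I * z)).im = 0 := this
  rw [show (starRingEnd ℂ) z * (Complex.I * z) = Complex.I * (z * (starRingEnd ℂ) z) by ring,
    Complex.mul_conj, Complex.I_mul_im, Complex.ofReal_re] at h2
  exact hz (Complex.normSq_eq_zero.1 h2)

namespace Mesh

variable {Ω : Set Plane} {M : Mesh Ω}

/-- A small multiple of x added to V lies in both triangles and off the two edges of T at V.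
Conformity then makes the two other vertices of T vertices of T' as well. -/
theorem eq_of_sectors_overlap {T T' : Fin M.n} {a a' : Fin 3} {V x : Plane}
    (hV : M.vert T a = V) (hV' : M.vert T' a' = V)
    (h1 : 0 < area (M.vert T (a + 1) - V) x) (h2 : 0 < area x (M.vert T (a + 2) - V))
    (h1' : 0 ≤ area (M.vert T' (a' + 1) - V) x) (h2' : 0 ≤ area x (M.vert T' (a' + 2) - V)) :
    T = T' := by
  have hev : ∀ {q D : ℝ}, 0 < D → ∀ᶠ ε in nhdsWithin (0 : ℝ) (Ioi 0), ε * q < D := by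
    intro q D hD
    have hc : Continuous fun ε : ℝ => ε * q := by fun_prop
    exact Filter.Eventually.filter_mono nhdsWithin_le_nhds
      (hc.continuousAt.eventually_lt continuousAt_const (by simpa using hD))
  have hall : ∀ᶠ ε in nhdsWithin (0 : ℝ) (Ioi 0), 0 < ε ∧
      ε * (area x (M.vert T (a + 2) - V) + area (M.vert T (a + 1) - V) x)
        < area (M.vert T 1 - M.vert T 0) (M.vert T 2 - M.vert T 0) ∧
      ε * (area x (M.vert T' (a' + 2) - V) + area (M.vert T' (a' + 1) - V) x)
        < area (M.vert T' 1 - M.vert T' 0) (M.vert T' 2 - M.vert T' 0) :=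
    Filter.Eventually.and self_mem_nhdsWithin ((hev (M.pos T)).and (hev (M.pos T')))
  obtain ⟨ε, hε, hD, hD'⟩ := hall.exists
  have e1 : ∀ Y, area (ε • x) Y = ε * area x Y := fun Y => by
    simp only [area, Pi.smul_apply, smul_eq_mul]; ring
  have e2 : ∀ Y, area Y (ε • x) = ε * area Y x := fun Y => by
    simp only [area, Pi.smul_apply, smul_eq_mul]; ring
  have hxT : V + ε • x ∈ M.elem T := by
    refine (coords_of_mem_triangle (M.pos T) a).2 ?_
    rw [hV, add_sub_cancel_left, e1, e2, ← mul_add]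
    exact ⟨by positivity, by positivity, hD.le⟩
  have hxT' : V + ε • x ∈ M.elem T' := by
    refine (coords_of_mem_triangle (M.pos T') a').2 ?_
    rw [hV', add_sub_cancel_left, e1, e2, ← mul_add]
    exact ⟨by positivity, by positivity, hD'.le⟩
  have hR := vert_mem_range_of_area_pos (a := a) hxT hxT' (by
    rw [hV, add_sub_cancel_left, e2]; positivity)
  have hQ := vert_mem_range_of_area_pos (a := a + 2) hxT hxT' (by
    rw [add_assoc a 2 1, show (2 : Fin 3) + 1 = 0 from rfl, add_zero, hV]
    have : 0 < ε * area x (M.vert T (a + 2) - V) := by positivity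
    convert this using 1
    simp only [area, Pi.add_apply, Pi.sub_apply, Pi.smul_apply, smul_eq_mul]; ring)
  rw [add_assoc a 2 2, show (2 : Fin 3) + 2 = 1 from rfl] at hQ
  refine range_eq_of_subset ?_
  rintro _ ⟨i, rfl⟩
  rcases fin_three_cases i a with rfl | rfl | rfl
  · exact ⟨a', hV'.trans hV.symm⟩
  · exact hQ
  · exact hR

/-- Near V only elements containing V occur, since the others are closed and finite in number.
Conformity makes V a vertex of each of them, and two of the barycentric inequalities are the sector
conditions. -/
theorem exists_ball_subset_iUnion (hopen : IsOpen Ω) {V : Plane} (hV : V ∈ Ω)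
    (hvert : V ∈ M.vertices) (hA : PosMinors A) : ∃ ρ > 0, ∀ w ∈ Metric.ball (0 : ℂ) ρ,
      ∃ p : Fin M.n × Fin 3, M.vert p.1 p.2 = V ∧
        w ∈ sector ρ (conformalCoord A (M.vert p.1 (p.2 + 1) - V))
          (conformalCoord A (M.vert p.1 (p.2 + 2) - V)) := by
  obtain ⟨U, hU⟩ : ∃ U, U = ⋂ T : {T // V ∉ M.elem T}, (M.elem T.1)ᶜ := ⟨_, rfl⟩
  have hUo : IsOpen U := by
    rw [hU]
    exact isOpen_iInter_of_finite fun T => (M.isClosed_elem T.1).isOpen_compl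
  have hVU : V ∈ U := by
    rw [hU]
    exact mem_iInter.2 fun T => T.2
  have hc : Continuous fun w : ℂ => V + conformalCoordSymm A w :=
    continuous_const.add continuous_conformalCoordSymm
  obtain ⟨ρ, hρ, hball⟩ := Metric.eventually_nhds_iff_ball.1
    (hc.continuousAt.eventually_mem (x := 0) ((hUo.inter hopen).mem_nhds (by
      rw [conformalCoordSymm_zero, add_zero]; exact ⟨hVU, hV⟩)))
  refine ⟨ρ, hρ, fun w hw => ?_⟩
  obtain ⟨hwU, hwΩ⟩ := hball w hw
  obtain ⟨T, hT⟩ := M.exists_mem_elem (subset_closure hwΩ)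
  have hVT : V ∈ M.elem T := by
    by_contra hn
    rw [hU] at hwU
    exact mem_iInter.1 hwU ⟨T, hn⟩ hT
  obtain ⟨q, -, rfl⟩ := Finset.mem_image.1 hvert
  obtain ⟨a, ha⟩ := vert_mem_range_of_mem_elem hVT
  refine ⟨(T, a), ha, ?_⟩
  have hco := (coords_of_mem_triangle (M.pos T) a).1 hT
  rw [ha, add_sub_cancel_left] at hco
  rw [← hA.conformalCoord_symm w, hA.conformalCoord_mem_sector_iff, hA.conformalCoord_symm]
  exact ⟨by simpa using hw, hco.2.1, hco.1⟩

/-- The corner angles at an interior mesh vertex, measured in one inner product, add up to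
`2π`. -/
theorem sum_cornerAngle (hopen : IsOpen Ω) {V : Plane} (hV : V ∈ Ω)
    (hvert : V ∈ M.vertices) (hA : PosMinors A) :
    ∑ T, ∑ a, (if M.vert T a = V then
      cornerAngle A (M.vert T a - M.vert T (a - 1)) (M.vert T (a + 1) - M.vert T a) else 0)
      = 2 * Real.pi := by
  classical
  obtain ⟨ρ, hρ, hcover⟩ := exists_ball_subset_iUnion hopen hV hvert hA
  obtain ⟨P, hP⟩ : ∃ P : Finset (Fin M.n × Fin 3), P = Finset.univ.filter
    fun p => M.vert p.1 p.2 = V := ⟨_, rfl⟩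
  have hmemP : ∀ p, p ∈ P ↔ M.vert p.1 p.2 = V := fun p => by rw [hP]; simp
  obtain ⟨X, hX⟩ : ∃ X : Fin M.n × Fin 3 → Plane, ∀ p, X p = M.vert p.1 (p.2 + 1) - V :=
    ⟨_, fun _ => rfl⟩
  obtain ⟨Y, hY⟩ : ∃ Y : Fin M.n × Fin 3 → Plane, ∀ p, Y p = M.vert p.1 (p.2 + 2) - V :=
    ⟨_, fun _ => rfl⟩
  have hXY : ∀ p ∈ P, 0 < area (X p) (Y p) := fun p hp => by
    rw [hX, hY, ← (hmemP p).1 hp, area_shift]; exact M.pos p.1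
  have him : ∀ p ∈ P, 0 < ((starRingEnd ℂ) (conformalCoord A (X p))
      * conformalCoord A (Y p)).im := fun p hp => by
    rw [PosMinors.conj_mul_conformalCoord_im]
    exact mul_pos (mul_pos hA.1 hA.sqrt_pos) (hXY p hp)
  have hball : Metric.ball (0 : ℂ) ρ
      = ⋃ p ∈ P, sector ρ (conformalCoord A (X p)) (conformalCoord A (Y p)) := by
    ext w
    simp only [mem_iUnion]
    constructor
    · intro hw
      obtain ⟨p, hp, hwp⟩ := hcover w hw
      exact ⟨p, (hmemP p).2 hp, by rw [hX, hY]; exact hwp⟩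
    · rintro ⟨p, hp, hw⟩
      simpa using hw.1
  -- A common point off the lines bounding the first sector forces the same element and then the
  -- same corner. Hence distinct sectors meet within two lines through 0, a null set.
  have hdisj : (P : Set (Fin M.n × Fin 3)).Pairwise (Function.onFun
      (MeasureTheory.AEDisjoint MeasureTheory.volume)
      fun p => sector ρ (conformalCoord A (X p)) (conformalCoord A (Y p))) := by
    intro p hp q hq hpq
    have hp' := him p hp
    have hzX : conformalCoord A (X p) ≠ 0 := fun h0 => by simp [h0] at hp'
    have hzY : conformalCoord A (Y p) ≠ 0 := fun h0 => by simp [h0] at hp'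
    refine MeasureTheory.measure_mono_null ?_ (MeasureTheory.measure_union_null
      (volume_line_eq_zero hzX) (volume_line_eq_zero hzY))
    rintro w ⟨hw, hw'⟩
    rw [← hA.conformalCoord_symm w] at hw hw' ⊢
    obtain ⟨x, hx⟩ : ∃ x, x = conformalCoordSymm A w := ⟨_, rfl⟩
    rw [← hx] at hw hw' ⊢
    rw [hA.conformalCoord_mem_sector_iff] at hw hw'
    simp only [mem_union, mem_ofPred_eq, PosMinors.conj_mul_conformalCoord_im]
    by_contra hn
    rw [not_or] at hn
    have ha : area (Y p) x = -area x (Y p) := by simp only [area]; ring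
    have n1 : area (X p) x ≠ 0 := fun h0 => hn.1 (by rw [h0, mul_zero])
    have n2 : area x (Y p) ≠ 0 := fun h0 => hn.2 (by rw [ha, h0, neg_zero, mul_zero])
    have hTT : p.1 = q.1 := eq_of_sectors_overlap (x := x) ((hmemP p).1 hp) ((hmemP q).1 hq)
      (by rw [← hX]; exact lt_of_le_of_ne hw.2.1 n1.symm)
      (by rw [← hY]; exact lt_of_le_of_ne hw.2.2 n2.symm)
      (by rw [← hX]; exact hw'.2.1) (by rw [← hY]; exact hw'.2.2)
    refine hpq (Prod.ext hTT (M.vert_injective p.1 ?_))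
    rw [(hmemP p).1 hp, hTT, (hmemP q).1 hq]
  have hvol := MeasureTheory.measure_biUnion_finset₀ (μ := MeasureTheory.volume) hdisj
    fun p _ => (measurableSet_sector ρ _ _).nullMeasurableSet
  have hang : ∀ p ∈ P, cornerAngle A (M.vert p.1 p.2 - M.vert p.1 (p.2 - 1))
      (M.vert p.1 (p.2 + 1) - M.vert p.1 p.2)
      = Complex.arg ((starRingEnd ℂ) (conformalCoord A (X p)) * conformalCoord A (Y p)) := by
    intro p hp
    have hp' := (hmemP p).1 hp
    rw [hp', ← hX]
    refine hA.cornerAngle_eq_arg ?_ (hXY p hp)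
    rw [hY, neg_sub, show p.2 - 1 = p.2 + 2 from by rw [sub_eq_add_neg]; rfl]
  have harg : ∀ p ∈ P, 0 ≤ ρ ^ 2 / 2 * Complex.arg ((starRingEnd ℂ) (conformalCoord A (X p))
      * conformalCoord A (Y p)) := fun p hp =>
    mul_nonneg (by positivity) (Complex.arg_nonneg_iff.2 (him p hp).le)
  -- Comparison of areas: πρ² = ∑ (ρ²/2) · angle.
  rw [← hball, Complex.volume_ball, Finset.sum_congr rfl fun p hp => volume_sector hρ (him p hp),
    ← ENNReal.ofReal_sum_of_nonneg harg, ← Finset.mul_sum] at hvol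
  have hpi : ENNReal.ofReal ρ ^ 2 * (NNReal.pi : ENNReal) = ENNReal.ofReal (ρ ^ 2 * Real.pi) := by
    rw [ENNReal.ofReal_mul (by positivity), ENNReal.ofReal_pow hρ.le, ← NNReal.coe_real_pi,
      ENNReal.ofReal_coe_nnreal]
  rw [hpi, ENNReal.ofReal_eq_ofReal_iff (by positivity)
    (by rw [Finset.mul_sum]; exact Finset.sum_nonneg harg)] at hvol
  rw [← Fintype.sum_prod_type', ← Finset.sum_filter, ← hP, Finset.sum_congr rfl hang]
  have hρ2 : ρ ^ 2 ≠ 0 := by positivity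
  apply mul_left_cancel₀ hρ2
  linear_combination -2 * hvol

end Mesh

end

section

/-! ### The integral representation of the curvature functional -/

theorem posDef_segment {A : Matrix (Fin 2) (Fin 2) ℝ} (hA : A.PosDef) {t : ℝ}
    (ht : t ∈ Icc (0 : ℝ) 1) : (1 + t • (A - 1)).PosDef := by
  rcases ht.1.eq_or_lt with rfl | h0
  · simpa using Matrix.PosDef.one
  · have e : 1 + t • (A - 1) = t • A + (1 - t) • (1 : Matrix (Fin 2) (Fin 2) ℝ) := by
      rw [smul_sub, sub_smul, one_smul]; abel
    rw [e]
    exact (hA.smul h0).add_posSemidef (Matrix.PosSemidef.one.smul (by linarith [ht.2]))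

namespace Mesh

variable {Ω : Set Plane} {M : Mesh Ω} {g : M.PiecewiseTensor} {u : Plane → ℝ}

theorem IsPiecewiseSmoothSym.smoothSym (hg : M.IsPiecewiseSmoothSym g) (T : Fin M.n) :
    SmoothSym (M.elem T) (g T) :=
  ⟨(hg T).1, fun x hx => ((hg T).2 x hx).apply 0 1⟩

theorem IsPiecewiseSmoothSym.smoothSym_deviation (hg : M.IsPiecewiseSmoothSym g) (T : Fin M.n) :
    SmoothSym (M.elem T) (M.deviation g T) := by
  refine ⟨fun i j => ((hg T).1 i j).sub contDiffOn_const, fun x hx => ?_⟩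
  simp [deviation, ((hg T).2 x hx).apply 0 1]

theorem pathPos_deviation {T : Fin M.n} (hpos : ∀ x ∈ M.elem T, (g T x).PosDef) :
    PathPos (M.elem T) (M.deviation g T) := fun _ ht x hx =>
  posMinors_of_posDef (posDef_segment (hpos x hx) ht)

theorem euclidPath_deviation_one (g : M.PiecewiseTensor) (T : Fin M.n) :
    euclidPath (M.deviation g T) 1 = g T := by
  funext x; simp [euclidPath, deviation]

theorem interiorAngle_eq (g : M.PiecewiseTensor) (T : Fin M.n) (a : Fin 3) :
    M.interiorAngle g T a = cornerAngle (g T (M.vert T a)) (M.vert T a - M.vert T (a - 1))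
      (M.vert T (a + 1) - M.vert T a) := by
  simp only [interiorAngle, cornerAngle, tangent, sub_add_cancel]

/-- Each corner of an element sits at exactly one mesh vertex, so a sum over vertices and incident
elements is a sum over corners. -/
theorem sum_vertices_ite (c : Fin M.n → Fin 3 → ℝ) (u : Plane → ℝ) :
    ∑ V ∈ M.vertices, (∑ T, ∑ a, if M.vert T a = V then c T a else 0) * u V
      = ∑ T, ∑ a, u (M.vert T a) * c T a := by
  simp only [Finset.sum_mul]
  rw [Finset.sum_comm]
  refine Finset.sum_congr rfl fun T _ => ?_
  rw [Finset.sum_comm]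
  refine Finset.sum_congr rfl fun a _ => ?_
  rw [Finset.sum_eq_single (M.vert T a)]
  · rw [if_pos rfl, mul_comm]
  · intro V _ hV
    rw [if_neg hV.symm, zero_mul]
  · intro h
    exact absurd (Finset.mem_image.2 ⟨(T, a), Finset.mem_univ _, rfl⟩) h

theorem curvatureFunctional_eq_sum (g : M.PiecewiseTensor) (u : Plane → ℝ) :
    M.curvatureFunctional g u = ∑ T, triangleCurvature (M.vert T) (g T) u
      + ∑ V ∈ M.vertices, M.angleDeficit g V * u V := rfl

theorem bForm_eq_sum (g σ : M.PiecewiseTensor) (u : Plane → ℝ) :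
    M.bForm g σ u = -∑ T, triangleInc (M.vert T) (g T) (σ T) u := by
  simp only [triangleInc, Finset.sum_sub_distrib]
  rfl

theorem angleDeficit_eq_zero (hopen : IsOpen Ω) {V : Plane} (hV : V ∈ Ω) (hvert : V ∈ M.vertices)
    {A : Matrix (Fin 2) (Fin 2) ℝ} (hA : PosMinors A)
    (hg : ∀ T a, M.vert T a = V → g T (M.vert T a) = A) : M.angleDeficit g V = 0 := by
  rw [angleDeficit, ← sum_cornerAngle hopen hV hvert hA, sub_eq_zero]
  refine Finset.sum_congr rfl fun T _ => Finset.sum_congr rfl fun a _ => ?_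
  split_ifs with h
  · rw [interiorAngle_eq, hg T a h]
  · rfl

theorem sum_angleDeficit_mul (g : M.PiecewiseTensor) (u : Plane → ℝ) :
    ∑ V ∈ M.vertices, M.angleDeficit g V * u V
      = ∑ V ∈ M.vertices, 2 * Real.pi * u V - ∑ T, ∑ a, u (M.vert T a) *
        cornerAngle (g T (M.vert T a)) (M.vert T a - M.vert T (a - 1))
          (M.vert T (a + 1) - M.vert T a) := by
  simp only [angleDeficit, sub_mul, Finset.sum_sub_distrib, sum_vertices_ite, interiorAngle_eq]

theorem sum_angleDeficit_mul_eq_zero (hopen : IsOpen Ω) (hu : ∀ x, x ∉ Ω → u x = 0)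
    {A : TensorField} (hA : ∀ x ∈ Ω, PosMinors (A x)) :
    ∑ V ∈ M.vertices, M.angleDeficit (M.restrict A) V * u V = 0 := by
  refine Finset.sum_eq_zero fun V hV => ?_
  by_cases h : V ∈ Ω
  · rw [angleDeficit_eq_zero hopen h hV (hA V h) fun T a ha => by rw [restrict, ha], zero_mul]
  · rw [hu V h, mul_zero]

/-- Summing the triangle identities leaves the weighted Euclidean angles. Together with the terms 2π
u(V) they form the angle deficits of δ tested with u, which vanish; replacing them by the angles of
g gives the deficits of g. -/
theorem curvatureFunctional_eq_integral (hopen : IsOpen Ω) (hg : M.IsPiecewiseSmoothSym g)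
    (hpos : ∀ T, ∀ x ∈ M.elem T, (g T x).PosDef) (hu : M.IsTestFunction u) :
    IntervalIntegrable (fun t => M.bForm (M.metricPath g t) (M.deviation g) u)
        MeasureTheory.volume 0 1 ∧
      M.curvatureFunctional g u
        = 1 / 2 * ∫ t in (0 : ℝ)..1, M.bForm (M.metricPath g t) (M.deviation g) u := by
  have hσ := hg.smoothSym_deviation
  have hpath := fun T => pathPos_deviation (hpos T)
  have hint : ∀ T, IntervalIntegrable (fun t => triangleInc (M.vert T)
      (euclidPath (M.deviation g T) t) (M.deviation g T) u) MeasureTheory.volume 0 1 := fun T =>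
    (integral_triangleInc (M.pos T) (hσ T) (hpath T) (hu.2.1 T)).1
  have hb : (fun t => M.bForm (M.metricPath g t) (M.deviation g) u)
      = fun t => -∑ T, triangleInc (M.vert T) (euclidPath (M.deviation g T) t)
        (M.deviation g T) u := by
    funext t; exact bForm_eq_sum _ _ _
  have hone : ∀ x ∈ Ω, PosMinors ((fun _ => 1 : TensorField) x) := fun x _ =>
    posMinors_of_posDef Matrix.PosDef.one
  have h0 := sum_angleDeficit_mul_eq_zero (M := M) hopen hu.2.2 hone
  rw [sum_angleDeficit_mul] at h0
  have hT := Finset.sum_congr (rfl : (Finset.univ : Finset (Fin M.n)) = Finset.univ) fun T _ =>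
    triangleCurvature_eq_integral (M.pos T) (hσ T) (hpath T) (hu.2.1 T)
  simp only [euclidPath_deviation_one, Finset.sum_sub_distrib, restrict, ← Finset.sum_div,
    Finset.sum_neg_distrib] at hT h0
  rw [hb]
  have hsum : IntervalIntegrable (fun t => ∑ T, triangleInc (M.vert T)
      (euclidPath (M.deviation g T) t) (M.deviation g T) u) MeasureTheory.volume 0 1 := by
    have := IntervalIntegrable.sum Finset.univ fun T (_ : T ∈ Finset.univ) => hint T
    rwa [Finset.sum_fn] at this
  refine ⟨hsum.neg, ?_⟩
  rw [curvatureFunctional_eq_sum, sum_angleDeficit_mul, intervalIntegral.integral_neg,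
    intervalIntegral.integral_finsetSum fun T _ => hint T]
  linear_combination hT + h0

end Mesh

end

section

/-! ### Existence and uniqueness of the curvature approximation -/

/-! ### Linearity of the curvature of a triangle in the test function -/

section triangle

variable {v : Fin 3 → Plane} {g : TensorField} {φ ψ : Plane → ℝ}

theorem triangleCurvature_add (hv : 0 < area (v 1 - v 0) (v 2 - v 0))
    (hg : SmoothSym (convexHull ℝ (range v)) g)
    (hpos : ∀ x ∈ convexHull ℝ (range v), PosMinors (g x))
    (hφ : ContinuousOn φ (convexHull ℝ (range v))) (hψ : ContinuousOn ψ (convexHull ℝ (range v))) :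
    triangleCurvature v g (fun x => φ x + ψ x)
      = triangleCurvature v g φ + triangleCurvature v g ψ := by
  have hS := uniqueDiffOn_triangle hv
  have hK := continuousOn_gaussCurvature_mul_sqrt_det hS (triangle_subset_closure_interior hv)
    hg hpos
  have iK : ∀ {f}, ContinuousOn f (convexHull ℝ (range v)) → MeasureTheory.IntegrableOn
      (fun x => gaussCurvature (convexHull ℝ (range v)) g x * f x * Real.sqrt (g x).det)
      (convexHull ℝ (range v)) := fun hf =>
    ((hK.mul hf).congr fun x _ => mul_right_comm _ _ _).integrableOn_compact
      (isCompact_triangle v)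
  have iκ : ∀ {f}, ContinuousOn f (convexHull ℝ (range v)) → ∀ a, IntervalIntegrable (fun s : ℝ =>
      geodesicCurvature (convexHull ℝ (range v)) g (v (a + 1) - v a)
        (v a + s • (v (a + 1) - v a)) * f (v a + s • (v (a + 1) - v a))
      * Real.sqrt (form (g (v a + s • (v (a + 1) - v a))) (v (a + 1) - v a) (v (a + 1) - v a)))
      MeasureTheory.volume 0 1 := fun {f} hf a => by
    refine intervalIntegrable_edge (v := v) (f := fun x =>
      geodesicCurvature (convexHull ℝ (range v)) g (v (a + 1) - v a) x * f x
        * Real.sqrt (form (g x) (v (a + 1) - v a) (v (a + 1) - v a))) ?_ a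
    exact ((continuousOn_geodesicCurvature_mul_length hS hg hpos (tangent_ne_zero hv a)).mul
      hf).congr fun x _ => mul_right_comm _ _ _
  simp only [triangleCurvature, mul_add, add_mul]
  rw [MeasureTheory.integral_add (iK hφ) (iK hψ),
    Finset.sum_congr rfl fun a _ => intervalIntegral.integral_add (iκ hφ a) (iκ hψ a),
    Finset.sum_add_distrib]
  ring

theorem triangleCurvature_const_mul (v : Fin 3 → Plane) (g : TensorField) (c : ℝ)
    (φ : Plane → ℝ) :
    triangleCurvature v g (fun x => c * φ x) = c * triangleCurvature v g φ := by
  have e : ∀ p q r : ℝ, p * (c * q) * r = c * (p * q * r) := fun p q r => by ring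
  simp only [triangleCurvature, e, intervalIntegral.integral_const_mul,
    MeasureTheory.integral_const_mul, mul_add, Finset.mul_sum]

end triangle

namespace Mesh

variable {Ω : Set Plane} {M : Mesh Ω} {g : M.PiecewiseTensor} {u w : Plane → ℝ} {k : ℕ}

theorem IsTestFunction.continuousOn_elem (hu : M.IsTestFunction u) (T : Fin M.n) :
    ContinuousOn u (M.elem T) := (hu.2.1 T).continuousOn

theorem curvatureFunctional_add (hg : M.IsPiecewiseSmoothSym g)
    (hpos : ∀ T, ∀ x ∈ M.elem T, (g T x).PosDef) (hu : M.IsTestFunction u)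
    (hw : M.IsTestFunction w) : M.curvatureFunctional g (fun x => u x + w x)
      = M.curvatureFunctional g u + M.curvatureFunctional g w := by
  simp only [curvatureFunctional_eq_sum, mul_add, Finset.sum_add_distrib]
  rw [Finset.sum_congr rfl fun T _ => triangleCurvature_add (M.pos T) (hg.smoothSym T)
    (fun x hx => posMinors_of_posDef (hpos T x hx)) (hu.continuousOn_elem T)
    (hw.continuousOn_elem T), Finset.sum_add_distrib]
  ring

theorem curvatureFunctional_const_mul (g : M.PiecewiseTensor) (c : ℝ) (u : Plane → ℝ) :
    M.curvatureFunctional g (fun x => c * u x) = c * M.curvatureFunctional g u := by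
  simp only [curvatureFunctional_eq_sum, triangleCurvature_const_mul, mul_add, Finset.mul_sum,
    mul_left_comm]

theorem meshIntegral_add {f h : Plane → ℝ} (hg : M.IsPiecewiseSmoothSym g)
    (hf : ∀ T, ContinuousOn f (M.elem T)) (hh : ∀ T, ContinuousOn h (M.elem T)) :
    M.meshIntegral g (fun x => f x + h x) = M.meshIntegral g f + M.meshIntegral g h := by
  have hi : ∀ {f : Plane → ℝ} {T}, ContinuousOn f (M.elem T) → MeasureTheory.IntegrableOn
      (fun x => f x * Real.sqrt (g T x).det) (M.elem T) := fun {f T} hf =>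
    (hf.mul (hg.smoothSym T).contDiffOn_det.continuousOn.sqrt).integrableOn_compact
      (isCompact_triangle _)
  simp only [meshIntegral, elemIntegral, add_mul]
  rw [Finset.sum_congr rfl fun T _ => MeasureTheory.integral_add (hi (hf T)) (hi (hh T)),
    Finset.sum_add_distrib]

theorem meshIntegral_const_mul (g : M.PiecewiseTensor) (c : ℝ) (f : Plane → ℝ) :
    M.meshIntegral g (fun x => c * f x) = c * M.meshIntegral g f := by
  simp only [meshIntegral, elemIntegral, mul_assoc, MeasureTheory.integral_const_mul,
    Finset.mul_sum]

/-- On each element the integrand is nonnegative, hence zero almost everywhere. By continuity it is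
zero on the whole element, as this lies in the closure of its interior. -/
theorem eq_zero_of_meshIntegral_sq_eq_zero (hg : M.IsPiecewiseSmoothSym g)
    (hpos : ∀ T, ∀ x ∈ M.elem T, (g T x).PosDef) (hu : M.IsTestFunction u)
    (h : M.meshIntegral g (fun x => u x * u x) = 0) : u = 0 := by
  have hnn : ∀ T x, 0 ≤ u x * u x * Real.sqrt (g T x).det := fun T x =>
    mul_nonneg (mul_self_nonneg _) (Real.sqrt_nonneg _)
  have hc : ∀ T, ContinuousOn (fun x => u x * u x * Real.sqrt (g T x).det) (M.elem T) := fun T =>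
    ((hu.continuousOn_elem T).mul (hu.continuousOn_elem T)).mul
      (hg.smoothSym T).contDiffOn_det.continuousOn.sqrt
  rw [meshIntegral, Finset.sum_eq_zero_iff_of_nonneg fun T _ =>
    MeasureTheory.integral_nonneg fun x => hnn T x] at h
  funext x
  by_cases hx : x ∈ Ω
  · obtain ⟨T, hT⟩ := M.exists_mem_elem (subset_closure hx)
    have hae := (MeasureTheory.setIntegral_eq_zero_iff_of_nonneg_ae
      (Filter.Eventually.of_forall fun x => hnn T x)
      ((hc T).integrableOn_compact (isCompact_triangle _))).1 (h T (Finset.mem_univ T))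
    have h0 := MeasureTheory.Measure.eqOn_of_ae_eq hae (hc T) continuousOn_const
      (triangle_subset_closure_interior (M.pos T)) hT
    have hd := (posMinors_of_posDef (hpos T x hT)).sqrt_pos.ne'
    have h1 : u x * u x * Real.sqrt (g T x).det = 0 := h0
    simpa [hd] using h1
  · exact hu.2.2 x hx

theorem IsTestFunction.add (hu : M.IsTestFunction u) (hw : M.IsTestFunction w) :
    M.IsTestFunction (u + w) :=
  ⟨hu.1.add hw.1, fun T => (hu.2.1 T).add (hw.2.1 T), fun x hx => by
    simp [hu.2.2 x hx, hw.2.2 x hx]⟩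

theorem IsTestFunction.const_smul (c : ℝ) (hu : M.IsTestFunction u) : M.IsTestFunction (c • u) :=
  ⟨hu.1.const_smul c, fun T => contDiffOn_const.smul (hu.2.1 T), fun x hx => by
    simp [hu.2.2 x hx]⟩

variable (M) in
/-- The Lagrange space as a submodule. -/
def lagrange (k : ℕ) : Submodule ℝ (Plane → ℝ) where
  carrier := {u | M.IsLagrange k u}
  zero_mem' := ⟨⟨continuousOn_const, fun _ => contDiffOn_const, fun _ _ => rfl⟩,
    fun _ => ⟨0, by simp, by simp⟩⟩
  add_mem' := by
    rintro u w ⟨hu, hup⟩ ⟨hw, hwp⟩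
    refine ⟨hu.add hw, fun T => ?_⟩
    obtain ⟨p, hp, hp'⟩ := hup T
    obtain ⟨q, hq, hq'⟩ := hwp T
    exact ⟨p + q, (MvPolynomial.totalDegree_add p q).trans (max_le hp hq), fun x hx => by
      simp [hp' x hx, hq' x hx]⟩
  smul_mem' := by
    rintro c u ⟨hu, hup⟩
    refine ⟨hu.const_smul c, fun T => ?_⟩
    obtain ⟨p, hp, hp'⟩ := hup T
    exact ⟨c • p, (MvPolynomial.totalDegree_smul_le c p).trans hp, fun x hx => by
      simp [hp' x hx]⟩

variable (M) in
open Classical in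
/-- The function glued from one polynomial for every element. -/
def gluePolynomials (k : ℕ) :
    (Fin M.n → MvPolynomial.restrictTotalDegree (Fin 2) ℝ k) →ₗ[ℝ] (Plane → ℝ) where
  -- On shared edges the choice of element is arbitrary. This is harmless: the map only has to reach
  -- every Lagrange function, whose polynomials agree there.
  toFun p x := if h : ∃ T, x ∈ M.elem T then
    MvPolynomial.eval x (p h.choose : MvPolynomial (Fin 2) ℝ) else 0
  map_add' p q := by
    funext x
    by_cases h : ∃ T, x ∈ M.elem T <;> simp [h]
  map_smul' c p := by
    funext x
    by_cases h : ∃ T, x ∈ M.elem T <;> simp [h]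

theorem lagrange_le_range (k : ℕ) : M.lagrange k ≤ LinearMap.range (M.gluePolynomials k) := by
  rintro u ⟨hu, hup⟩
  choose p hp hp' using hup
  refine ⟨fun T => ⟨p T, (MvPolynomial.mem_restrictTotalDegree _ _ _).2 (hp T)⟩, ?_⟩
  funext x
  by_cases h : ∃ T, x ∈ M.elem T
  · simp only [gluePolynomials, LinearMap.coe_mk, AddHom.coe_mk, dif_pos h]
    exact (hp' _ x h.choose_spec).symm
  · simp only [gluePolynomials, LinearMap.coe_mk, AddHom.coe_mk, dif_neg h]
    exact (hu.2.2 x fun hx => h (M.exists_mem_elem (subset_closure hx))).symm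

instance (k : ℕ) : FiniteDimensional ℝ (M.lagrange k) :=
  Submodule.finiteDimensional_of_le (lagrange_le_range k)

/-- The mass form is definite, so it maps the Lagrange space injectively into its dual, and by
finite dimension bijectively. The solution is the preimage of the curvature functional. -/
theorem existsUnique_isCurvatureApprox (hg : M.IsPiecewiseSmoothSym g)
    (hpos : ∀ T, ∀ x ∈ M.elem T, (g T x).PosDef) (k : ℕ) :
    ∃! K : Plane → ℝ, M.IsCurvatureApprox g k K := by
  have hc : ∀ (u w : M.lagrange (k + 1)) T,
      ContinuousOn (fun x => u.1 x * w.1 x) (M.elem T) := fun u w T =>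
    (u.2.1.continuousOn_elem T).mul (w.2.1.continuousOn_elem T)
  let B : M.lagrange (k + 1) →ₗ[ℝ] Module.Dual ℝ (M.lagrange (k + 1)) :=
    LinearMap.mk₂ ℝ (fun u w => M.meshIntegral g (fun x => u.1 x * w.1 x))
      (fun u u' w => by
        rw [← meshIntegral_add hg (hc u w) (hc u' w)]
        simp [add_mul])
      (fun c u w => by
        rw [smul_eq_mul, ← meshIntegral_const_mul]
        simp [mul_assoc])
      (fun u w w' => by
        rw [← meshIntegral_add hg (hc u w) (hc u w')]
        simp [mul_add])
      (fun c u w => by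
        rw [smul_eq_mul, ← meshIntegral_const_mul]
        simp [mul_left_comm])
  let L : Module.Dual ℝ (M.lagrange (k + 1)) :=
    { toFun := fun u => M.curvatureFunctional g u.1
      map_add' := fun u w => curvatureFunctional_add hg hpos u.2.1 w.2.1
      map_smul' := fun c u => curvatureFunctional_const_mul g c u.1 }
  have hinj : Function.Injective B := by
    refine (injective_iff_map_eq_zero B).2 fun u hu => Subtype.ext ?_
    exact eq_zero_of_meshIntegral_sq_eq_zero hg hpos u.2.1 (LinearMap.congr_fun hu u)
  have hsurj := (LinearMap.injective_iff_surjective_of_finrank_eq_finrank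
    (Subspace.dual_finrank_eq (K := ℝ) (V := M.lagrange (k + 1))).symm).1 hinj
  obtain ⟨K, hK⟩ := hsurj L
  refine ⟨K.1, ⟨K.2, fun u hu => LinearMap.congr_fun hK ⟨u, hu⟩⟩, fun K' hK' => ?_⟩
  have : B ⟨K', hK'.1⟩ = B K := by
    rw [hK]
    exact LinearMap.ext fun u => hK'.2 u.1 u.2
  exact congrArg Subtype.val (hinj this)

end Mesh

end

section

/-! ### Smooth metrics -/

/-! ### Independence of the curvatures from the set in which derivatives are taken -/

section restriction

variable {S S' : Set Plane} {g : TensorField} {x τ : Plane}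

theorem SmoothSym.mono (hg : SmoothSym S g) (hSS : S' ⊆ S) : SmoothSym S' g :=
  ⟨fun i j => (hg.1 i j).mono hSS, fun x hx => hg.2 x (hSS hx)⟩

theorem christoffel₁_mono (hSS : S' ⊆ S) (hS' : UniqueDiffOn ℝ S') (hg : SmoothSym S g)
    (hx : x ∈ S') (i j l : Fin 2) : christoffel₁ S' g i j l x = christoffel₁ S g i j l x := by
  simp only [christoffel₁, pd_mono hSS (hS' x hx)
    (differentiableWithinAt_of_smooth (hg.1 _ _) (hSS hx))]

theorem christoffel₂_mono (hSS : S' ⊆ S) (hS' : UniqueDiffOn ℝ S') (hg : SmoothSym S g)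
    (hx : x ∈ S') (i j k : Fin 2) : christoffel₂ S' g i j k x = christoffel₂ S g i j k x := by
  simp only [christoffel₂, christoffel₁_mono hSS hS' hg hx]

/-- The functional differentiates within each element, the target integral within `closure Ω`. The
two agree because the connection form involves only first derivatives of g and is itself smooth on
the larger set. -/
theorem gaussCurvature_mono (hSS : S' ⊆ S) (hS : UniqueDiffOn ℝ S) (hS' : UniqueDiffOn ℝ S')
    (hcl : S ⊆ closure (interior S)) (hcl' : S' ⊆ closure (interior S')) (hg : SmoothSym S g)
    (hpos : ∀ x ∈ S, PosMinors (g x)) (hx : x ∈ S') :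
    gaussCurvature S' g x = gaussCurvature S g x := by
  have hd := (hpos x (hSS hx)).sqrt_pos.ne'
  have hw : ∀ i, EqOn (connForm S' g i) (connForm S g i) S' := fun i y hy => by
    simp only [connForm, christoffel₁_mono hSS hS' hg hy]
  have hc := fun i => differentiableWithinAt_of_smooth (contDiffOn_connForm hS hg hpos i) (hSS hx)
  apply mul_right_cancel₀ hd
  rw [gaussCurvature_mul_sqrt_det hS hcl hg hpos (hSS hx),
    gaussCurvature_mul_sqrt_det hS' hcl' (hg.mono hSS) (fun y hy => hpos y (hSS hy)) hx,
    pd_congr (hw 1) hx, pd_congr (hw 0) hx, pd_mono hSS (hS' x hx) (hc 1),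
    pd_mono hSS (hS' x hx) (hc 0)]

theorem geodesicCurvature_mul_length_mono (hSS : S' ⊆ S) (hS : UniqueDiffOn ℝ S)
    (hS' : UniqueDiffOn ℝ S') (hg : SmoothSym S g) (hpos : ∀ x ∈ S, PosMinors (g x))
    (hτ : τ ≠ 0) (hx : x ∈ S') :
    geodesicCurvature S' g τ x * Real.sqrt (form (g x) τ τ)
      = geodesicCurvature S g τ x * Real.sqrt (form (g x) τ τ) := by
  rw [geodesicCurvature_mul_length hS hg hpos (hSS hx) hτ,
    geodesicCurvature_mul_length hS' (hg.mono hSS) (fun y hy => hpos y (hSS hy)) hx hτ]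
  simp only [christoffel₂_mono hSS hS' hg hx]

/-- By `geodesicCurvature_mul_length` the density is a cubic form in τ divided by a quadratic one,
hence odd in τ. -/
theorem geodesicCurvature_mul_length_neg (hS : UniqueDiffOn ℝ S) (hg : SmoothSym S g)
    (hpos : ∀ x ∈ S, PosMinors (g x)) (hτ : τ ≠ 0) (hx : x ∈ S) :
    geodesicCurvature S g (-τ) x * Real.sqrt (form (g x) (-τ) (-τ))
      = -(geodesicCurvature S g τ x * Real.sqrt (form (g x) τ τ)) := by
  have hf : form (g x) (-τ) (-τ) = form (g x) τ τ := by
    simp only [ReggeCurvature.form_eq, Pi.neg_apply]; ring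
  rw [geodesicCurvature_mul_length hS hg hpos hx hτ,
    geodesicCurvature_mul_length hS hg hpos hx (neg_ne_zero.2 hτ), hf]
  simp only [Fin.sum_univ_two, Pi.neg_apply]
  ring

end restriction

namespace Mesh

variable {Ω : Set Plane} {M : Mesh Ω} {gex : TensorField} {u : Plane → ℝ}

/-- Unique differentiability passes from an element containing the point to the larger set. -/
theorem uniqueDiffOn_closure (M : Mesh Ω) : UniqueDiffOn ℝ (closure Ω) := fun x hx => by
  obtain ⟨T, hT⟩ := M.exists_mem_elem hx
  exact (uniqueDiffOn_triangle (M.pos T) x hT).mono (M.elem_subset T)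

theorem closure_subset_closure_interior (hopen : IsOpen Ω) :
    closure Ω ⊆ closure (interior (closure Ω)) :=
  closure_mono (interior_maximal subset_closure hopen)

end Mesh

theorem IsSmoothMetric.smoothSym {Ω : Set Plane} {gex : TensorField} (h : IsSmoothMetric Ω gex) :
    SmoothSym (closure Ω) gex :=
  ⟨h.1, fun x hx => (posMinors_of_posDef (h.2 x hx)).2.2⟩

namespace Mesh

variable {Ω : Set Plane} {M : Mesh Ω} {gex : TensorField} {u : Plane → ℝ}

theorem isPiecewiseSmoothSym_restrict (h : IsSmoothMetric Ω gex) :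
    M.IsPiecewiseSmoothSym (M.restrict gex) := fun T => by
  refine ⟨fun i j => (h.1 i j).mono (M.elem_subset T), fun x hx => ?_⟩
  have := (h.2 x (M.elem_subset T hx)).isHermitian
  rwa [Matrix.IsHermitian, Matrix.conjTranspose_eq_transpose_of_trivial] at this

/-- Measured within `closure Ω`, the curvature density is the same for all elements and odd in the
tangent, so an edge and its reversal cancel. An edge whose relative interior misses Ω contributes
nothing because u is zero there. -/
theorem sum_edgeIntegral_eq_zero (hopen : IsOpen Ω) (h : IsSmoothMetric Ω gex)
    (hu : ∀ x, x ∉ Ω → u x = 0) :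
    ∑ T, ∑ a, M.edgeIntegral (M.restrict gex) T a
      (fun x => geodesicCurvature (M.elem T) gex (M.tangent T a) x * u x) = 0 := by
  have hS := M.uniqueDiffOn_closure
  have hpos : ∀ x ∈ closure Ω, PosMinors (gex x) := fun x hx => posMinors_of_posDef (h.2 x hx)
  have hτ : ∀ T a, M.tangent T a ≠ 0 := fun T a => tangent_ne_zero (M.pos T) a
  have hmem : ∀ T a, ∀ s ∈ Icc (0 : ℝ) 1, M.vert T a + s • M.tangent T a ∈ M.elem T :=
    fun T a s hs => segment_mem_triangle _ a hs
  obtain ⟨q, hq⟩ : ∃ q : Plane → Plane → ℝ, ∀ τ x, q τ x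
      = geodesicCurvature (closure Ω) gex τ x * Real.sqrt (form (gex x) τ τ) * u x :=
    ⟨_, fun _ _ => rfl⟩
  have hF : ∀ T a, M.edgeIntegral (M.restrict gex) T a
      (fun x => geodesicCurvature (M.elem T) gex (M.tangent T a) x * u x)
      = ∫ s in (0 : ℝ)..1, q (M.tangent T a) (M.vert T a + s • M.tangent T a) := by
    intro T a
    refine intervalIntegral.integral_congr fun s hs => ?_
    rw [uIcc_of_le zero_le_one] at hs
    simp only [restrict, hq]
    rw [mul_right_comm, geodesicCurvature_mul_length_mono (M.elem_subset T) hS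
      (uniqueDiffOn_triangle (M.pos T)) h.smoothSym hpos (hτ T a) (hmem T a s hs)]
  simp only [hF]
  refine sum_edges_eq_zero hopen ?_ ?_
  · intro T a T' a' h1 h2
    have ht : M.tangent T' a' = -M.tangent T a := by
      rw [tangent, tangent, h1, h2, neg_sub]
    have hflip := intervalIntegral.integral_comp_sub_left (a := 0) (b := 1)
      (fun s : ℝ => q (M.tangent T a) (M.vert T a + s • M.tangent T a)) 1
    rw [sub_self, sub_zero] at hflip
    rw [← hflip, ← neg_eq_iff_add_eq_zero, ← intervalIntegral.integral_neg]
    refine intervalIntegral.integral_congr fun s hs => ?_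
    rw [uIcc_of_le zero_le_one] at hs
    have hx : M.vert T' a' + s • M.tangent T' a' = M.vert T a + (1 - s) • M.tangent T a := by
      rw [ht, h1, ← sub_eq_zero, tangent]
      module
    have hmem' : M.vert T a + (1 - s) • M.tangent T a ∈ closure Ω :=
      M.elem_subset T (hmem T a _ ⟨by linarith [hs.2], by linarith [hs.1]⟩)
    simp only [hq]
    rw [hx, ht, geodesicCurvature_mul_length_neg hS h.smoothSym hpos (hτ T a) hmem', neg_mul]
  · intro T a hout
    -- The hypothesis concerns only interior parameters; the endpoint is null.
    rw [intervalIntegral.integral_of_le zero_le_one, MeasureTheory.integral_Ioc_eq_integral_Ioo]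
    refine MeasureTheory.setIntegral_eq_zero_of_forall_eq_zero fun s hs => ?_
    rw [hq, hu _ (hout s hs), mul_zero]

/-- The edge terms cancel, the deficits vanish at vertices in Ω and u vanishes at the others, so
only the element terms survive. -/
theorem curvatureFunctional_restrict (hopen : IsOpen Ω) (h : IsSmoothMetric Ω gex)
    (hu : ∀ x, x ∉ Ω → u x = 0) :
    M.curvatureFunctional (M.restrict gex) u
      = M.meshIntegral (M.restrict gex) (fun x => gaussCurvature (closure Ω) gex x * u x) := by
  have hpos : ∀ x ∈ closure Ω, PosMinors (gex x) := fun x hx => posMinors_of_posDef (h.2 x hx)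
  have hE := sum_edgeIntegral_eq_zero (M := M) hopen h hu
  rw [curvatureFunctional, sum_angleDeficit_mul_eq_zero hopen hu
    fun x hx => hpos x (subset_closure hx), add_zero, Finset.sum_add_distrib]
  simp only [restrict] at hE ⊢
  rw [hE, add_zero, meshIntegral]
  refine Finset.sum_congr rfl fun T _ =>
    MeasureTheory.setIntegral_congr_fun (M.isClosed_elem T).measurableSet fun x hx => ?_
  simp only [gaussCurvature_mono (M.elem_subset T) M.uniqueDiffOn_closure
    (uniqueDiffOn_triangle (M.pos T)) (closure_subset_closure_interior hopen)
    (triangle_subset_closure_interior (M.pos T)) h.smoothSym hpos hx]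

end Mesh

end

end ReggeCurvature

end

/-! ### The theorem -/

theorem mainTheorem6 (Ω : Set ReggeCurvature.Plane) (hopen : IsOpen Ω) (hconn : IsConnected Ω)
    (hbdd : Bornology.IsBounded Ω) (M : ReggeCurvature.Mesh Ω)
    (g : M.PiecewiseTensor) (hg : M.IsReggeMetric g) (k : ℕ)
    (gex : ReggeCurvature.TensorField) (hgex : ReggeCurvature.IsSmoothMetric Ω gex) :
    (∃! K : ReggeCurvature.Plane → ℝ, M.IsCurvatureApprox g k K) ∧
    (∀ K : ReggeCurvature.Plane → ℝ, M.IsCurvatureApprox g k K →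
      ∀ u : ReggeCurvature.Plane → ℝ, M.IsLagrange (k + 1) u →
        IntervalIntegrable (fun t => M.bForm (M.metricPath g t) (M.deviation g) u)
          MeasureTheory.volume 0 1 ∧
        M.meshIntegral g (fun x => K x * u x)
          = 1 / 2 * ∫ t in (0 : ℝ)..1, M.bForm (M.metricPath g t) (M.deviation g) u) ∧
    (∀ u : ReggeCurvature.Plane → ℝ, M.IsTestFunction u →
      IntervalIntegrable
        (fun t => M.bForm (M.metricPath (M.restrict gex) t) (M.deviation (M.restrict gex)) u)
        MeasureTheory.volume 0 1 ∧
      M.meshIntegral (M.restrict gex)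
          (fun x => ReggeCurvature.gaussCurvature (closure Ω) gex x * u x)
        = 1 / 2 * ∫ t in (0 : ℝ)..1,
            M.bForm (M.metricPath (M.restrict gex) t) (M.deviation (M.restrict gex)) u) := by
  have hsm := hg.1.1
  have hrs := ReggeCurvature.Mesh.isPiecewiseSmoothSym_restrict (M := M) hgex
  refine ⟨ReggeCurvature.Mesh.existsUnique_isCurvatureApprox hsm hg.2 k, fun K hK u hu => ?_,
    fun u hu => ?_⟩
  · obtain ⟨h1, h2⟩ :=
      ReggeCurvature.Mesh.curvatureFunctional_eq_integral hopen hsm hg.2 hu.1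
    exact ⟨h1, (hK.2 u hu).trans h2⟩
  · obtain ⟨h1, h2⟩ := ReggeCurvature.Mesh.curvatureFunctional_eq_integral hopen hrs
      (fun T x hx => hgex.2 x (M.elem_subset T hx)) hu
    exact ⟨h1, (ReggeCurvature.Mesh.curvatureFunctional_restrict hopen hgex hu.2.2).symm.trans h2⟩
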